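/- Let $N\ge 0$ and let $M$ be one of the following Kähler manifolds. (a) $M=\mathbb{C}P^N$, with its $N+1$ inhomogeneous coordinate charts $z=(z^1,\dots,z^N)\in\mathbb{C}^N$ and, in each of them, the Kähler potential $\Phi=\ln(1+|z|^2)$. (b) $M=\mathbb{C}H^N=\{z\in\mathbb{C}^N : |z|^2<1\}$, with the Kähler potential $\Phi=-\ln(1-|z|^2)$. Write $\partial_k=\partial/\partial z^k$, $\partial_{\bar k}=\partial/\partial\bar z^k$, $g_{k\bar l}=\partial_k\partial_{\bar l}\Phi$, let $(g^{\bar k l})$ be the inverse matrix, $D^{\bar\imath}=\sum_j g^{\bar\imath j}\partial_j$, and let $ds^2=2g_{k\bar l}\,dz^k d\bar z^l$ be the metric, with Riemannian volume form $\sqrt g\,dz^1\cdots dz^N d\bar z^1\cdots d\bar z^N$, that is, $2^N\,|\det(g_{k\bar l})|$ times Lebesgue measure on $\mathbb{C}^N$ in any of the above charts (the complement of each chart in $M$ is a null set). There is exactly one family of maps $C_n:C^\infty(M)\times C^\infty(M)\to C^\infty(M)$, $n\ge 0$ (complex-valued smooth functions; $\hbar$ is a formal parameter), defining Karabegov's star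 product with separation of variables $F*G=\sum_{n\ge0}\hbar^n C_n(F,G)$, i.e. such that for every $F\in C^\infty(M)$ one has, in each of the above charts, $F*G=L_F\,G$ for all $G\in C^\infty(M)$, where $L_F=\sum_{n\ge0}\hbar^n A^{(n)}$, each $A^{(n)}=\sum_{k\le m_n}\sum_{i_1,\dots,i_k}a^{(n;k)}_{\bar\imath_1\cdots\bar\imath_k}D^{\bar\imath_1}\cdots D^{\bar\imath_k}$ is a differential operator of finite order with smooth coefficients containing only derivatives in the $z^i$, and $$L_F\,1=F,\qquad [L_F,\ \partial_{\bar\imath}\Phi+\hbar\,\partial_{\bar\imath}]=0\quad(i=1,\dots,N).$$ For this star product the Riemannian volume form is a trace density: for all compactly supported smooth functions $F,G$ on $M$ (on the compact space $\mathbb{C}P^N$: for all smooth functions), all coefficients of $F*G$ and $G*F$ are integrable and $$\int_M F*G\,\sqrt g\,dz^1\cdots dz^N d\bar z^1\cdots d\bar z^N=\int_M G*F\,\sqrt g\,dz^1\cdots dz^N d\bar z^1\cdots d\bar z^N$$ as formal power series in $\hbar$, i.e. coefficient by coefficient. -/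

import Mathlib

open scoped ContDiff LinearAlgebra.Projectivization

noncomputable section

namespace KarabegovTrace

/-- The coordinate space `ℂ^N`. -/
abbrev V (N : ℕ) : Type := Fin N → ℂ

/-! ### Local Kähler geometry in a holomorphic coordinate chart -/

/-- The Wirtinger derivative `∂_k = ∂/∂z^k = (∂/∂x^k - i ∂/∂y^k) / 2`. -/
def dz {N : ℕ} (k : Fin N) (f : V N → ℂ) (z : V N) : ℂ :=
  (fderiv ℝ f z (Pi.single k 1) - Complex.I * fderiv ℝ f z (Pi.single k Complex.I)) / 2

/-- The Wirtinger derivative `∂_k̄ = ∂/∂z̄^k = (∂/∂x^k + i ∂/∂y^k) / 2`. -/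
def dzbar {N : ℕ} (k : Fin N) (f : V N → ℂ) (z : V N) : ℂ :=
  (fderiv ℝ f z (Pi.single k 1) + Complex.I * fderiv ℝ f z (Pi.single k Complex.I)) / 2

/-- The function `∂_k̄ Φ` for a real potential `Φ`. -/
def dbarPot {N : ℕ} (Φ : V N → ℝ) (k : Fin N) : V N → ℂ :=
  dzbar k fun z => (Φ z : ℂ)

/-- The Kähler metric `g_{k l̄} = ∂_k ∂_l̄ Φ`, rows indexed by `k` and columns by `l̄`. -/
def metric {N : ℕ} (Φ : V N → ℝ) (z : V N) : Matrix (Fin N) (Fin N) ℂ :=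
  Matrix.of fun k l => dz k (dbarPot Φ l) z

/-- The operator `D^ī = ∑ j, g^{ī j} ∂_j`, where `g^{ī j}` is the inverse matrix of `g_{k l̄}`. -/
def D {N : ℕ} (Φ : V N → ℝ) (i : Fin N) (f : V N → ℂ) (z : V N) : ℂ :=
  ∑ j, (metric Φ z)⁻¹ i j * dz j f z

/-- The composition `D^{ī_1} ⋯ D^{ī_k}` for the multi-index `J = (i_1, …, i_k)`. -/
def iterD {N : ℕ} (Φ : V N → ℝ) {k : ℕ} (J : Fin k → Fin N) (f : V N → ℂ) : V N → ℂ :=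
  (List.ofFn J).foldr (D Φ) f

/-- The density of the Riemannian volume form `√g dz^1 ⋯ dz^N dz̄^1 ⋯ dz̄^N` of the metric
`ds² = 2 g_{k l̄} dz^k dz̄^l` with respect to Lebesgue measure on `ℂ^N = ℝ^{2N}`: here `√g` is
`|det (g_{k l̄})|` and `|dz dz̄| = 2 dx dy` in each coordinate. -/
def volDensity {N : ℕ} (Φ : V N → ℝ) (z : V N) : ℝ :=
  2 ^ N * ‖(metric Φ z).det‖

/-- `T` is, on smooth functions on `U`, a differential operator of finite order with smooth
coefficients that contains only derivatives in the `z^i`, i.e.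
`T = ∑_{k ≤ m} a_{ī_1 ⋯ ī_k} D^{ī_1} ⋯ D^{ī_k}`. -/
def IsHolDiffOp {N : ℕ} (U : Set (V N)) (Φ : V N → ℝ) (T : (V N → ℂ) → (V N → ℂ)) : Prop :=
  ∃ (m : ℕ) (a : (k : ℕ) → (Fin k → Fin N) → V N → ℂ),
    (∀ k J, ContDiffOn ℝ ∞ (a k J) U) ∧
    ∀ h : V N → ℂ, ContDiffOn ℝ ∞ h U → ∀ z ∈ U,
      T h z = ∑ k ∈ Finset.range (m + 1), ∑ J : Fin k → Fin N, a k J z * iterD Φ J h z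

/-- `L = ∑ₙ ℏⁿ A n` is the operator `L_f` of left star multiplication by `f` on the chart domain
`U` with Kähler potential `Φ`: a formal series of differential operators in the `z`-directions
with `L 1 = f` and `[L, ∂_ī Φ + ℏ ∂_ī] = 0` for all `i`. Both identities are between formal power
series in `ℏ` and are written coefficient by coefficient. -/
structure IsLeftMul {N : ℕ} (U : Set (V N)) (Φ : V N → ℝ) (f : V N → ℂ)
    (A : ℕ → (V N → ℂ) → (V N → ℂ)) : Prop where
  diffOp : ∀ n, IsHolDiffOp U Φ (A n)
  one_zero : ∀ z ∈ U, A 0 (fun _ => 1) z = f z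
  one_succ : ∀ n, ∀ z ∈ U, A (n + 1) (fun _ => 1) z = 0
  comm_zero : ∀ (i : Fin N) (h : V N → ℂ), ContDiffOn ℝ ∞ h U → ∀ z ∈ U,
    A 0 (fun w => dbarPot Φ i w * h w) z - dbarPot Φ i z * A 0 h z = 0
  comm_succ : ∀ (n : ℕ) (i : Fin N) (h : V N → ℂ), ContDiffOn ℝ ∞ h U → ∀ z ∈ U,
    (A (n + 1) (fun w => dbarPot Φ i w * h w) z - dbarPot Φ i z * A (n + 1) h z)
      + (A n (dzbar i h) z - dzbar i (A n h) z) = 0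

/-! ### Spaces with an atlas of charts carrying Kähler potentials -/

/-- A covering of `M` by injectively parametrized open subsets of `ℂ^N`, with a potential on each.
It is only used for the two concrete spaces below. -/
structure KahlerAtlas (N : ℕ) (M : Type) where
  /-- the index set of the charts -/
  ι : Type
  /-- the domains in `ℂ^N` -/
  dom : ι → Set (V N)
  /-- the parametrizations -/
  param : (i : ι) → dom i → M
  /-- the Kähler potentials -/
  pot : ι → V N → ℝ
  isOpen_dom : ∀ i, IsOpen (dom i)
  injective_param : ∀ i, Function.Injective (param i)
  cover : ∀ p, ∃ i z, param i z = p

namespace KahlerAtlas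

variable {N : ℕ} {M : Type} (𝒜 : KahlerAtlas N M)

open Classical in
/-- The function `F` on `M`, written in the coordinates of the chart `i` (and `0` outside the
domain of the coordinates). -/
def rep (i : 𝒜.ι) (F : M → ℂ) (z : V N) : ℂ :=
  if h : z ∈ 𝒜.dom i then F (𝒜.param i ⟨z, h⟩) else 0

/-- `C^∞(M)`: complex functions that are smooth in all charts. -/
def Smooth : Type :=
  {F : M → ℂ // ∀ i, ContDiffOn ℝ ∞ (𝒜.rep i F) (𝒜.dom i)}

/-- `star F G n = C_n(F, G)` are the coefficients of Karabegov's star product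
`F * G = ∑ₙ ℏⁿ C_n(F, G)` on `M`: in every chart, `F * G = L_F G`. -/
def IsKarabegovStar (star : 𝒜.Smooth → 𝒜.Smooth → ℕ → 𝒜.Smooth) : Prop :=
  ∀ (F : 𝒜.Smooth) (i : 𝒜.ι), ∃ A : ℕ → (V N → ℂ) → (V N → ℂ),
    IsLeftMul (𝒜.dom i) (𝒜.pot i) (𝒜.rep i F.1) A ∧
    ∀ (G : 𝒜.Smooth) (n : ℕ), ∀ z ∈ 𝒜.dom i,
      𝒜.rep i (star F G n).1 z = A n (𝒜.rep i G.1) z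

/-- The Riemannian volume integrand of `H` in the coordinates of the chart `i`. -/
def integrand (i : 𝒜.ι) (H : 𝒜.Smooth) (z : V N) : ℂ :=
  𝒜.rep i H.1 z * (volDensity (𝒜.pot i) z : ℂ)

/-- `H` is integrable over the chart `i` for the Riemannian volume. -/
def VolIntegrable (i : 𝒜.ι) (H : 𝒜.Smooth) : Prop :=
  MeasureTheory.IntegrableOn (𝒜.integrand i H) (𝒜.dom i)

/-- The integral of `H` for the Riemannian volume, computed in the chart `i`. For the charts of
`ℂP^N` and `ℂH^N` below the complement of the chart is a null set, so this is the integral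
over `M`. -/
def volIntegral (i : 𝒜.ι) (H : 𝒜.Smooth) : ℂ :=
  ∫ z in 𝒜.dom i, 𝒜.integrand i H z

end KahlerAtlas

/-! ### Complex projective space -/

/-- Homogeneous coordinates `[z^0 : ⋯ : 1 : ⋯ : z^{N-1}]`, with `1` in position `i`. -/
theorem insertNth_one_ne_zero {N : ℕ} (i : Fin (N + 1)) (z : V N) :
    (i.insertNth (1 : ℂ) z : Fin (N + 1) → ℂ) ≠ 0 := by
  intro h
  have := congrFun h i
  simp at this

/-- `ℂP^N` with its `N + 1` inhomogeneous coordinate systems and `Φ = log (1 + |z|²)` in each. -/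
def CP (N : ℕ) : KahlerAtlas N (ℙ ℂ (Fin (N + 1) → ℂ)) where
  ι := Fin (N + 1)
  dom := fun _ => Set.univ
  param := fun i z => Projectivization.mk ℂ (i.insertNth (1 : ℂ) z.1) (insertNth_one_ne_zero i z.1)
  pot := fun _ z => Real.log (1 + ∑ k, ‖z k‖ ^ 2)
  isOpen_dom := fun _ => isOpen_univ
  injective_param := by
    intro i z w h
    obtain ⟨a, ha⟩ := (Projectivization.mk_eq_mk_iff' ℂ _ _ _ _).1 h
    have h1 : a = 1 := by simpa using congrFun ha i
    subst h1
    ext j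
    simpa using (congrFun ha (i.succAbove j)).symm
  cover := by
    intro p
    induction p with
    | h v hv =>
      obtain ⟨i, hi⟩ := Function.ne_iff.1 hv
      have hi' : v i ≠ 0 := hi
      refine ⟨i, ⟨fun j => (v i)⁻¹ * v (i.succAbove j), Set.mem_univ _⟩, ?_⟩
      refine (Projectivization.mk_eq_mk_iff' ℂ _ _ _ _).2 ⟨(v i)⁻¹, ?_⟩
      ext j
      refine Fin.succAboveCases i ?_ (fun j => ?_) j
      · simp [hi']
      · simp

/-! ### Complex hyperbolic space -/

/-- The open unit ball of `ℂ^N`. -/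
def unitBall (N : ℕ) : Set (V N) := {z | ∑ k, ‖z k‖ ^ 2 < 1}

/-- `ℂH^N`: the unit ball of `ℂ^N` with `Φ = - log (1 - |z|²)`. -/
def CH (N : ℕ) : KahlerAtlas N (unitBall N) where
  ι := Unit
  dom := fun _ => unitBall N
  param := fun _ z => z
  pot := fun _ z => -Real.log (1 - ∑ k, ‖z k‖ ^ 2)
  isOpen_dom := fun _ => isOpen_lt (by fun_prop) continuous_const
  injective_param := fun _ _ _ h => h
  cover := fun p => ⟨(), p, rfl⟩

end KarabegovTrace

end

noncomputable section

namespace KarabegovTrace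

/-! ### The recursion for the bidifferential operators, in an abstract ring -/

/-! Put `ε = 1` for projective and `ε = -1` for hyperbolic space, so that every chart has the
potential `Φ = ε log h` with `h = 1 + ε|z|²`. Then `w_i = ∂_ī Φ = z^i / h`, and `w_i`, `b_i = ∂_ī`
and `D^i` satisfy a small closed list of commutation relations (`SpaceForm.spaceFormRel`): `D^k`
acts as `∂/∂w_k` with `z̄` frozen, and the curvature enters only through `[b_i, w_j]` and `[b_i,
D^k]`.

Existence and uniqueness in a chart are algebraic. The recursion `T_{m+1} = ∑ [b_i, T_m] D^i - ε
m(m-1) T_m`, `T_0 = f`, is arranged so that `[T_{m+1}, w_i]` and `[b_i, T_m]` are combinations of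
the same operators `S_{m,i}` (`SpaceFormRel.tOp_succ_w`). Hence `L_f = ∑ ℏ^m / (m! ∏_{k<m} (1 -
εkℏ)) T_m` commutes with `w_i + ℏ b_i`. For uniqueness, the difference of two solutions at the first
order where they differ commutes with all `w_i`. The map `S ↦ ∑ [S, w_i] D^i` multiplies words of
length `k` in the `D` by `k`, so this difference is a multiplication operator; it kills `1`, hence
it vanishes (`SpaceForm.isLeftMul_iff`).

For the trace, let `σ` be integration against `h^{-(N+1)}`, which is the Riemannian density up to
`2^N`. Integration by parts gives `σ(D^i u) = 0` and `σ(∂_ī u) = ε(N+1) σ(w_i u)`. Applied to the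
recursion, this yields `σ(T_n(f) g) = (-1)^n σ(f ∏_{k<n} (Δ + εk(N+k)) g)` with `Δ = ∑ D^i ∂_ī`
(`SpaceForm.IsTraceFunctional.tf_eq`). Since `Δ` is symmetric for `σ`, the right side is symmetric
in `f` and `g` as soon as one of them has compact support in the chart. This settles hyperbolic
space, which has a single chart.

On `ℂP^N` three global facts are added. The chart operators agree on overlaps, because in
homogeneous coordinates they all come from the same recursion with `∂_Ā` and `|Z|² ∂_A`
(`ambOp_pull`). The integral does not depend on the chart, because each chart measure is, up to one
constant, the image of the Gaussian measure on `ℂ^{N+1}` (`map_proj_gaussMeasure`). A partition of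
unity (`exists_partition`) then writes `F` as a sum of functions, each compactly supported in some
chart, where the local trace property applies. -/

theorem bracket_mul_eq {R : Type*} [Ring R] (a b c : R) :
    a * (b * c) - b * c * a = (a * b - b * a) * c + b * (a * c - c * a) := by
  noncomm_ring

theorem bracket_smul_left {R : Type*} [Ring R] [Algebra ℂ R] (r : ℂ) (a b : R) :
    r • a * b - b * r • a = r • (a * b - b * a) := by
  rw [smul_mul_assoc, mul_smul_comm, smul_sub]

theorem bracket_smul_right {R : Type*} [Ring R] [Algebra ℂ R] (r : ℂ) (a b : R) :
    b * r • a - r • a * b = r • (b * a - a * b) := by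
  rw [smul_mul_assoc, mul_smul_comm, smul_sub]

section Recursion

variable {R ι : Type*} [Ring R] [Fintype ι]

/-- The operators `T₀ = f`, `Tₙ₊₁ = ∑ᵢ [bᵢ, Tₙ] Dᵢ - ε n (n - 1) Tₙ`. -/
def tOp (ε : ℤ) (b D : ι → R) (f : R) : ℕ → R
  | 0 => f
  | n + 1 => ∑ i, (b i * tOp ε b D f n - tOp ε b D f n * b i) * D i
      - (ε * n * (n - 1)) • tOp ε b D f n

/-- The operators `Sₙ,ᵢ = [bᵢ, Tₙ] - ε n (n - 1) Sₙ₋₁,ᵢ`. -/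
def sOp (ε : ℤ) (b D : ι → R) (f : R) : ℕ → ι → R
  | 0, i => b i * f - f * b i
  | n + 1, i => b i * tOp ε b D f (n + 1) - tOp ε b D f (n + 1) * b i
      - (ε * (n + 1) * n) • sOp ε b D f n i

/-- The corrections in the two recursions match after multiplication by `D i` and summation. The
right factor `D i` is what makes `T_{n+1}` kill constants and what produces `S_{n,i}` in the
commutator with `w_i`. -/
theorem tOp_succ_eq_sum_sOp (ε : ℤ) (b D : ι → R) (f : R) (n : ℕ) :
    tOp ε b D f (n + 1) = ∑ i, sOp ε b D f n i * D i := by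
  induction n with
  | zero => simp [tOp, sOp]
  | succ n ih =>
    rw [tOp]
    simp only [sOp, sub_mul _ _ (D _), Finset.sum_sub_distrib, smul_mul_assoc,
      ← Finset.smul_sum, ← ih]
    congr 2
    push_cast
    ring

theorem bracket_tOp_succ (ε : ℤ) (b D : ι → R) (f : R) (n : ℕ) (i : ι) :
    b i * tOp ε b D f (n + 1) - tOp ε b D f (n + 1) * b i
      = sOp ε b D f (n + 1) i + (ε * (n + 1) * n) • sOp ε b D f n i := by
  rw [sOp, sub_add_cancel]

theorem tOp_add (ε : ℤ) (b D : ι → R) (f g : R) (n : ℕ) :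
    tOp ε b D (f + g) n = tOp ε b D f n + tOp ε b D g n := by
  induction n with
  | zero => rfl
  | succ n ih =>
    simp only [tOp, ih, smul_add]
    rw [sub_add_sub_comm, ← Finset.sum_add_distrib]
    congr 1
    refine Finset.sum_congr rfl fun i _ => ?_
    noncomm_ring

theorem tOp_zero (ε : ℤ) (b D : ι → R) (n : ℕ) : tOp ε b D 0 n = 0 := by
  induction n with
  | zero => rfl
  | succ n ih => simp [tOp, ih]

/-- Needed to split the left factor of the star product by a partition of unity. -/
theorem tOp_sum {κ : Type*} (s : Finset κ) (ε : ℤ) (b D : ι → R) (f : κ → R) (n : ℕ) :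
    tOp ε b D (∑ a ∈ s, f a) n = ∑ a ∈ s, tOp ε b D (f a) n := by
  classical
  induction s using Finset.induction_on with
  | empty => simp [tOp_zero]
  | insert a s ha ih => rw [Finset.sum_insert ha, Finset.sum_insert ha, tOp_add, ih]

/-- `Tₙ` commutes with every `q` such that `f` and all `Dᵢ`, and `[bᵢ, q]`, behave like
a function and its derivatives in a commuting direction. -/
theorem tOp_commute_of_commute {ε : ℤ} {b D : ι → R} {f : R} {s : Set R}
    (hf : ∀ q ∈ s, Commute f q) (hD : ∀ i, ∀ q ∈ s, Commute (D i) q)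
    (hb : ∀ i, ∀ q ∈ s, b i * q - q * b i ∈ s) (n : ℕ) :
    ∀ q ∈ s, Commute (tOp ε b D f n) q := by
  induction n with
  | zero => exact hf
  | succ n ih =>
    intro q hq
    rw [tOp]
    refine Commute.sub_left (Commute.sum_left _ _ _ fun i _ => ?_) (Commute.smul_left (ih q hq) _)
    refine Commute.mul_left ?_ (hD i q hq)
    have h1 := (ih q hq).eq
    have h2 := (ih _ (hb i q hq)).eq
    generalize tOp ε b D f n = t at h1 h2
    show (b i * t - t * b i) * q = q * (b i * t - t * b i)
    have e1 : b i * t * q = b i * q * t := by rw [mul_assoc, h1, mul_assoc]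
    have e2 : t * (b i * q) - q * t * b i = b i * q * t - q * b i * t := by
      rw [mul_sub, sub_mul, ← mul_assoc t q, h1] at h2
      exact h2
    rw [sub_mul, mul_sub, e1, mul_assoc t, ← mul_assoc q, ← mul_assoc q]
    rw [sub_eq_sub_iff_add_eq_add] at e2 ⊢
    rw [e2.symm, add_comm]

end Recursion

/-- The commutation relations of `wᵢ = ∂_ī Φ`, `bᵢ = ∂_ī` and `Dᵢ = D^ī` on a complex space form
of sign `ε`. -/
structure SpaceFormRel {R ι : Type*} [Ring R] [Fintype ι] [DecidableEq ι]
    (ε : ℤ) (w b D : ι → R) : Prop where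
  D_w : ∀ k i, D k * w i - w i * D k = if k = i then 1 else 0
  b_b : ∀ i j, b i * b j = b j * b i
  b_D : ∀ i k, b i * D k - D k * b i =
    ε • (w i * D k + if i = k then ∑ j, w j * D j else 0)
  b_w : ∀ i j, b i * w j - w j * b i = -(ε • (w i * w j))
  w_w : ∀ i j, w i * w j = w j * w i
  D_D : ∀ i j, D i * D j = D j * D i

namespace SpaceFormRel

variable {R ι : Type*} [Ring R] [Fintype ι] [DecidableEq ι] {ε : ℤ} {w b D : ι → R}

/-- By the Jacobi identity `[b_k, [b_i, t]]` is symmetric in `i` and `k`, since the `b` commute; the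
correction term inherits this by induction. -/
theorem bracket_sOp_comm (H : SpaceFormRel ε w b D) (f : R) (n : ℕ) (i k : ι) :
    b k * sOp ε b D f n i - sOp ε b D f n i * b k
      = b i * sOp ε b D f n k - sOp ε b D f n k * b i := by
  have key : ∀ t : R, b k * (b i * t - t * b i) - (b i * t - t * b i) * b k
      = b i * (b k * t - t * b k) - (b k * t - t * b k) * b i := by
    intro t
    have e1 : b k * b i * t = b i * b k * t := by rw [H.b_b]
    have e2 : t * (b k * b i) = t * (b i * b k) := by rw [H.b_b]
    rw [mul_sub, sub_mul, mul_sub, sub_mul, ← mul_assoc (b k), ← mul_assoc (b i) (b k),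
      mul_assoc t, mul_assoc t, e1, e2]
    noncomm_ring
  induction n with
  | zero => exact key f
  | succ n ih =>
    simp only [sOp]
    have := key (tOp ε b D f (n + 1))
    rw [mul_sub, sub_mul, mul_sub (b i) (b k * _ - _), sub_mul (b k * _ - _) _ (b i),
      sub_sub_sub_comm, this, mul_smul_comm, smul_mul_assoc, ← smul_sub, ih, smul_sub,
      sub_sub_sub_comm, mul_smul_comm, smul_mul_assoc]

theorem tOp_succ_w_aux (H : SpaceFormRel ε w b D) (f : R) (n : ℕ) (i : ι) :
    tOp ε b D f (n + 1) * w i - w i * tOp ε b D f (n + 1) = sOp ε b D f n i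
      + ∑ k, (sOp ε b D f n k * w i - w i * sOp ε b D f n k) * D k := by
  have h : ∀ k, sOp ε b D f n k * D k * w i - w i * (sOp ε b D f n k * D k)
      = (if k = i then sOp ε b D f n k else 0)
        + (sOp ε b D f n k * w i - w i * sOp ε b D f n k) * D k := by
    intro k
    have : (if k = i then sOp ε b D f n k else 0) = sOp ε b D f n k * (D k * w i - w i * D k) := by
      rw [H.D_w]; split_ifs <;> simp
    rw [this]; noncomm_ring
  rw [tOp_succ_eq_sum_sOp, Finset.sum_mul, Finset.mul_sum, ← Finset.sum_sub_distrib]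
  simp only [h, Finset.sum_add_distrib]
  simp

/-- The central identity. In flat space it is the statement that `T_{n+1}` has degree `n + 1` in the
`D`; the term `ε n(n-1)` in the recursion is the one that absorbs the curvature contributions of
`b_w` and `b_D`. -/
theorem tOp_succ_w (H : SpaceFormRel ε w b D) {f : R} (hf : ∀ i, f * w i = w i * f) (n : ℕ) :
    ∀ i, tOp ε b D f (n + 1) * w i - w i * tOp ε b D f (n + 1)
      = ((n : ℤ) + 1) • sOp ε b D f n i := by
  induction n with
  | zero =>
    intro i
    rw [tOp_succ_w_aux H, add_eq_left.2, Nat.cast_zero, zero_add, one_smul]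
    -- `[b_k, w_i]` is quadratic in the `w`, so it commutes with `f`, and the Jacobi identity makes
    -- `[[b_k, f], w_i]` vanish.
    refine Finset.sum_eq_zero fun k _ => ?_
    have h1 : (b k * f - f * b k) * w i - w i * (b k * f - f * b k)
        = b k * (f * w i - w i * f) - (f * w i - w i * f) * b k
          + ((b k * w i - w i * b k) * f - f * (b k * w i - w i * b k)) := by noncomm_ring
    have h2 : f * (w k * w i) = w k * w i * f := by
      rw [← mul_assoc, hf, mul_assoc, hf, mul_assoc]
    rw [sOp, h1, hf, H.b_w, mul_neg, mul_smul_comm, h2, neg_mul, smul_mul_assoc]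
    simp
  | succ n ih =>
    intro i
    rw [tOp_succ_w_aux H]
    set T := tOp ε b D f (n + 1) with hT
    set S := sOp ε b D f n with hS
    have hsum : ∑ k, (S k * w i - w i * S k) * D k = (n : ℤ) • S i := by
      have := ih i
      rw [hT, tOp_succ_w_aux H, ← hS, add_smul, one_smul, add_comm] at this
      exact add_right_cancel this
    -- Jacobi identity for `[[b_k, T], w_i]`, with `[T, w_i]` supplied by the induction hypothesis;
    -- symmetry in `i, k` then turns `[b_k, S_i]` into `[b_i, S_k]`, so that the sum against `D k`
    -- can be recognised.
    have hterm : ∀ k, (sOp ε b D f (n + 1) k * w i - w i * sOp ε b D f (n + 1) k)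
        = ((n : ℤ) + 1) • (b i * S k - S k * b i)
          + (ε * (n + 1)) • (w i * S k + S i * w k)
          - (ε * (n + 1) * n) • (S k * w i - w i * S k) := by
      intro k
      have e1 : (b k * T - T * b k) * w i - w i * (b k * T - T * b k)
        = b k * (T * w i - w i * T) - (T * w i - w i * T) * b k
          + ((b k * w i - w i * b k) * T - T * (b k * w i - w i * b k)) := by noncomm_ring
      have e2 : T * (w i * w k) - w i * w k * T
          = (T * w i - w i * T) * w k + w i * (T * w k - w k * T) := by noncomm_ring
      have e3 : sOp ε b D f (n + 1) k * w i - w i * sOp ε b D f (n + 1) k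
        = ((b k * T - T * b k) * w i - w i * (b k * T - T * b k))
          - (ε * (n + 1) * n) • (S k * w i - w i * S k) := by
        rw [sOp, sub_mul, mul_sub (w i), smul_mul_assoc, mul_smul_comm, smul_sub]
        abel
      have e4 : ((b k * w i - w i * b k) * T - T * (b k * w i - w i * b k))
          = (ε * (n + 1)) • (w i * S k + S i * w k) := by
        rw [H.b_w, H.w_w k i, neg_mul, mul_neg, smul_mul_assoc, mul_smul_comm, neg_sub_neg,
          ← smul_sub, e2, ih, ih, smul_mul_assoc, mul_smul_comm, ← smul_add, mul_smul,
          add_comm (S i * _)]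
      rw [e3, e1, e4, ih, mul_smul_comm, smul_mul_assoc, ← smul_sub, bracket_sOp_comm H]
    have hD : ∑ k, (b i * S k - S k * b i) * D k
        = b i * T - T * b i - ε • ∑ k, S k * w i * D k - ε • ∑ k, S i * w k * D k := by
      have e : ∀ k, (b i * S k - S k * b i) * D k
          = b i * (S k * D k) - S k * D k * b i - S k * (b i * D k - D k * b i) := by
        intro k; noncomm_ring
      have e' : ∀ k, S k * (b i * D k - D k * b i) = ε • (S k * w i * D k)
          + (if i = k then ε • ∑ j, S k * w j * D j else 0) := by
        intro k
        rw [H.b_D, mul_smul_comm, mul_add, smul_add, mul_assoc]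
        split_ifs <;> simp [Finset.mul_sum, mul_assoc]
      simp only [e, e', Finset.sum_sub_distrib, Finset.sum_add_distrib, ← Finset.mul_sum,
        ← Finset.sum_mul, ← Finset.smul_sum]
      rw [hT, tOp_succ_eq_sum_sOp, Finset.sum_ite_eq]
      simp only [Finset.mem_univ, if_true, ← hS]
      abel
    have htotal : ∑ k, (sOp ε b D f (n + 1) k * w i - w i * sOp ε b D f (n + 1) k) * D k
        = ((n : ℤ) + 1) • ∑ k, (b i * S k - S k * b i) * D k
          + (ε * (n + 1)) • (∑ k, w i * S k * D k + ∑ k, S i * w k * D k)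
          - (ε * (n + 1) * n) • ∑ k, (S k * w i - w i * S k) * D k := by
      rw [← Finset.sum_add_distrib, Finset.smul_sum, Finset.smul_sum, Finset.smul_sum,
        ← Finset.sum_add_distrib, ← Finset.sum_sub_distrib]
      refine Finset.sum_congr rfl fun k _ => ?_
      rw [hterm, sub_mul, add_mul, smul_mul_assoc, smul_mul_assoc, smul_mul_assoc, add_mul]
    rw [htotal, hsum, hD]
    -- Moving `w i` to the left of `S k` costs `n S_i`. The sums of `S i * w k * D k` cancel, and
    -- what is left over, `ε(n+1)(n + n²) S_i`, is `n + 1` times the correction `ε(n+1)n S_i` in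
    -- `sOp`.
    have hx : ∑ k, S k * w i * D k = ∑ k, w i * S k * D k + (n : ℤ) • S i := by
      rw [← hsum, ← Finset.sum_add_distrib]
      exact Finset.sum_congr rfl fun k _ => by noncomm_ring
    rw [hx, sOp, ← hT, ← hS]
    push_cast
    module

theorem sum_bracket_tOp_w_mul_D (H : SpaceFormRel ε w b D) {f : R}
    (hf : ∀ i, f * w i = w i * f) (n : ℕ) :
    ∑ i, (tOp ε b D f n * w i - w i * tOp ε b D f n) * D i = (n : ℤ) • tOp ε b D f n := by
  cases n with
  | zero => simp [tOp, hf]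
  | succ n =>
    simp only [tOp_succ_w H hf, smul_mul_assoc, ← Finset.smul_sum, ← tOp_succ_eq_sum_sOp]
    push_cast
    rfl

/-- `D k` acts like `∂/∂w_k`, so bracketing with `w i` deletes one letter `D i` and the right
multiplication puts it back: an Euler operator counting letters. Commutativity of the `D` is needed
to put the letter back in its place. -/
theorem sum_bracket_word_w_mul_D (H : SpaceFormRel ε w b D) (l : List ι) :
    ∑ i, ((l.map D).prod * w i - w i * (l.map D).prod) * D i
      = (l.length : ℤ) • (l.map D).prod := by
  induction l with
  | nil => simp
  | cons j l ih =>
    have hc : Commute (D j) (l.map D).prod := by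
      refine Commute.list_prod_right _ _ fun x hx => ?_
      obtain ⟨k, -, rfl⟩ := List.mem_map.1 hx
      exact H.D_D j k
    simp only [List.map_cons, List.prod_cons, List.length_cons]
    set v := (l.map D).prod
    have e : ∀ i, (D j * v * w i - w i * (D j * v)) * D i
        = D j * ((v * w i - w i * v) * D i) + (if j = i then v * D i else 0) := by
      intro i
      have : (if j = i then v * D i else 0) = (D j * w i - w i * D j) * v * D i := by
        rw [H.D_w]; split_ifs <;> simp
      rw [this]; noncomm_ring
    simp only [e, Finset.sum_add_distrib, ← Finset.mul_sum, ih]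
    rw [Finset.sum_ite_eq]
    simp only [Finset.mem_univ, if_true, ← hc.eq, mul_smul_comm]
    push_cast
    rw [add_smul, one_smul]

/-- The trace of `b_D`: the first curvature term contributes `∑ w_i D_i` once, the diagonal term
once for each index. This is the factor `N + 1` that later cancels against the exponent of the
volume density. -/
theorem sum_b_mul_D (H : SpaceFormRel ε w b D) :
    ∑ i, b i * D i = ∑ i, D i * b i + (ε * (Fintype.card ι + 1)) • ∑ i, w i * D i := by
  have : ∀ i, b i * D i = D i * b i + ε • (w i * D i + ∑ j, w j * D j) := by
    intro i
    have := H.b_D i i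
    rw [if_pos rfl] at this
    rw [← this]; abel
  simp only [this, Finset.sum_add_distrib, ← Finset.smul_sum, Finset.sum_const, Finset.card_univ]
  rw [mul_smul, add_smul, one_smul, natCast_zsmul, add_comm (∑ i, w i * D i)]

end SpaceFormRel

/-- A sum of eigenvectors for the eigenvalues `0, …, m` that lies in the kernel is its
`0`-component. -/
theorem sum_eigenvectors_eq_zero_component {M : Type*} [AddCommGroup M] [Module ℂ M]
    (L : M →ₗ[ℂ] M) (m : ℕ) :
    ∀ (x : ℕ → M), (∀ k, L (x k) = (k : ℂ) • x k) → L (∑ k ∈ Finset.range (m + 1), x k) = 0 →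
      ∑ k ∈ Finset.range (m + 1), x k = x 0 := by
  induction m with
  | zero => intro x _ _; simp
  | succ m ih =>
    intro x hx h0
    have h1 := h0
    rw [map_sum] at h1
    simp only [hx] at h1
    -- The weight `k - (m + 1)` removes the top component and only rescales the others, so the
    -- induction hypothesis applies.
    have hy := ih (fun k => ((k : ℂ) - (m + 1)) • x k)
      (fun k => by rw [map_smul, hx, smul_comm]) (by
        have e : ∑ k ∈ Finset.range (m + 1), ((k : ℂ) - (m + 1)) • x k
            = ∑ k ∈ Finset.range (m + 1 + 1), (k : ℂ) • x k
              - ((m : ℂ) + 1) • ∑ k ∈ Finset.range (m + 1 + 1), x k := by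
          rw [Finset.smul_sum, ← Finset.sum_sub_distrib, Finset.sum_range_succ _ (m + 1)]
          simp [sub_smul]
        rw [e, h1, zero_sub, map_neg, map_smul, h0]
        simp)
    have e : ∑ k ∈ Finset.range (m + 1), ((k : ℂ) - (m + 1)) • x k
        = - (((m : ℂ) + 1) • ∑ k ∈ Finset.range (m + 1 + 1), x k) := by
      rw [← zero_sub, ← h1, Finset.smul_sum, ← Finset.sum_sub_distrib,
        Finset.sum_range_succ _ (m + 1)]
      simp [sub_smul]
    rw [e] at hy
    have hne : ((m : ℂ) + 1) ≠ 0 := by exact_mod_cast Nat.succ_ne_zero m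
    have : ((m : ℂ) + 1) • (∑ k ∈ Finset.range (m + 1 + 1), x k) = ((m : ℂ) + 1) • x 0 := by
      rw [← neg_inj, hy, Nat.cast_zero, zero_sub, neg_smul]
    exact smul_right_injective _ hne this

/-! ### The algebra of smooth functions on an open subset of `ℂ^N` -/

open Classical in
/-- Extension by zero. -/
def extend {N : ℕ} {U : Set (V N)} (f : U → ℂ) (z : V N) : ℂ :=
  if h : z ∈ U then f ⟨z, h⟩ else 0

theorem extend_of_mem {N : ℕ} {U : Set (V N)} (f : U → ℂ) {z : V N} (h : z ∈ U) :
    extend f z = f ⟨z, h⟩ := dif_pos h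

@[simp]
theorem extend_coe {N : ℕ} {U : Set (V N)} (f : U → ℂ) (z : U) : extend f z = f z :=
  extend_of_mem f z.2

theorem extend_restrict {N : ℕ} {U : Set (V N)} (g : V N → ℂ) :
    Set.EqOn (extend (U.domRestrict g)) g U := fun _ hz => extend_of_mem _ hz

/-- The algebra `C^∞(U)` of complex-valued smooth functions on `U`. -/
def smoothAlg {N : ℕ} (U : Set (V N)) : Subalgebra ℂ (U → ℂ) where
  carrier := {f | ContDiffOn ℝ ∞ (extend f) U}
  mul_mem' {f g} hf hg := (ContDiffOn.mul hf hg).congr fun z hz => by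
    simp [extend_of_mem _ hz]
  add_mem' {f g} hf hg := (ContDiffOn.add hf hg).congr fun z hz => by
    simp [extend_of_mem _ hz]
  algebraMap_mem' c := (contDiffOn_const (c := c)).congr fun z hz => by
    simp [extend_of_mem _ hz]

/-- The algebra `smoothAlg U` as a type. -/
def SmoothFn {N : ℕ} (U : Set (V N)) : Type := smoothAlg U

section SmoothAlg

variable {N : ℕ} {U : Set (V N)}

instance : CommRing (SmoothFn U) := inferInstanceAs (CommRing (smoothAlg U))

instance : Algebra ℂ (SmoothFn U) := inferInstanceAs (Algebra ℂ (smoothAlg U))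

/-- Evaluation at a point. -/
def evalHom (z : U) : SmoothFn U →ₐ[ℂ] ℂ :=
  (Pi.evalAlgHom ℂ (fun _ : U => ℂ) z).comp (smoothAlg U).val

theorem evalHom_apply (z : U) (f : SmoothFn U) : evalHom z f = f.1 z := rfl

@[simp] theorem add_val (f g : SmoothFn U) (z : U) : (f + g).1 z = f.1 z + g.1 z := rfl
@[simp] theorem sub_val (f g : SmoothFn U) (z : U) : (f - g).1 z = f.1 z - g.1 z := rfl
@[simp] theorem neg_val (f : SmoothFn U) (z : U) : (-f).1 z = -f.1 z := rfl
@[simp] theorem mul_val (f g : SmoothFn U) (z : U) : (f * g).1 z = f.1 z * g.1 z := rfl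
@[simp] theorem smul_val (c : ℂ) (f : SmoothFn U) (z : U) : (c • f).1 z = c * f.1 z := rfl
@[simp] theorem one_val (z : U) : (1 : SmoothFn U).1 z = 1 := rfl
@[simp] theorem zero_val (z : U) : (0 : SmoothFn U).1 z = 0 := rfl
@[simp] theorem intCast_val (n : ℤ) (z : U) : (n : SmoothFn U).1 z = n := rfl
@[simp] theorem pow_val (f : SmoothFn U) (n : ℕ) (z : U) : (f ^ n).1 z = f.1 z ^ n := rfl

@[simp] theorem sum_val {κ : Type*} (s : Finset κ) (f : κ → SmoothFn U) (z : U) :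
    (∑ j ∈ s, f j).1 z = ∑ j ∈ s, (f j).1 z := by
  rw [← evalHom_apply, map_sum]
  rfl

/-- The restriction to `U` of a function that is smooth on `U`. -/
def mkSmooth (g : V N → ℂ) (hg : ContDiffOn ℝ ∞ g U) : SmoothFn U :=
  ⟨U.domRestrict g, hg.congr (extend_restrict g)⟩

@[simp]
theorem mkSmooth_apply (g : V N → ℂ) (hg : ContDiffOn ℝ ∞ g U) (z : U) :
    (mkSmooth g hg).1 z = g z := rfl

theorem mkSmooth_extend (f : SmoothFn U) : mkSmooth (extend f.1) f.2 = f :=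
  Subtype.ext (funext fun z => extend_coe f.1 z)

theorem smoothFn_ext {f g : SmoothFn U} (h : ∀ z : U, f.1 z = g.1 z) : f = g :=
  Subtype.ext (funext h)

theorem extend_mkSmooth (g : V N → ℂ) (hg : ContDiffOn ℝ ∞ g U) :
    Set.EqOn (extend (mkSmooth g hg).1) g U := extend_restrict g

theorem differentiableAt_extend (hU : IsOpen U) (f : SmoothFn U) {z : V N} (hz : z ∈ U) :
    DifferentiableAt ℝ (extend f.1) z :=
  ((f.2.contDiffAt (hU.mem_nhds hz)).differentiableAt (by simp))

theorem contDiffOn_fderiv_apply (hU : IsOpen U) {f : V N → ℂ} (hf : ContDiffOn ℝ ∞ f U) (v : V N) :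
    ContDiffOn ℝ ∞ (fun z => fderiv ℝ f z v) U :=
  (hf.fderiv_of_isOpen hU (by simp)).clm_apply contDiffOn_const

/-- The directional derivative as a derivation of `C^∞(U)`. -/
def dirDer (hU : IsOpen U) (v : V N) : Derivation ℂ (SmoothFn U) (SmoothFn U) where
  toFun f := mkSmooth (fun z => fderiv ℝ (extend f.1) z v) (contDiffOn_fderiv_apply hU f.2 v)
  map_add' f g := by
    refine smoothFn_ext fun z => ?_
    have : extend (f + g).1 = extend f.1 + extend g.1 := by
      funext w; by_cases hw : w ∈ U <;> simp [extend, hw]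
    simp only [mkSmooth_apply, add_val]
    rw [this, fderiv_add (differentiableAt_extend hU f z.2) (differentiableAt_extend hU g z.2)]
    rfl
  map_smul' c f := by
    refine smoothFn_ext fun z => ?_
    have : extend (c • f).1 = c • extend f.1 := by
      funext w; by_cases hw : w ∈ U <;> simp [extend, hw]
    simp only [mkSmooth_apply, this, RingHom.id_apply]
    rw [fderiv_const_smul (differentiableAt_extend hU f z.2)]
    rfl
  map_one_eq_zero' := by
    refine smoothFn_ext fun z => ?_
    -- `extend 1` is the indicator function of `U`, so it is constant only locally.
    have : extend (1 : SmoothFn U).1 =ᶠ[nhds z.1] fun _ => 1 :=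
      Filter.eventuallyEq_of_mem (hU.mem_nhds z.2) fun w hw => by simp [extend_of_mem _ hw]
    simp only [LinearMap.coe_mk, AddHom.coe_mk, mkSmooth_apply, this.fderiv_eq]
    simp
  leibniz' f g := by
    refine smoothFn_ext fun z => ?_
    have : extend (f * g).1 = extend f.1 * extend g.1 := by
      funext w; by_cases hw : w ∈ U <;> simp [extend, hw]
    simp only [LinearMap.coe_mk, AddHom.coe_mk, mkSmooth_apply, this]
    rw [fderiv_mul (differentiableAt_extend hU f z.2) (differentiableAt_extend hU g z.2)]
    simp [smul_eq_mul]

theorem dirDer_apply (hU : IsOpen U) (v : V N) (f : SmoothFn U) (z : U) :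
    (dirDer hU v f).1 z = fderiv ℝ (extend f.1) z v := rfl

theorem dirDer_mkSmooth (hU : IsOpen U) (v : V N) (g : V N → ℂ) (hg : ContDiffOn ℝ ∞ g U) (z : U) :
    (dirDer hU v (mkSmooth g hg)).1 z = fderiv ℝ g z v := by
  rw [dirDer_apply, Filter.EventuallyEq.fderiv_eq]
  exact Filter.eventuallyEq_of_mem (hU.mem_nhds z.2) (extend_mkSmooth g hg)

theorem dirDer_comm (hU : IsOpen U) (v w : V N) (f : SmoothFn U) :
    dirDer hU v (dirDer hU w f) = dirDer hU w (dirDer hU v f) := by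
  refine smoothFn_ext fun z => ?_
  have hf : ContDiffAt ℝ ∞ (extend f.1) z := f.2.contDiffAt (hU.mem_nhds z.2)
  have key : ∀ a b : V N, (dirDer hU a (dirDer hU b f)).1 z
      = fderiv ℝ (fderiv ℝ (extend f.1)) z a b := by
    intro a b
    change (dirDer hU a (mkSmooth (fun z => fderiv ℝ (extend f.1) z b)
      (contDiffOn_fderiv_apply hU f.2 b))).1 z = _
    rw [dirDer_mkSmooth]
    have hd : DifferentiableAt ℝ (fderiv ℝ (extend f.1)) z :=
      (hf.fderiv_right (m := ∞) (by simp)).differentiableAt (by simp)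
    rw [fderiv_clm_apply hd (differentiableAt_const b)]
    simp
  rw [key, key]
  exact (hf.isSymmSndFDerivAt (by simpa using ENat.LEInfty.out)).eq v w

/-- The Wirtinger derivation `∂_k` of `C^∞(U)`. -/
def dzDer (hU : IsOpen U) (k : Fin N) : Derivation ℂ (SmoothFn U) (SmoothFn U) :=
  (1 / 2 : ℂ) • (dirDer hU (Pi.single k 1) - Complex.I • dirDer hU (Pi.single k Complex.I))

/-- The Wirtinger derivation `∂_k̄` of `C^∞(U)`. -/
def dzbarDer (hU : IsOpen U) (k : Fin N) : Derivation ℂ (SmoothFn U) (SmoothFn U) :=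
  (1 / 2 : ℂ) • (dirDer hU (Pi.single k 1) + Complex.I • dirDer hU (Pi.single k Complex.I))

theorem dzDer_apply (hU : IsOpen U) (k : Fin N) (f : SmoothFn U) (z : U) :
    (dzDer hU k f).1 z = dz k (extend f.1) z := by
  simp only [dzDer, dz]
  simp [dirDer_apply]
  ring

theorem dzbarDer_apply (hU : IsOpen U) (k : Fin N) (f : SmoothFn U) (z : U) :
    (dzbarDer hU k f).1 z = dzbar k (extend f.1) z := by
  simp only [dzbarDer, dzbar]
  simp [dirDer_apply]
  ring

theorem dz_congr (hU : IsOpen U) (k : Fin N) {f g : V N → ℂ} (h : Set.EqOn f g U) :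
    Set.EqOn (dz k f) (dz k g) U := fun z hz => by
  have := (Filter.eventuallyEq_of_mem (hU.mem_nhds hz) h).fderiv_eq (𝕜 := ℝ)
  simp only [dz, this]

theorem dzbar_congr (hU : IsOpen U) (k : Fin N) {f g : V N → ℂ} (h : Set.EqOn f g U) :
    Set.EqOn (dzbar k f) (dzbar k g) U := fun z hz => by
  have := (Filter.eventuallyEq_of_mem (hU.mem_nhds hz) h).fderiv_eq (𝕜 := ℝ)
  simp only [dzbar, this]

theorem dzDer_mkSmooth (hU : IsOpen U) (k : Fin N) (g : V N → ℂ) (hg : ContDiffOn ℝ ∞ g U) (z : U) :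
    (dzDer hU k (mkSmooth g hg)).1 z = dz k g z := by
  rw [dzDer_apply, dz_congr hU k (extend_mkSmooth g hg) z.2]

theorem dzbarDer_mkSmooth (hU : IsOpen U) (k : Fin N) (g : V N → ℂ) (hg : ContDiffOn ℝ ∞ g U)
    (z : U) : (dzbarDer hU k (mkSmooth g hg)).1 z = dzbar k g z := by
  rw [dzbarDer_apply, dzbar_congr hU k (extend_mkSmooth g hg) z.2]

theorem dzDer_comm (hU : IsOpen U) (k l : Fin N) (f : SmoothFn U) :
    dzDer hU k (dzDer hU l f) = dzDer hU l (dzDer hU k f) := by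
  simp only [dzDer, Derivation.smul_apply, Derivation.sub_apply, Derivation.map_smul,
    Derivation.map_sub,
    dirDer_comm hU (Pi.single k 1), dirDer_comm hU (Pi.single k Complex.I)]
  module

theorem dzbarDer_comm (hU : IsOpen U) (k l : Fin N) (f : SmoothFn U) :
    dzbarDer hU k (dzbarDer hU l f) = dzbarDer hU l (dzbarDer hU k f) := by
  simp only [dzbarDer, Derivation.smul_apply, Derivation.add_apply, Derivation.map_smul,
    Derivation.map_add,
    dirDer_comm hU (Pi.single k 1), dirDer_comm hU (Pi.single k Complex.I)]
  module

theorem dzbarDer_dzDer_comm (hU : IsOpen U) (k l : Fin N) (f : SmoothFn U) :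
    dzbarDer hU k (dzDer hU l f) = dzDer hU l (dzbarDer hU k f) := by
  simp only [dzDer, dzbarDer, Derivation.smul_apply, Derivation.add_apply, Derivation.sub_apply,
    Derivation.map_smul, Derivation.map_add, Derivation.map_sub,
    dirDer_comm hU (Pi.single k 1), dirDer_comm hU (Pi.single k Complex.I)]
  module

variable (U) in
/-- The coordinate function `z^k`. -/
def coord (k : Fin N) : SmoothFn U :=
  mkSmooth (fun z => z k) (by fun_prop)

theorem contDiff_coordBar (k : Fin N) :
    ContDiff ℝ ∞ fun z : V N => (starRingEnd ℂ) (z k) :=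
  Complex.conjCLE.contDiff.comp (contDiff_apply ℝ ℂ k)

variable (U) in
/-- The conjugate coordinate function `z̄^k`. -/
def coordBar (k : Fin N) : SmoothFn U :=
  mkSmooth (fun z => (starRingEnd ℂ) (z k)) (contDiff_coordBar k).contDiffOn

theorem fderiv_coord (k : Fin N) (z v : V N) : fderiv ℝ (fun z : V N => z k) z v = v k := by
  have : (fun z : V N => z k) = ContinuousLinearMap.proj (R := ℝ) (φ := fun _ => ℂ) k := rfl
  rw [this, ContinuousLinearMap.fderiv]
  rfl

theorem fderiv_coordBar (k : Fin N) (z v : V N) :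
    fderiv ℝ (fun z : V N => (starRingEnd ℂ) (z k)) z v = (starRingEnd ℂ) (v k) := by
  have : (fun z : V N => (starRingEnd ℂ) (z k)) = (Complex.conjCLE : ℂ →L[ℝ] ℂ).comp
      (ContinuousLinearMap.proj (R := ℝ) (φ := fun _ => ℂ) k) := rfl
  rw [this, ContinuousLinearMap.fderiv]
  rfl

theorem dzDer_coord (hU : IsOpen U) (k l : Fin N) :
    dzDer hU k (coord U l) = if k = l then 1 else 0 := by
  refine smoothFn_ext fun z => ?_
  rw [coord, dzDer_mkSmooth, dz, fderiv_coord, fderiv_coord]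
  by_cases h : k = l
  · subst h; simp
  · simp [h, Ne.symm (a := k) (b := l) h]

theorem dzDer_coordBar (hU : IsOpen U) (k l : Fin N) : dzDer hU k (coordBar U l) = 0 := by
  refine smoothFn_ext fun z => ?_
  rw [coordBar, dzDer_mkSmooth, dz, fderiv_coordBar, fderiv_coordBar]
  by_cases h : k = l
  · subst h; simp
  · simp [Ne.symm (a := k) (b := l) h]

theorem dzbarDer_coord (hU : IsOpen U) (k l : Fin N) : dzbarDer hU k (coord U l) = 0 := by
  refine smoothFn_ext fun z => ?_
  rw [coord, dzbarDer_mkSmooth, dzbar, fderiv_coord, fderiv_coord]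
  by_cases h : k = l
  · subst h; simp
  · simp [Ne.symm (a := k) (b := l) h]

theorem dzbarDer_coordBar (hU : IsOpen U) (k l : Fin N) :
    dzbarDer hU k (coordBar U l) = if k = l then 1 else 0 := by
  refine smoothFn_ext fun z => ?_
  rw [coordBar, dzbarDer_mkSmooth, dzbar, fderiv_coordBar, fderiv_coordBar]
  by_cases h : k = l
  · subst h; simp
  · simp [h, Ne.symm (a := k) (b := l) h]

end SmoothAlg

/-! ### Charts of complex space forms -/

/-- An open set on which `h = 1 + ε |z|²` is positive, with a sign `ε`; it carries the
potential `Φ = ε log h`. -/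
structure SpaceForm (N : ℕ) where
  /-- the domain -/
  U : Set (V N)
  /-- the sign of the curvature -/
  ε : ℤ
  isOpen : IsOpen U
  sq_sign : ε * ε = 1
  pos : ∀ z ∈ U, 0 < 1 + (ε : ℝ) * ∑ k, ‖z k‖ ^ 2

namespace SpaceForm

variable {N : ℕ} (c : SpaceForm N)

/-- The algebra `C^∞(U)`. -/
abbrev E : Type := SmoothFn c.U

/-- The real function `h = 1 + ε |z|²`. -/
def rho (z : V N) : ℝ := 1 + (c.ε : ℝ) * ∑ k, ‖z k‖ ^ 2

/-- The Kähler potential `ε log h`. -/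
def pot (z : V N) : ℝ := c.ε * Real.log (c.rho z)

theorem rho_pos {z : V N} (hz : z ∈ c.U) : 0 < c.rho z := c.pos z hz

theorem contDiff_rho : ContDiff ℝ ∞ c.rho := by
  unfold rho
  refine contDiff_const.add (contDiff_const.mul (ContDiff.sum fun k _ => ?_))
  exact (contDiff_apply ℝ ℂ k).norm_sq ℝ

/-- `∂_k` -/
def dzD (k : Fin N) : Derivation ℂ c.E c.E := dzDer c.isOpen k

/-- `∂_k̄` -/
def bD (k : Fin N) : Derivation ℂ c.E c.E := dzbarDer c.isOpen k

/-- `z^k` -/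
def zc (k : Fin N) : c.E := coord c.U k

/-- `z̄^k` -/
def zb (k : Fin N) : c.E := coordBar c.U k

/-- The function `h = 1 + ε |z|²` as an element of the algebra. -/
def h : c.E := 1 + (c.ε : c.E) * ∑ k, c.zc k * c.zb k

theorem h_apply (z : c.U) : c.h.1 z = (c.rho z : ℂ) := by
  have : ∀ k, (c.zc k * c.zb k).1 z = ((‖z.1 k‖ ^ 2 : ℝ) : ℂ) := by
    intro k
    change z.1 k * (starRingEnd ℂ) (z.1 k) = _
    rw [Complex.mul_conj, Complex.normSq_eq_norm_sq]
  have h2 : (∑ k, c.zc k * c.zb k).1 z = ∑ k, (c.zc k * c.zb k).1 z := sum_val _ _ _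
  have h3 : c.h.1 z = 1 + (c.ε : ℂ) * (∑ k, c.zc k * c.zb k).1 z := rfl
  rw [h3, h2, rho]
  simp only [this]
  push_cast
  rfl

/-- The function `1 / h`. -/
def hInv : c.E := mkSmooth (fun z => ((c.rho z)⁻¹ : ℝ))
  (Complex.ofRealCLM.contDiff.comp_contDiffOn
    (c.contDiff_rho.contDiffOn.inv fun _ hz => (c.rho_pos hz).ne'))

theorem hInv_apply (z : c.U) : c.hInv.1 z = ((c.rho z)⁻¹ : ℝ) := rfl

theorem h_mul_hInv : c.h * c.hInv = 1 := by
  refine smoothFn_ext fun z => ?_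
  change c.h.1 z * c.hInv.1 z = 1
  rw [h_apply, hInv_apply, ← Complex.ofReal_mul, mul_inv_cancel₀ (c.rho_pos z.2).ne',
    Complex.ofReal_one]

/-- The Euler derivation `∑ z^j ∂_j`. -/
def eul : Derivation ℂ c.E c.E := ∑ j, c.zc j • c.dzD j

/-- The derivation `D^k̄ = h (∂_k + ε z̄^k ∑ z^j ∂_j)`. -/
def dD (k : Fin N) : Derivation ℂ c.E c.E :=
  c.h • (c.dzD k + ((c.ε : c.E) * c.zb k) • c.eul)

/-- The function `w_k = ∂_k̄ Φ = z^k / h`. -/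
def w (k : Fin N) : c.E := c.zc k * c.hInv

theorem eul_apply (f : c.E) : c.eul f = ∑ j, c.zc j * c.dzD j f := by
  have : c.eul f = Derivation.coeFnAddMonoidHom c.eul f := rfl
  rw [this, eul, map_sum, Finset.sum_apply]
  rfl

theorem dD_apply (k : Fin N) (f : c.E) :
    c.dD k f = c.h * (c.dzD k f + c.ε * c.zb k * c.eul f) := rfl

theorem dzD_zc (k l : Fin N) : c.dzD k (c.zc l) = if k = l then 1 else 0 := dzDer_coord _ _ _
theorem dzD_zb (k l : Fin N) : c.dzD k (c.zb l) = 0 := dzDer_coordBar _ _ _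
theorem bD_zc (k l : Fin N) : c.bD k (c.zc l) = 0 := dzbarDer_coord _ _ _
theorem bD_zb (k l : Fin N) : c.bD k (c.zb l) = if k = l then 1 else 0 := dzbarDer_coordBar _ _ _
theorem dzD_dzD (k l : Fin N) (f : c.E) : c.dzD k (c.dzD l f) = c.dzD l (c.dzD k f) :=
  dzDer_comm _ _ _ _
theorem bD_bD (k l : Fin N) (f : c.E) : c.bD k (c.bD l f) = c.bD l (c.bD k f) :=
  dzbarDer_comm _ _ _ _
theorem bD_dzD (k l : Fin N) (f : c.E) : c.bD k (c.dzD l f) = c.dzD l (c.bD k f) :=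
  dzbarDer_dzDer_comm _ _ _ _

theorem dzD_h (k : Fin N) : c.dzD k c.h = c.ε * c.zb k := by
  simp [h, dzD_zc, dzD_zb]

theorem bD_h (k : Fin N) : c.bD k c.h = c.ε * c.zc k := by
  simp [h, bD_zc, bD_zb]

theorem eul_h : c.eul c.h = c.h - 1 := by
  have : c.h - 1 = ∑ j, c.ε * (c.zc j * c.zb j) := by
    rw [h, add_sub_cancel_left, Finset.mul_sum]
  rw [this, eul_apply]
  exact Finset.sum_congr rfl fun j _ => by rw [dzD_h]; ring

theorem eul_zc (k : Fin N) : c.eul (c.zc k) = c.zc k := by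
  simp [eul_apply, dzD_zc]

theorem dzD_eul (k : Fin N) (f : c.E) : c.dzD k (c.eul f) = c.dzD k f + c.eul (c.dzD k f) := by
  simp only [eul_apply, map_sum, Derivation.leibniz, smul_eq_mul, dzD_zc, Finset.sum_add_distrib,
    c.dzD_dzD k]
  simp [add_comm]

theorem eul_zb (k : Fin N) : c.eul (c.zb k) = 0 := by
  simp [eul_apply, dzD_zb]

theorem bD_eul (k : Fin N) (f : c.E) : c.bD k (c.eul f) = c.eul (c.bD k f) := by
  simp only [eul_apply, map_sum, Derivation.leibniz, smul_eq_mul, bD_zc, bD_dzD]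
  simp

theorem dD_h (k : Fin N) : c.dD k c.h = c.ε * c.zb k * c.h ^ 2 := by
  rw [dD_apply, dzD_h, eul_h]; ring

theorem dD_hInv (k : Fin N) : c.dD k c.hInv = -(c.ε * c.zb k) := by
  rw [Derivation.leibniz_of_mul_eq_one _ ((mul_comm _ _).trans c.h_mul_hInv), dD_h, smul_eq_mul]
  linear_combination (- c.ε * c.zb k * (1 + c.h * c.hInv)) * c.h_mul_hInv

theorem bD_hInv (k : Fin N) : c.bD k c.hInv = -(c.ε * c.w k * c.hInv) := by
  rw [Derivation.leibniz_of_mul_eq_one _ ((mul_comm _ _).trans c.h_mul_hInv), bD_h, smul_eq_mul, w]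
  ring

theorem dzD_hInv (k : Fin N) : c.dzD k c.hInv = -(c.ε * c.zb k * c.hInv ^ 2) := by
  rw [Derivation.leibniz_of_mul_eq_one _ ((mul_comm _ _).trans c.h_mul_hInv), dzD_h, smul_eq_mul]
  ring

/-- With `z̄` frozen, the `w_i` are coordinates and `D^k = ∂/∂w_k`. This duality is also what
identifies `gInv` as the inverse metric. -/
theorem dD_w (k i : Fin N) : c.dD k (c.w i) = if k = i then 1 else 0 := by
  have hz : c.dD k (c.zc i) = c.h * ((if k = i then 1 else 0) + c.ε * c.zb k * c.zc i) := by
    rw [dD_apply, dzD_zc, eul_zc]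
  rw [w, Derivation.leibniz, dD_hInv, hz, smul_eq_mul, smul_eq_mul]
  linear_combination ((if k = i then 1 else 0) + c.ε * c.zb k * c.zc i) * c.h_mul_hInv

theorem bD_w (i j : Fin N) : c.bD i (c.w j) = -(c.ε * (c.w i * c.w j)) := by
  conv_lhs => rw [w]
  rw [Derivation.leibniz, bD_hInv, bD_zc, smul_eq_mul, smul_zero, add_zero,
    show c.w j = c.zc j * c.hInv from rfl]
  ring

theorem sum_w_mul_dD (f : c.E) : ∑ j, c.w j * c.dD j f = c.h * c.eul f := by
  have : ∀ j, c.w j * c.dD j f = c.zc j * c.dzD j f + (c.ε * (c.zc j * c.zb j)) * c.eul f := by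
    intro j
    rw [w, dD_apply]
    linear_combination (c.zc j * (c.dzD j f + c.ε * c.zb j * c.eul f)) * c.h_mul_hInv
  simp only [this, Finset.sum_add_distrib, ← Finset.sum_mul, ← Finset.mul_sum]
  rw [← eul_apply, h]
  ring

/-- `D^k = h (∂_k + ε z̄^k E)`, with `E` the Euler field, depends on `z̄` through `h` and `z̄^k`
only. Differentiating `h` gives `ε z^i = ε w_i h`, hence the first term; differentiating `z̄^k`
gives `ε h E`, which is `ε ∑ w_j D^j`. -/
theorem bD_dD (i k : Fin N) (f : c.E) : c.bD i (c.dD k f) - c.dD k (c.bD i f)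
    = c.ε * (c.w i * c.dD k f + if i = k then ∑ j, c.w j * c.dD j f else 0) := by
  have e : (if i = k then ∑ j, c.w j * c.dD j f else 0)
      = (if i = k then 1 else 0) * (c.h * c.eul f) := by
    rw [sum_w_mul_dD]; split_ifs <;> simp
  rw [e, dD_apply, dD_apply, Derivation.leibniz, bD_h, map_add, Derivation.leibniz,
    Derivation.leibniz, bD_zb, bD_dzD, bD_eul, w]
  simp only [smul_eq_mul, Derivation.map_intCast, mul_zero, add_zero]
  linear_combination (-(c.ε * c.zc i * (c.dzD k f + c.ε * c.zb k * c.eul f))) * c.h_mul_hInv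

theorem dD_dD (i j : Fin N) (f : c.E) : c.dD i (c.dD j f) = c.dD j (c.dD i f) := by
  have key : ∀ i j, c.dD i (c.dD j f) = c.h ^ 2 * (c.ε * c.zb i * c.dzD j f
      + c.ε * c.ε * c.zb i * c.zb j * c.eul f + c.dzD i (c.dzD j f)
      + c.ε * c.zb j * (c.dzD i f + c.eul (c.dzD i f)) + c.ε * c.zb i * c.eul (c.dzD j f)
      + c.ε * c.ε * c.zb i * c.zb j * c.eul (c.eul f)) := by
    intro i j
    rw [c.dD_apply j, Derivation.leibniz, dD_h, dD_apply]
    simp only [map_add, Derivation.leibniz, smul_eq_mul, dzD_zb, eul_zb, dzD_eul,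
      Derivation.map_intCast]
    ring
  rw [key i j, key j i, c.dzD_dzD i j]
  ring

/-! #### Operators -/

/-- Multiplication by `f` as an operator on `C^∞(U)`. -/
def mulOp (f : c.E) : Module.End ℂ c.E := LinearMap.mulLeft ℂ f
/-- Multiplication by `w_i`. -/
def wOp (i : Fin N) : Module.End ℂ c.E := c.mulOp (c.w i)
/-- The operator `∂_ī`. -/
def bOp (i : Fin N) : Module.End ℂ c.E := (c.bD i : c.E →ₗ[ℂ] c.E)
/-- The operator `D^ī`. -/
def dOp (i : Fin N) : Module.End ℂ c.E := (c.dD i : c.E →ₗ[ℂ] c.E)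

@[simp] theorem mulOp_apply (f g : c.E) : c.mulOp f g = f * g := rfl
@[simp] theorem wOp_apply (i : Fin N) (g : c.E) : c.wOp i g = c.w i * g := rfl
@[simp] theorem bOp_apply (i : Fin N) (g : c.E) : c.bOp i g = c.bD i g := rfl
@[simp] theorem dOp_apply (i : Fin N) (g : c.E) : c.dOp i g = c.dD i g := rfl

theorem mulOp_comm (f g : c.E) : c.mulOp f * c.mulOp g = c.mulOp g * c.mulOp f :=
  LinearMap.ext fun u => mul_left_comm f g u

theorem bOp_mulOp (i : Fin N) (f : c.E) :
    c.bOp i * c.mulOp f - c.mulOp f * c.bOp i = c.mulOp (c.bD i f) := by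
  ext1 u
  simp only [LinearMap.sub_apply, Module.End.mul_apply, bOp_apply, mulOp_apply, Derivation.leibniz,
    smul_eq_mul]
  ring

theorem dOp_mulOp (i : Fin N) (f : c.E) :
    c.dOp i * c.mulOp f - c.mulOp f * c.dOp i = c.mulOp (c.dD i f) := by
  ext1 u
  simp only [LinearMap.sub_apply, Module.End.mul_apply, dOp_apply, mulOp_apply, Derivation.leibniz,
    smul_eq_mul]
  ring

theorem spaceFormRel : SpaceFormRel c.ε c.wOp c.bOp c.dOp where
  D_w k i := by
    rw [wOp, dOp_mulOp, dD_w]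
    ext1 u
    split_ifs <;> simp
  b_b i j := LinearMap.ext fun u => c.bD_bD i j u
  b_D i k := by
    ext1 u
    refine (c.bD_dD i k u).trans ?_
    change _ = c.ε • ((c.wOp i * c.dOp k + if i = k then ∑ j, c.wOp j * c.dOp j else 0) u)
    rw [LinearMap.add_apply, zsmul_eq_mul]
    split_ifs <;> simp [LinearMap.sum_apply]
  b_w i j := by
    rw [show c.wOp j = c.mulOp (c.w j) from rfl, bOp_mulOp, bD_w]
    ext1 u
    change _ = -(c.ε • (c.w i * (c.w j * u)))
    rw [mulOp_apply, zsmul_eq_mul]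
    ring
  w_w i j := c.mulOp_comm _ _
  D_D i j := LinearMap.ext fun u => c.dD_dD i j u

/-! #### The metric -/

theorem dzbar_pot (i : Fin N) {z : V N} (hz : z ∈ c.U) :
    dbarPot c.pot i z = (c.w i).1 ⟨z, hz⟩ := by
  have hd : DifferentiableAt ℝ c.rho z := c.contDiff_rho.contDiffAt.differentiableAt (by simp)
  have h1 : HasFDerivAt (fun z => (c.pot z : ℂ))
      (Complex.ofRealCLM.comp ((c.ε : ℝ) • (c.rho z)⁻¹ • fderiv ℝ c.rho z)) z :=
    Complex.ofRealCLM.hasFDerivAt.comp z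
      ((hd.hasFDerivAt.log (c.rho_pos hz).ne').const_mul (c.ε : ℝ))
  have h2 : HasFDerivAt (fun z => (c.rho z : ℂ)) (Complex.ofRealCLM.comp (fderiv ℝ c.rho z)) z :=
    Complex.ofRealCLM.hasFDerivAt.comp z hd.hasFDerivAt
  have h3 : dbarPot c.pot i z = (c.ε : ℂ) * ((c.rho z)⁻¹ : ℝ) * dzbar i (fun z => (c.rho z : ℂ)) z := by
    rw [dbarPot, dzbar, dzbar, h1.fderiv, h2.fderiv]
    simp
    ring
  have h4 : dzbar i (fun z => (c.rho z : ℂ)) z = (c.bD i c.h).1 ⟨z, hz⟩ := by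
    rw [bD, dzbarDer_apply]
    refine dzbar_congr c.isOpen i (fun y hy => ?_) hz
    rw [extend_of_mem _ hy, h_apply]
  -- One sign comes from `Φ = ε log h`, the other from `∂_ī h = ε z^i`; they cancel by `sq_sign`.
  have h5 : (c.ε * (c.hInv * (c.ε * c.zc i))) = c.w i := by
    have := congrArg (Int.cast : ℤ → c.E) c.sq_sign
    push_cast at this
    rw [w]
    linear_combination (c.zc i * c.hInv) * this
  rw [h3, h4, bD_h, ← h5, mul_assoc]
  rfl

theorem metric_apply (k l : Fin N) {z : V N} (hz : z ∈ c.U) :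
    metric c.pot z k l = (c.dzD k (c.w l)).1 ⟨z, hz⟩ := by
  rw [dzD, dzDer_apply, metric, Matrix.of_apply]
  exact dz_congr c.isOpen k (fun y hy => by rw [dzbar_pot c l hy, extend_of_mem _ hy]) hz

/-- The matrix `g^{ī j} = h (δ_ij + ε z̄^i z^j)`. -/
def gInv (i j : Fin N) : c.E := c.h * ((if i = j then 1 else 0) + c.ε * c.zb i * c.zc j)

theorem dD_eq_sum (i : Fin N) (f : c.E) : c.dD i f = ∑ j, c.gInv i j * c.dzD j f := by
  have : ∀ j, c.gInv i j * c.dzD j f = (if i = j then c.h * c.dzD j f else 0)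
      + c.h * (c.ε * c.zb i) * (c.zc j * c.dzD j f) := by
    intro j; rw [gInv]; split_ifs <;> ring
  simp only [this, Finset.sum_add_distrib, ← Finset.mul_sum, ← eul_apply]
  rw [dD_apply]
  simp
  ring

theorem metric_inv {z : V N} (hz : z ∈ c.U) :
    (metric c.pot z)⁻¹ = Matrix.of fun i j => (c.gInv i j).1 ⟨z, hz⟩ := by
  refine Matrix.inv_eq_left_inv ?_
  ext i l
  rw [Matrix.mul_apply]
  simp only [Matrix.of_apply, metric_apply c _ _ hz]
  have := congrArg (fun f : c.E => f.1 ⟨z, hz⟩) ((c.dD_eq_sum i (c.w l)).symm.trans (c.dD_w i l))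
  simp only [sum_val] at this
  refine this.trans ?_
  rw [Matrix.one_apply]
  split_ifs <;> rfl

theorem D_eq (i : Fin N) (f : V N → ℂ) (hf : ContDiffOn ℝ ∞ f c.U) {z : V N} (hz : z ∈ c.U) :
    D c.pot i f z = (c.dD i (mkSmooth f hf)).1 ⟨z, hz⟩ := by
  rw [D, metric_inv c hz, dD_eq_sum, sum_val]
  refine Finset.sum_congr rfl fun j _ => ?_
  change _ = (c.gInv i j).1 _ * (c.dzD j _).1 _
  rw [dzD, dzDer_mkSmooth]
  rfl

/-- The metric is `1/h` times a rank one perturbation of the identity, so the matrix determinant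
lemma applies: the scaling gives `h^{-N}` and the perturbation one more factor `1 - ε|z|²/h = 1/h`.
-/
theorem det_metric {z : V N} (hz : z ∈ c.U) :
    (metric c.pot z).det = (((c.rho z)⁻¹ ^ (N + 1) : ℝ) : ℂ) := by
  set r : ℂ := (((c.rho z)⁻¹ : ℝ) : ℂ) with hr
  set u : Fin N → ℂ := fun k => -(c.ε * r) * (starRingEnd ℂ) (z k) with hu
  have hm : metric c.pot z = r • (1 + Matrix.replicateCol Unit u * Matrix.replicateRow Unit z) := by
    ext k l
    rw [metric_apply c k l hz, w, Derivation.leibniz, dzD_hInv, dzD_zc, Matrix.smul_apply,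
      Matrix.add_apply, Matrix.mul_apply]
    simp only [Matrix.replicateCol_apply, Matrix.replicateRow_apply, Finset.univ_unique,
      Finset.sum_singleton, hu]
    change z l * (-(c.ε * (starRingEnd ℂ) (z k) * r ^ 2)) + r * (if k = l then (1 : c.E) else 0).1 ⟨z, hz⟩ = _
    rw [Matrix.one_apply, smul_eq_mul]
    split_ifs
    · change _ + r * 1 = _
      ring
    · change _ + r * 0 = _
      ring
  rw [hm, Matrix.det_smul, Matrix.det_one_add_replicateCol_mul_replicateRow, Fintype.card_fin]
  have hd : 1 + z ⬝ᵥ u = r := by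
    have h1 : z ⬝ᵥ u = -(c.ε * r) * ((∑ k, ‖z k‖ ^ 2 : ℝ) : ℂ) := by
      rw [dotProduct, Complex.ofReal_sum, Finset.mul_sum]
      refine Finset.sum_congr rfl fun k _ => ?_
      rw [hu, ← Complex.normSq_eq_norm_sq, ← Complex.mul_conj]
      ring
    have h2 : r * (1 + c.ε * ((∑ k, ‖z k‖ ^ 2 : ℝ) : ℂ)) = 1 := by
      have : (c.rho z)⁻¹ * c.rho z = 1 := inv_mul_cancel₀ (c.rho_pos hz).ne'
      rw [hr]
      have h3 := congrArg (Complex.ofReal) this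
      rw [Complex.ofReal_mul, Complex.ofReal_one] at h3
      refine Eq.trans ?_ h3
      congr 1
      rw [rho]; push_cast; rfl
    rw [h1]
    linear_combination -h2
  rw [hd, ← pow_succ, hr, ← Complex.ofReal_pow]

theorem volDensity_eq {z : V N} (hz : z ∈ c.U) :
    volDensity c.pot z = 2 ^ N * (c.rho z)⁻¹ ^ (N + 1) := by
  rw [volDensity, det_metric c hz, Complex.norm_real, Real.norm_of_nonneg]
  exact pow_nonneg (inv_nonneg.2 (c.rho_pos hz).le) _

end SpaceForm

/-! ### Left star multiplication in a chart: existence and uniqueness -/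

/-- The coefficient of `ℏⁿ` in `ℏᵐ / (m! ∏_{k < m} (1 - ε k ℏ))`. -/
def coef (ε : ℤ) : ℕ → ℕ → ℂ
  | 0, 0 => 1
  | 0, _ + 1 => 0
  | _ + 1, 0 => 0
  | m + 1, n + 1 => coef ε m n / (m + 1) + ε * m * coef ε (m + 1) n

theorem coef_eq_zero (ε : ℤ) (n : ℕ) : ∀ m, n < m → coef ε m n = 0 := by
  induction n with
  | zero =>
    intro m hm
    obtain ⟨m, rfl⟩ := Nat.exists_eq_succ_of_ne_zero hm.ne'
    rw [Nat.succ_eq_add_one, coef]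
  | succ n ih =>
    intro m hm
    obtain ⟨m, rfl⟩ := Nat.exists_eq_succ_of_ne_zero (Nat.ne_zero_of_lt hm)
    rw [Nat.succ_eq_add_one, coef, ih m (by omega), ih (m + 1) (by omega)]
    simp

/-- The form of the recursion that matches coefficients of `S_{m,i}`: the left side comes from
`[T_{m+1}, w_i]`, the right side from `[b_i, T_m]` and from the correction in `[b_i, T_{m+1}]`. -/
theorem coef_succ_succ (ε : ℤ) (m n : ℕ) :
    ((m : ℂ) + 1) * coef ε (m + 1) (n + 1)
      = coef ε m n + ε * (m + 1) * m * coef ε (m + 1) n := by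
  have : ((m : ℂ) + 1) ≠ 0 := by exact_mod_cast Nat.succ_ne_zero m
  rw [coef]
  field_simp

namespace SpaceForm

variable {N : ℕ} (c : SpaceForm N)

/-- The bidifferential operator `Tₘ(f)`. -/
def tf (f : c.E) (m : ℕ) : Module.End ℂ c.E := tOp c.ε c.bOp c.dOp (c.mulOp f) m

/-- The coefficient of `ℏⁿ` in left star multiplication by `f`. -/
def lOp (f : c.E) (n : ℕ) : Module.End ℂ c.E :=
  ∑ m ∈ Finset.range (n + 1), coef c.ε m n • c.tf f m

theorem tf_succ_one (f : c.E) (m : ℕ) : c.tf f (m + 1) 1 = 0 := by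
  rw [tf, tOp_succ_eq_sum_sOp]
  simp [LinearMap.sum_apply]

theorem lOp_zero (f : c.E) : c.lOp f 0 = c.mulOp f := by
  simp [lOp, coef, tf, tOp]

theorem lOp_succ_one (f : c.E) (n : ℕ) : c.lOp f (n + 1) 1 = 0 := by
  rw [lOp, Finset.sum_range_succ']
  simp [LinearMap.sum_apply, tf_succ_one, coef]

/-- Both brackets expand in the same operators `S_{m,i}`, by `SpaceFormRel.tOp_succ_w` and
`bracket_tOp_succ`, and `coef` is the solution of the resulting recursion. -/
theorem lOp_succ_comm (f : c.E) (n : ℕ) (i : Fin N) :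
    (c.lOp f (n + 1) * c.wOp i - c.wOp i * c.lOp f (n + 1))
      + (c.lOp f n * c.bOp i - c.bOp i * c.lOp f n) = 0 := by
  have hf : ∀ i, c.mulOp f * c.wOp i = c.wOp i * c.mulOp f := fun i => c.mulOp_comm _ _
  set S := sOp c.ε c.bOp c.dOp (c.mulOp f) with hS
  have h1 : c.lOp f (n + 1) * c.wOp i - c.wOp i * c.lOp f (n + 1)
      = ∑ m ∈ Finset.range (n + 1), (((m : ℂ) + 1) * coef c.ε (m + 1) (n + 1)) • S m i := by
    rw [lOp, Finset.sum_mul, Finset.mul_sum, ← Finset.sum_sub_distrib, Finset.sum_range_succ']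
    rw [add_eq_left.2 (by simp [coef])]
    refine Finset.sum_congr rfl fun m _ => ?_
    refine (bracket_smul_left _ _ _).trans ?_
    rw [tf, c.spaceFormRel.tOp_succ_w hf, mul_comm, mul_smul, ← hS]
    congr 1
    rw [← Int.cast_smul_eq_zsmul ℂ]
    push_cast; rfl
  have h2 : c.bOp i * c.lOp f n - c.lOp f n * c.bOp i
      = ∑ m ∈ Finset.range (n + 1), coef c.ε m n • S m i
        + ∑ m ∈ Finset.range n, (c.ε * (m + 1) * m * coef c.ε (m + 1) n) • S m i := by
    rw [lOp, Finset.sum_mul, Finset.mul_sum, ← Finset.sum_sub_distrib, Finset.sum_range_succ',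
      Finset.sum_range_succ' (fun m => coef c.ε m n • S m i), add_right_comm,
      ← Finset.sum_add_distrib]
    congr 1
    · refine Finset.sum_congr rfl fun m _ => ?_
      refine (bracket_smul_right _ _ _).trans ?_
      rw [tf, bracket_tOp_succ, smul_add, ← hS]
      congr 1
      rw [← Int.cast_smul_eq_zsmul ℂ, smul_smul, mul_comm]
      push_cast; rfl
    · exact bracket_smul_right _ _ _
  -- The ranges differ by one index, whose coefficient vanishes because `T_m` starts at order `ℏ^m`.
  have h3 : ∑ m ∈ Finset.range n, (c.ε * (m + 1) * m * coef c.ε (m + 1) n) • S m i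
      = ∑ m ∈ Finset.range (n + 1), (c.ε * (m + 1) * m * coef c.ε (m + 1) n) • S m i := by
    rw [Finset.sum_range_succ _ n, coef_eq_zero _ n (n + 1) (by omega)]
    simp
  rw [← sub_neg_eq_add, neg_sub, h1, h2, h3, ← Finset.sum_add_distrib, sub_eq_zero]
  refine Finset.sum_congr rfl fun m _ => ?_
  rw [← add_smul, coef_succ_succ]

/-! #### Differential operators in the `z`-directions -/

/-- The composition of the operators `D^ī` along a list of indices. -/
def word (l : List (Fin N)) : Module.End ℂ c.E := (l.map c.dOp).prod

/-- The space of differential operators of finite order in the `z`-directions. -/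
def holOps : Submodule ℂ (Module.End ℂ c.E) :=
  Submodule.span ℂ {T | ∃ a l, T = c.mulOp a * c.word l}

theorem mulOp_mul_word_mem (a : c.E) (l : List (Fin N)) : c.mulOp a * c.word l ∈ c.holOps :=
  Submodule.subset_span ⟨a, l, rfl⟩

theorem mulOp_mul (f g : c.E) : c.mulOp (f * g) = c.mulOp f * c.mulOp g :=
  LinearMap.ext fun u => mul_assoc f g u

theorem mulOp_one : c.mulOp 1 = 1 := LinearMap.ext fun u => one_mul u

theorem word_mem (l : List (Fin N)) : c.word l ∈ c.holOps := by
  simpa [mulOp_one] using c.mulOp_mul_word_mem 1 l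

theorem mulOp_mem (f : c.E) : c.mulOp f ∈ c.holOps := by
  simpa [word] using c.mulOp_mul_word_mem f []

/-- A linear map that sends the generators to `holOps` preserves `holOps`. -/
theorem map_mem_holOps (L : Module.End ℂ c.E →ₗ[ℂ] Module.End ℂ c.E)
    (hL : ∀ a l, L (c.mulOp a * c.word l) ∈ c.holOps) {T : Module.End ℂ c.E} (hT : T ∈ c.holOps) :
    L T ∈ c.holOps := by
  have : c.holOps ≤ c.holOps.comap L := Submodule.span_le.2 (by rintro _ ⟨a, l, rfl⟩; exact hL a l)
  exact this hT

theorem mulOp_mul_mem (f : c.E) {T : Module.End ℂ c.E} (hT : T ∈ c.holOps) :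
    c.mulOp f * T ∈ c.holOps :=
  c.map_mem_holOps (LinearMap.mulLeft ℂ (c.mulOp f)) (fun a l => by
    rw [LinearMap.mulLeft_apply, ← mul_assoc, ← mulOp_mul]
    exact c.mulOp_mul_word_mem _ _) hT

theorem dOp_mul_mem (i : Fin N) {T : Module.End ℂ c.E} (hT : T ∈ c.holOps) :
    c.dOp i * T ∈ c.holOps :=
  c.map_mem_holOps (LinearMap.mulLeft ℂ (c.dOp i)) (fun a l => by
    have : c.dOp i * (c.mulOp a * c.word l)
        = c.mulOp (c.dD i a) * c.word l + c.mulOp a * c.word (i :: l) := by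
      rw [← dOp_mulOp, word, word, List.map_cons, List.prod_cons, sub_mul, mul_assoc, mul_assoc,
        sub_add_cancel]
    rw [LinearMap.mulLeft_apply, this]
    exact add_mem (c.mulOp_mul_word_mem _ _) (c.mulOp_mul_word_mem _ _)) hT

theorem mul_dOp_mem (i : Fin N) {T : Module.End ℂ c.E} (hT : T ∈ c.holOps) :
    T * c.dOp i ∈ c.holOps :=
  c.map_mem_holOps (LinearMap.mulRight ℂ (c.dOp i)) (fun a l => by
    have : c.mulOp a * c.word l * c.dOp i = c.mulOp a * c.word (l ++ [i]) := by
      simp [word, mul_assoc]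
    rw [LinearMap.mulRight_apply, this]
    exact c.mulOp_mul_word_mem _ _) hT

/-- By `b_D`, bracketing with `∂_ī` creates no `z̄`-derivative: it replaces a letter of the word by
a combination of letters with function coefficients. Hence the recursion never leaves `holOps`. -/
theorem bracket_word_mem (i : Fin N) (l : List (Fin N)) :
    c.bOp i * c.word l - c.word l * c.bOp i ∈ c.holOps := by
  induction l with
  | nil => simp [word]
  | cons k l ih =>
    have hw : c.word (k :: l) = c.dOp k * c.word l := by simp [word]
    have : c.bOp i * c.word (k :: l) - c.word (k :: l) * c.bOp i
        = (c.bOp i * c.dOp k - c.dOp k * c.bOp i) * c.word l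
          + c.dOp k * (c.bOp i * c.word l - c.word l * c.bOp i) := by
      rw [hw, bracket_mul_eq]
    rw [this]
    refine add_mem ?_ (c.dOp_mul_mem k ih)
    rw [c.spaceFormRel.b_D, smul_mul_assoc]
    refine zsmul_mem ?_ _
    rw [add_mul]
    refine add_mem ?_ ?_
    · rw [mul_assoc]
      exact c.mulOp_mul_mem _ (c.dOp_mul_mem _ (c.word_mem l))
    · split_ifs
      · rw [Finset.sum_mul]
        refine sum_mem fun j _ => ?_
        rw [mul_assoc]
        exact c.mulOp_mul_mem _ (c.dOp_mul_mem _ (c.word_mem l))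
      · rw [zero_mul]; exact zero_mem _

theorem bracket_mem (i : Fin N) {T : Module.End ℂ c.E} (hT : T ∈ c.holOps) :
    c.bOp i * T - T * c.bOp i ∈ c.holOps :=
  c.map_mem_holOps (LinearMap.mulLeft ℂ (c.bOp i) - LinearMap.mulRight ℂ (c.bOp i)) (fun a l => by
    have : c.bOp i * (c.mulOp a * c.word l) - c.mulOp a * c.word l * c.bOp i
        = c.mulOp (c.bD i a) * c.word l + c.mulOp a * (c.bOp i * c.word l - c.word l * c.bOp i) := by
      rw [← bOp_mulOp, bracket_mul_eq]
    rw [LinearMap.sub_apply, LinearMap.mulLeft_apply, LinearMap.mulRight_apply, this]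
    exact add_mem (c.mulOp_mul_word_mem _ _) (c.mulOp_mul_mem _ (c.bracket_word_mem i l))) hT

theorem tf_mem (f : c.E) (m : ℕ) : c.tf f m ∈ c.holOps := by
  induction m with
  | zero => exact c.mulOp_mem f
  | succ m ih =>
    rw [tf, tOp]
    exact sub_mem (sum_mem fun i _ => c.mul_dOp_mem i (c.bracket_mem i ih)) (zsmul_mem ih _)

theorem lOp_mem (f : c.E) (n : ℕ) : c.lOp f n ∈ c.holOps :=
  sum_mem fun m _ => Submodule.smul_mem _ _ (c.tf_mem f m)

/-- Operators in `holOps` in the form `∑_{k ≤ m} a_{ī_1 ⋯ ī_k} D^{ī_1} ⋯ D^{ī_k}`. -/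
theorem exists_coefficients {T : Module.End ℂ c.E} (hT : T ∈ c.holOps) :
    ∃ (a : (k : ℕ) → (Fin k → Fin N) → c.E) (m : ℕ), ∀ m' ≥ m,
      T = ∑ k ∈ Finset.range (m' + 1), ∑ J : Fin k → Fin N,
        c.mulOp (a k J) * c.word (List.ofFn J) := by
  induction hT using Submodule.span_induction with
  | mem T h =>
    obtain ⟨a, l, rfl⟩ := h
    classical
    -- Coefficients that vanish above the order allow every larger cutoff `m'`, which is what lets
    -- operators of different orders be added.
    refine ⟨fun k J => if List.ofFn J = l then a else 0, l.length, fun m' hm' => ?_⟩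
    have hz : c.mulOp 0 = 0 := LinearMap.ext fun u => zero_mul u
    rw [Finset.sum_eq_single l.length, Finset.sum_eq_single l.get]
    · simp
    · intro J _ hJ
      simp only []
      rw [if_neg, hz, zero_mul]
      intro h
      exact hJ (List.ofFn_injective (h.trans (List.ofFn_get l).symm))
    · simp
    · intro k _ hk
      refine Finset.sum_eq_zero fun J _ => ?_
      simp only []
      rw [if_neg, hz, zero_mul]
      intro h
      exact hk (by rw [← h, List.length_ofFn])
    · intro h
      exact absurd (Finset.mem_range.2 (by omega)) h
  | zero =>
    refine ⟨fun _ _ => 0, 0, fun m' _ => ?_⟩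
    have hz : c.mulOp 0 = 0 := LinearMap.ext fun u => zero_mul u
    simp [hz]
  | add S T _ _ hS hT =>
    obtain ⟨a, m, ha⟩ := hS
    obtain ⟨b, n, hb⟩ := hT
    refine ⟨fun k J => a k J + b k J, max m n, fun m' hm' => ?_⟩
    have hadd : ∀ f g, c.mulOp (f + g) = c.mulOp f + c.mulOp g :=
      fun f g => LinearMap.ext fun u => add_mul f g u
    simp only [hadd, add_mul, Finset.sum_add_distrib]
    rw [← ha m' (le_trans (le_max_left _ _) hm'), ← hb m' (le_trans (le_max_right _ _) hm')]
  | smul r T _ hT =>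
    obtain ⟨a, m, ha⟩ := hT
    refine ⟨fun k J => r • a k J, m, fun m' hm' => ?_⟩
    have hsmul : ∀ f, c.mulOp (r • f) = r • c.mulOp f :=
      fun f => LinearMap.ext fun u => smul_mul_assoc r f u
    simp only [hsmul, smul_mul_assoc, ← Finset.smul_sum]
    rw [← ha m' hm']

/-- An operator in `holOps` that commutes with all `w_i` is a multiplication operator. -/
theorem eq_mulOp_of_commute {T : Module.End ℂ c.E} (hT : T ∈ c.holOps)
    (hw : ∀ i, T * c.wOp i = c.wOp i * T) : T = c.mulOp (T 1) := by
  obtain ⟨a, m, ha⟩ := c.exists_coefficients hT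
  replace ha := ha m le_rfl
  -- The Euler operator counting letters: the part of order `k` is an eigenvector for `k`, while `T`
  -- itself lies in the kernel, so only the part of order `0` survives.
  let L : Module.End ℂ c.E →ₗ[ℂ] Module.End ℂ c.E := ∑ i, LinearMap.mulRight ℂ (c.dOp i) ∘ₗ
    (LinearMap.mulRight ℂ (c.wOp i) - LinearMap.mulLeft ℂ (c.wOp i))
  have hL : ∀ S, L S = ∑ i, (S * c.wOp i - c.wOp i * S) * c.dOp i := by
    intro S
    simp [L, LinearMap.sum_apply]
  have hLx : ∀ k, L (∑ J : Fin k → Fin N, c.mulOp (a k J) * c.word (List.ofFn J))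
      = (k : ℂ) • ∑ J : Fin k → Fin N, c.mulOp (a k J) * c.word (List.ofFn J) := by
    intro k
    rw [map_sum, Finset.smul_sum]
    refine Finset.sum_congr rfl fun J _ => ?_
    have e : ∀ i, (c.mulOp (a k J) * c.word (List.ofFn J) * c.wOp i
        - c.wOp i * (c.mulOp (a k J) * c.word (List.ofFn J))) * c.dOp i
        = c.mulOp (a k J) * ((c.word (List.ofFn J) * c.wOp i
          - c.wOp i * c.word (List.ofFn J)) * c.dOp i) := by
      intro i
      rw [← mul_assoc (c.wOp i), show c.wOp i * c.mulOp (a k J) = c.mulOp (a k J) * c.wOp i from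
        c.mulOp_comm _ _, mul_assoc, mul_assoc, ← mul_sub, mul_assoc]
    rw [hL]
    simp only [e, ← Finset.mul_sum]
    rw [word, c.spaceFormRel.sum_bracket_word_w_mul_D, List.length_ofFn, mul_smul_comm,
      ← Int.cast_smul_eq_zsmul ℂ]
    push_cast; rfl
  have h0 := sum_eigenvectors_eq_zero_component L m _ hLx (by
    rw [← ha, hL]
    exact Finset.sum_eq_zero fun i _ => by rw [hw, sub_self, zero_mul])
  rw [← ha] at h0
  have h1 : T = c.mulOp (a 0 default) := by
    rw [h0, Fintype.sum_unique]
    simp [word]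
  rw [h1]
  simp

/-! #### Comparison with the operators on functions -/

theorem foldr_D_eq (f : V N → ℂ) (hf : ContDiffOn ℝ ∞ f c.U) (l : List (Fin N)) :
    Set.EqOn (l.foldr (D c.pot) f) (extend (c.word l (mkSmooth f hf)).1) c.U := by
  induction l with
  | nil => exact (extend_mkSmooth f hf).symm
  | cons i l ih =>
    intro z hz
    have hw : c.word (i :: l) = c.dOp i * c.word l := by simp [word]
    have h1 : D c.pot i (l.foldr (D c.pot) f) z
        = D c.pot i (extend (c.word l (mkSmooth f hf)).1) z := by
      simp only [D]
      exact Finset.sum_congr rfl fun j _ => by rw [dz_congr c.isOpen j ih hz]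
    rw [List.foldr_cons, h1, D_eq c i _ (c.word l (mkSmooth f hf)).2 hz, mkSmooth_extend,
      extend_of_mem _ hz, hw]
    rfl

theorem iterD_eq {k : ℕ} (J : Fin k → Fin N) (f : V N → ℂ) (hf : ContDiffOn ℝ ∞ f c.U)
    {z : V N} (hz : z ∈ c.U) :
    iterD c.pot J f z = (c.word (List.ofFn J) (mkSmooth f hf)).1 ⟨z, hz⟩ := by
  rw [iterD, foldr_D_eq c f hf _ hz, extend_of_mem]

theorem sum_sum_word_apply (m : ℕ) (a : (k : ℕ) → (Fin k → Fin N) → c.E) (u : c.E) (z : c.U) :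
    ((∑ k ∈ Finset.range (m + 1), ∑ J : Fin k → Fin N,
      c.mulOp (a k J) * c.word (List.ofFn J)) u).1 z
    = ∑ k ∈ Finset.range (m + 1), ∑ J : Fin k → Fin N,
      (a k J).1 z * (c.word (List.ofFn J) u).1 z := by
  simp only [LinearMap.sum_apply, sum_val]
  rfl

theorem exists_holOp_of_isHolDiffOp {T : (V N → ℂ) → (V N → ℂ)} (hT : IsHolDiffOp c.U c.pot T) :
    ∃ B ∈ c.holOps, ∀ f (hf : ContDiffOn ℝ ∞ f c.U) (z : c.U),
      T f z = (B (mkSmooth f hf)).1 z := by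
  obtain ⟨m, a, ha, hT⟩ := hT
  refine ⟨∑ k ∈ Finset.range (m + 1), ∑ J : Fin k → Fin N,
      c.mulOp (mkSmooth (a k J) (ha k J)) * c.word (List.ofFn J),
      sum_mem fun k _ => sum_mem fun J _ => c.mulOp_mul_word_mem _ _, fun f hf z => ?_⟩
  rw [hT f hf z z.2]
  refine Eq.trans ?_ (c.sum_sum_word_apply m (fun k J => mkSmooth (a k J) (ha k J)) _ z).symm
  refine Finset.sum_congr rfl fun k _ => Finset.sum_congr rfl fun J _ => ?_
  rw [iterD_eq c J f hf z.2]
  rfl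

theorem isHolDiffOp_of_mem {T : (V N → ℂ) → (V N → ℂ)} {B : Module.End ℂ c.E} (hB : B ∈ c.holOps)
    (h : ∀ f (hf : ContDiffOn ℝ ∞ f c.U) (z : c.U), T f z = (B (mkSmooth f hf)).1 z) :
    IsHolDiffOp c.U c.pot T := by
  obtain ⟨a, m, ha⟩ := c.exists_coefficients hB
  refine ⟨m, fun k J => extend (a k J).1, fun k J => (a k J).2, fun f hf z hz => ?_⟩
  rw [h f hf ⟨z, hz⟩, ha m le_rfl]
  refine (c.sum_sum_word_apply m a _ ⟨z, hz⟩).trans ?_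
  refine Finset.sum_congr rfl fun k _ => Finset.sum_congr rfl fun J _ => ?_
  simp only [iterD_eq c J f hf hz, extend_of_mem _ hz]

theorem contDiffOn_dbarPot_mul (i : Fin N) {f : V N → ℂ} (hf : ContDiffOn ℝ ∞ f c.U) :
    ContDiffOn ℝ ∞ (fun y => dbarPot c.pot i y * f y) c.U :=
  ((c.w i).2.congr fun y hy => by rw [dzbar_pot c i hy, extend_of_mem]).mul hf

theorem mkSmooth_dbarPot_mul (i : Fin N) {f : V N → ℂ} (hf : ContDiffOn ℝ ∞ f c.U) :
    mkSmooth _ (c.contDiffOn_dbarPot_mul i hf) = c.w i * mkSmooth f hf :=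
  smoothFn_ext fun z => by
    rw [mkSmooth_apply, dzbar_pot c i z.2]
    rfl

theorem contDiffOn_dzbar (i : Fin N) {f : V N → ℂ} (hf : ContDiffOn ℝ ∞ f c.U) :
    ContDiffOn ℝ ∞ (dzbar i f) c.U :=
  (c.bD i (mkSmooth f hf)).2.congr fun y hy => by
    rw [extend_of_mem _ hy, bD, dzbarDer_mkSmooth]

theorem mkSmooth_dzbar (i : Fin N) {f : V N → ℂ} (hf : ContDiffOn ℝ ∞ f c.U) :
    mkSmooth _ (c.contDiffOn_dzbar i hf) = c.bD i (mkSmooth f hf) :=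
  smoothFn_ext fun z => by rw [mkSmooth_apply, bD, dzbarDer_mkSmooth]

/-- Operators on functions that are given by operators `B n` on `C^∞(U)`. -/
theorem dzbar_of_eq {T : (V N → ℂ) → (V N → ℂ)} {B : Module.End ℂ c.E}
    (h : ∀ f (hf : ContDiffOn ℝ ∞ f c.U) (z : c.U), T f z = (B (mkSmooth f hf)).1 z)
    (i : Fin N) {f : V N → ℂ} (hf : ContDiffOn ℝ ∞ f c.U) (z : c.U) :
    dzbar i (T f) z = (c.bD i (B (mkSmooth f hf))).1 z := by
  rw [bD, dzbarDer_apply]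
  exact dzbar_congr c.isOpen i (fun y hy => by rw [h f hf ⟨y, hy⟩, extend_of_mem]) z.2

/-- Uniqueness is an induction on the order in `ℏ`: once the previous coefficients agree, the
difference of the next ones commutes with every `w_i`, hence is multiplication by its value at `1`,
which is zero. The comparison is made on functions smooth on `U` only, since the axioms leave the
other values of `A n` free. -/
theorem isLeftMul_iff {f : V N → ℂ} (hf : ContDiffOn ℝ ∞ f c.U)
    (A : ℕ → (V N → ℂ) → (V N → ℂ)) :
    IsLeftMul c.U c.pot f A ↔ ∀ n g (hg : ContDiffOn ℝ ∞ g c.U) (z : c.U),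
      A n g z = (c.lOp (mkSmooth f hf) n (mkSmooth g hg)).1 z := by
  constructor
  · intro H
    choose B hB hAB using fun n => c.exists_holOp_of_isHolDiffOp (H.diffOp n)
    have one : mkSmooth (fun _ => 1) contDiffOn_const = (1 : c.E) := rfl
    have hext : ∀ u : c.E, mkSmooth (extend u.1) u.2 = u := mkSmooth_extend
    suffices ∀ n, B n = c.lOp (mkSmooth f hf) n by
      intro n g hg z
      rw [hAB n g hg, this]
    intro n
    induction n with
    | zero =>
      have h1 : B 0 1 = mkSmooth f hf := smoothFn_ext fun z => by
        rw [← one, ← hAB, H.one_zero z z.2]; rfl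
      rw [lOp_zero, c.eq_mulOp_of_commute (hB 0), h1]
      intro i
      refine LinearMap.ext fun u => smoothFn_ext fun z => ?_
      have h2 := H.comm_zero i (extend u.1) u.2 z z.2
      rw [hAB 0 _ (c.contDiffOn_dbarPot_mul i u.2), hAB 0 _ u.2, c.mkSmooth_dbarPot_mul i u.2, hext,
        dzbar_pot c i z.2, sub_eq_zero] at h2
      exact h2
    | succ n ih =>
      have h1 : B (n + 1) 1 = 0 := smoothFn_ext fun z => by
        rw [← one, ← hAB, H.one_succ n z z.2]; rfl
      have hrel : ∀ i, (B (n + 1) * c.wOp i - c.wOp i * B (n + 1))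
          + (B n * c.bOp i - c.bOp i * B n) = 0 := by
        intro i
        refine LinearMap.ext fun u => smoothFn_ext fun z => ?_
        have h2 := H.comm_succ n i (extend u.1) u.2 z z.2
        rw [hAB _ _ (c.contDiffOn_dbarPot_mul i u.2), hAB _ _ u.2, c.mkSmooth_dbarPot_mul i u.2, hext,
          dzbar_pot c i z.2, hAB _ _ (c.contDiffOn_dzbar i u.2), c.mkSmooth_dzbar i u.2,
          c.dzbar_of_eq (hAB n) i u.2, hext] at h2
        exact h2
      have h3 : B (n + 1) - c.lOp (mkSmooth f hf) (n + 1)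
          = c.mulOp ((B (n + 1) - c.lOp (mkSmooth f hf) (n + 1)) 1) := by
        refine c.eq_mulOp_of_commute (sub_mem (hB _) (c.lOp_mem _ _)) fun i => ?_
        have h4 := (hrel i).trans (c.lOp_succ_comm (mkSmooth f hf) n i).symm
        rw [ih] at h4
        have h5 := add_right_cancel h4
        rw [sub_mul, mul_sub, sub_eq_sub_iff_sub_eq_sub]
        exact h5
      rw [LinearMap.sub_apply, h1, lOp_succ_one, sub_zero] at h3
      have hz : c.mulOp 0 = 0 := LinearMap.ext fun u => zero_mul u
      rw [hz] at h3
      exact sub_eq_zero.1 h3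
  · intro H
    have one : mkSmooth (fun _ => 1) contDiffOn_const = (1 : c.E) := rfl
    refine ⟨fun n => c.isHolDiffOp_of_mem (c.lOp_mem _ n) (H n), fun z hz => ?_, fun n z hz => ?_,
      fun i g hg z hz => ?_, fun n i g hg z hz => ?_⟩
    · rw [H 0 _ contDiffOn_const ⟨z, hz⟩, one, lOp_zero, mulOp_apply, mul_one]
      rfl
    · rw [H _ _ contDiffOn_const ⟨z, hz⟩, one, lOp_succ_one]
      rfl
    · rw [H 0 _ (c.contDiffOn_dbarPot_mul i hg) ⟨z, hz⟩, H 0 g hg ⟨z, hz⟩, mkSmooth_dbarPot_mul,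
        lOp_zero, mulOp_apply, mulOp_apply, dzbar_pot c i hz, mul_left_comm]
      exact sub_self _
    · rw [H _ _ (c.contDiffOn_dbarPot_mul i hg) ⟨z, hz⟩, H _ g hg ⟨z, hz⟩, mkSmooth_dbarPot_mul,
        dzbar_pot c i hz, H _ _ (c.contDiffOn_dzbar i hg) ⟨z, hz⟩, mkSmooth_dzbar,
        c.dzbar_of_eq (H n) i hg ⟨z, hz⟩]
      exact congrArg (fun T : Module.End ℂ c.E => (T (mkSmooth g hg)).1 ⟨z, hz⟩)
        (c.lOp_succ_comm (mkSmooth f hf) n i)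

theorem exists_isLeftMul {f : V N → ℂ} (hf : ContDiffOn ℝ ∞ f c.U) :
    ∃ A, IsLeftMul c.U c.pot f A := by
  classical
  refine ⟨fun n g => if hg : ContDiffOn ℝ ∞ g c.U then
    extend (c.lOp (mkSmooth f hf) n (mkSmooth g hg)).1 else 0, (c.isLeftMul_iff hf _).2 ?_⟩
  intro n g hg z
  rw [dif_pos hg, extend_coe]

end SpaceForm

/-! ### Compactly supported functions and integration by parts -/

section CompactSupport

variable {N : ℕ} {U : Set (V N)}

variable (U) in
/-- The ideal of smooth functions on `U` with compact support in `U`. -/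
def csIdeal : Ideal (SmoothFn U) where
  carrier := {u | ∃ K ⊆ U, IsCompact K ∧ ∀ z : U, z.1 ∉ K → u.1 z = 0}
  zero_mem' := ⟨∅, Set.empty_subset _, isCompact_empty, fun _ _ => rfl⟩
  add_mem' := by
    rintro u v ⟨K, hK, hKc, hu⟩ ⟨L, hL, hLc, hv⟩
    refine ⟨K ∪ L, Set.union_subset hK hL, hKc.union hLc, fun z hz => ?_⟩
    rw [add_val, hu z fun h => hz (Or.inl h), hv z fun h => hz (Or.inr h), add_zero]
  smul_mem' := by
    rintro f u ⟨K, hK, hKc, hu⟩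
    exact ⟨K, hK, hKc, fun z hz => by rw [smul_eq_mul, mul_val, hu z hz, mul_zero]⟩

theorem dirDer_mem_csIdeal (hU : IsOpen U) (v : V N) {u : SmoothFn U} (hu : u ∈ csIdeal U) :
    dirDer hU v u ∈ csIdeal U := by
  obtain ⟨K, hK, hKc, hu⟩ := hu
  refine ⟨K, hK, hKc, fun z hz => ?_⟩
  have : extend u.1 =ᶠ[nhds z.1] fun _ => 0 :=
    Filter.eventuallyEq_of_mem ((hU.sdiff hKc.isClosed).mem_nhds ⟨z.2, hz⟩) fun y hy => by
      rw [extend_of_mem _ hy.1, hu _ hy.2]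
  rw [dirDer_apply, this.fderiv_eq]
  simp

theorem smul_mem_csIdeal (r : ℂ) {u : SmoothFn U} (hu : u ∈ csIdeal U) : r • u ∈ csIdeal U := by
  rw [Algebra.smul_def]
  exact Ideal.mul_mem_left _ _ hu

theorem dzDer_mem_csIdeal (hU : IsOpen U) (k : Fin N) {u : SmoothFn U} (hu : u ∈ csIdeal U) :
    dzDer hU k u ∈ csIdeal U :=
  smul_mem_csIdeal _ (sub_mem (dirDer_mem_csIdeal hU _ hu)
    (smul_mem_csIdeal _ (dirDer_mem_csIdeal hU _ hu)))

theorem dzbarDer_mem_csIdeal (hU : IsOpen U) (k : Fin N) {u : SmoothFn U} (hu : u ∈ csIdeal U) :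
    dzbarDer hU k u ∈ csIdeal U :=
  smul_mem_csIdeal _ (add_mem (dirDer_mem_csIdeal hU _ hu)
    (smul_mem_csIdeal _ (dirDer_mem_csIdeal hU _ hu)))

theorem hasCompactSupport_extend {u : SmoothFn U} (hu : u ∈ csIdeal U) :
    HasCompactSupport (extend u.1) := by
  obtain ⟨K, hK, hKc, hu⟩ := hu
  refine HasCompactSupport.intro hKc fun z hz => ?_
  by_cases h : z ∈ U
  · rw [extend_of_mem _ h, hu _ hz]
  · simp [extend, h]

theorem contDiff_extend (hU : IsOpen U) {u : SmoothFn U} (hu : u ∈ csIdeal U) :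
    ContDiff ℝ ∞ (extend u.1) := by
  obtain ⟨K, hK, hKc, hu⟩ := hu
  rw [contDiff_iff_contDiffAt]
  intro z
  by_cases hz : z ∈ K
  · exact u.2.contDiffAt (hU.mem_nhds (hK hz))
  · have : extend u.1 =ᶠ[nhds z] fun _ => 0 :=
      Filter.eventuallyEq_of_mem (hKc.isClosed.isOpen_compl.mem_nhds hz) fun y hy => by
        by_cases h : y ∈ U
        · rw [extend_of_mem _ h, hu ⟨y, h⟩ hy]
        · simp [extend, h]
    exact contDiffAt_const.congr_of_eventuallyEq this

theorem integrable_extend (hU : IsOpen U) {u : SmoothFn U} (hu : u ∈ csIdeal U) :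
    MeasureTheory.Integrable (extend u.1) :=
  (contDiff_extend hU hu).continuous.integrable_of_hasCompactSupport (hasCompactSupport_extend hu)

theorem extend_dirDer (hU : IsOpen U) (v : V N) {u : SmoothFn U} (hu : u ∈ csIdeal U) :
    extend (dirDer hU v u).1 = fun z => fderiv ℝ (extend u.1) z v := by
  funext z
  by_cases h : z ∈ U
  · rw [extend_of_mem _ h, dirDer_apply]
  · obtain ⟨K, hK, hKc, hu⟩ := hu
    have : extend u.1 =ᶠ[nhds z] fun _ => 0 :=
      Filter.eventuallyEq_of_mem (hKc.isClosed.isOpen_compl.mem_nhds fun hz => h (hK hz))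
        fun y hy => by
          by_cases h : y ∈ U
          · rw [extend_of_mem _ h, hu ⟨y, h⟩ hy]
          · simp [extend, h]
    rw [this.fderiv_eq]
    simp [extend, h]

theorem integral_dirDer (hU : IsOpen U) (v : V N) {u : SmoothFn U} (hu : u ∈ csIdeal U) :
    ∫ z, extend (dirDer hU v u).1 z = 0 := by
  have h1 := integrable_extend hU (dirDer_mem_csIdeal hU v hu)
  rw [extend_dirDer hU v hu] at h1 ⊢
  -- Integration by parts against the constant function `1`.
  have := integral_mul_fderiv_eq_neg_fderiv_mul_of_integrable (𝕜 := ℂ)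
    (μ := MeasureTheory.volume) (f := fun _ : V N => (1 : ℂ)) (g := extend u.1) (v := v)
    (by simp) (by simpa using h1) (by simpa using integrable_extend hU hu)
    (fun _ _ => differentiableAt_const _)
    (fun z _ => (contDiff_extend hU hu).differentiable (by simp) z)
  simpa using this

variable (U) in
/-- A linear extension of the integral to `C^∞(U)`. -/
theorem exists_integral_extension (hU : IsOpen U) : ∃ τ : SmoothFn U →ₗ[ℂ] ℂ,
    ∀ u ∈ csIdeal U, τ u = ∫ z, extend u.1 z := by
  let I : Submodule ℂ (SmoothFn U) := (csIdeal U).restrictScalars ℂ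
  let φ : I →ₗ[ℂ] ℂ :=
    { toFun := fun u => ∫ z, extend u.1.1 z
      map_add' := fun u v => by
        rw [← MeasureTheory.integral_add (integrable_extend hU u.2) (integrable_extend hU v.2)]
        congr 1
        funext w; by_cases hw : w ∈ U <;> simp [extend, hw]
      map_smul' := fun r u => by
        rw [RingHom.id_apply, smul_eq_mul, ← MeasureTheory.integral_const_mul]
        congr 1
        funext w; by_cases hw : w ∈ U <;> simp [extend, hw] }
  obtain ⟨τ, hτ⟩ := φ.exists_extend
  exact ⟨τ, fun u hu => LinearMap.congr_fun hτ (⟨u, hu⟩ : I)⟩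

end CompactSupport

/-! ### Integration by parts for the Riemannian volume -/

namespace SpaceForm

variable {N : ℕ} (c : SpaceForm N)

theorem dzD_mem {u : c.E} (hu : u ∈ csIdeal c.U) (k : Fin N) : c.dzD k u ∈ csIdeal c.U :=
  dzDer_mem_csIdeal _ _ hu

theorem bD_mem {u : c.E} (hu : u ∈ csIdeal c.U) (k : Fin N) : c.bD k u ∈ csIdeal c.U :=
  dzbarDer_mem_csIdeal _ _ hu

theorem dD_mem {u : c.E} (hu : u ∈ csIdeal c.U) (k : Fin N) : c.dD k u ∈ csIdeal c.U := by
  rw [dD_eq_sum]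
  exact sum_mem fun j _ => Ideal.mul_mem_left _ _ (c.dzD_mem hu j)

/-- A linear functional on `C^∞(U)` that satisfies, on compactly supported functions, the rules of
integration by parts for the Riemannian volume. -/
structure IsTraceFunctional (σ : c.E →ₗ[ℂ] ℂ) : Prop where
  bD : ∀ i, ∀ u ∈ csIdeal c.U, σ (c.bD i u) = (c.ε * (N + 1)) * σ (c.w i * u)
  dD : ∀ i, ∀ u ∈ csIdeal c.U, σ (c.dD i u) = 0

/-- The density is `h^{-(N+1)}`, and `∂_ī h^{-(N+1)} = -ε(N+1) w_i h^{-(N+1)}` gives the first rule.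
For the second, `D^i` has divergence zero for this density. The functional is extended linearly to
all smooth functions so that the later algebra needs no membership proof for each summand; its
values outside `csIdeal` carry no meaning. -/
theorem exists_isTraceFunctional : ∃ σ : c.E →ₗ[ℂ] ℂ, c.IsTraceFunctional σ ∧
    ∀ u ∈ csIdeal c.U, σ u = ∫ z, extend (u * c.hInv ^ (N + 1)).1 z := by
  obtain ⟨τ, hτ⟩ := exists_integral_extension c.U c.isOpen
  have hdir : ∀ v, ∀ u ∈ csIdeal c.U, τ (dirDer c.isOpen v u) = 0 := fun v u hu => by
    rw [hτ _ (dirDer_mem_csIdeal c.isOpen v hu), integral_dirDer c.isOpen v hu]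
  have hdz : ∀ k, ∀ u ∈ csIdeal c.U, τ (c.dzD k u) = 0 := fun k u hu => by
    change τ ((1 / 2 : ℂ) • (dirDer c.isOpen _ u - Complex.I • dirDer c.isOpen _ u)) = 0
    rw [map_smul, map_sub, map_smul, hdir _ u hu, hdir _ u hu]
    simp
  have hdb : ∀ k, ∀ u ∈ csIdeal c.U, τ (c.bD k u) = 0 := fun k u hu => by
    change τ ((1 / 2 : ℂ) • (dirDer c.isOpen _ u + Complex.I • dirDer c.isOpen _ u)) = 0
    rw [map_smul, map_add, map_smul, hdir _ u hu, hdir _ u hu]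
    simp
  refine ⟨τ ∘ₗ LinearMap.mulRight ℂ (c.hInv ^ (N + 1)), ⟨fun i u hu => ?_, fun i u hu => ?_⟩,
    fun u hu => hτ _ (Ideal.mul_mem_right _ _ hu)⟩
  · have h1 := hdb i _ (Ideal.mul_mem_right (c.hInv ^ (N + 1)) _ hu)
    rw [Derivation.leibniz, Derivation.leibniz_pow, bD_hInv] at h1
    have h2 : u • (N + 1) • c.hInv ^ (N + 1 - 1) • -(↑c.ε * c.w i * c.hInv)
        = (-(c.ε * (N + 1)) : ℂ) • (c.w i * u * c.hInv ^ (N + 1)) := by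
      have : ((-(c.ε * (N + 1)) : ℂ)) • (c.w i * u * c.hInv ^ (N + 1))
          = (-(c.ε * (N + 1)) : c.E) * (c.w i * u * c.hInv ^ (N + 1)) := by
        rw [Algebra.smul_def]
        simp
      rw [this]
      simp only [smul_eq_mul, nsmul_eq_mul, Nat.add_sub_cancel]
      push_cast
      ring
    rw [h2, map_add, map_smul] at h1
    simp only [LinearMap.comp_apply, LinearMap.mulRight_apply]
    rw [smul_eq_mul, smul_eq_mul, mul_comm (c.hInv ^ (N + 1))] at h1
    linear_combination h1
  · simp only [LinearMap.comp_apply, LinearMap.mulRight_apply]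
    set v := u * c.hInv ^ (N + 1) with hv
    have hvm : v ∈ csIdeal c.U := Ideal.mul_mem_right _ _ hu
    have e1 : c.dD i u * c.hInv ^ (N + 1) = c.dD i v + (N + 1) * c.ε * c.zb i * (c.h * v) := by
      rw [hv, Derivation.leibniz, Derivation.leibniz_pow, dD_hInv]
      simp only [smul_eq_mul, nsmul_eq_mul, Nat.add_sub_cancel]
      push_cast
      linear_combination (-(N + 1) * c.ε * c.zb i * u * c.hInv ^ N) * c.h_mul_hInv
    have e2 : c.dzD i (c.h * v) = c.h * c.dzD i v + c.ε * c.zb i * v := by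
      rw [Derivation.leibniz, dzD_h, smul_eq_mul, smul_eq_mul]; ring
    have e3 : ∀ j, c.dzD j (c.zb i * (c.zc j * (c.h * v)))
        = c.zb i * (c.h * v + c.h * (c.zc j * c.dzD j v) + c.ε * (c.zc j * c.zb j) * v) := by
      intro j
      simp only [Derivation.leibniz, dzD_h, dzD_zb, dzD_zc, smul_eq_mul, if_true]
      ring
    have e4 : ∑ j, c.dzD j (c.zb i * (c.zc j * (c.h * v)))
        = c.zb i * (N * (c.h * v) + c.h * c.eul v + (c.h - 1) * v) := by
      have hh : c.h - 1 = c.ε * ∑ j, c.zc j * c.zb j := by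
        rw [h, add_sub_cancel_left]
      simp only [e3, ← Finset.mul_sum, Finset.sum_add_distrib, ← eul_apply, ← Finset.sum_mul]
      rw [← hh]
      simp
      ring
    -- A total derivative: the right side is `∑ ∂_j (g^{ī j} v)`, with `g^{ī j} = h (δ_ij + ε z̄^i
    -- z^j)` written out.
    have e5 : c.dD i u * c.hInv ^ (N + 1) = c.dzD i (c.h * v)
        + (c.ε : ℂ) • ∑ j, c.dzD j (c.zb i * (c.zc j * (c.h * v))) := by
      rw [e1, e2, e4, dD_apply, Algebra.smul_def]
      simp only [map_intCast]
      ring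
    rw [e5, map_add, map_smul, map_sum, hdz _ _ (Ideal.mul_mem_left _ _ hvm)]
    rw [Finset.sum_eq_zero fun j _ => hdz _ _ (Ideal.mul_mem_left _ _ (Ideal.mul_mem_left _ _
      (Ideal.mul_mem_left _ _ hvm)))]
    simp

/-! ### The Laplacian and the symmetry of the trace functional -/

/-- The operator `Δ = ∑ D^ī ∂_ī`. -/
def lap : Module.End ℂ c.E := ∑ i, c.dOp i * c.bOp i

theorem lap_apply (u : c.E) : c.lap u = ∑ i, c.dD i (c.bD i u) := by
  simp [lap, LinearMap.sum_apply]

/-- `Δ + ε n (N + n)` -/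
def shiftLap (n : ℕ) : Module.End ℂ c.E := c.lap + (c.ε * n * (N + n) : ℂ) • 1

theorem shiftLap_apply (n : ℕ) (u : c.E) :
    c.shiftLap n u = c.lap u + (c.ε * n * (N + n) : ℂ) • u := rfl

/-- `∏_{k < n} (Δ + ε k (N + k))` -/
def polyLap : ℕ → Module.End ℂ c.E
  | 0 => 1
  | n + 1 => polyLap n * c.shiftLap n

theorem lap_mem {u : c.E} (hu : u ∈ csIdeal c.U) : c.lap u ∈ csIdeal c.U := by
  rw [lap_apply]
  exact sum_mem fun i _ => c.dD_mem (c.bD_mem hu i) i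

theorem shiftLap_mem (n : ℕ) {u : c.E} (hu : u ∈ csIdeal c.U) : c.shiftLap n u ∈ csIdeal c.U :=
  add_mem (c.lap_mem hu) (smul_mem_csIdeal _ hu)

theorem polyLap_mem (n : ℕ) {u : c.E} (hu : u ∈ csIdeal c.U) : c.polyLap n u ∈ csIdeal c.U := by
  induction n generalizing u with
  | zero => exact hu
  | succ n ih => exact ih (c.shiftLap_mem n hu)

theorem polyLap_commute (n m : ℕ) : Commute (c.polyLap n) (c.shiftLap m) := by
  have h : ∀ k, Commute (c.shiftLap k) (c.shiftLap m) := fun k =>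
    (Commute.add_left (Commute.add_right (Commute.refl _) ((Commute.one_right _).smul_right _))
      ((Commute.one_left _).smul_left _))
  induction n with
  | zero => exact Commute.one_left _
  | succ n ih => exact ih.mul_left (h n)

section Symmetry

variable {c} {σ : c.E →ₗ[ℂ] ℂ}

theorem sum_bD_dD (u : c.E) : ∑ i, c.bD i (c.dD i u)
    = c.lap u + (c.ε * (N + 1) : ℂ) • ∑ i, c.w i * c.dD i u := by
  have h := congrArg (fun T : Module.End ℂ c.E => T u) c.spaceFormRel.sum_b_mul_D
  rw [← Int.cast_smul_eq_zsmul ℂ] at h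
  simp only [LinearMap.sum_apply, LinearMap.add_apply, LinearMap.smul_apply,
    Module.End.mul_apply, bOp_apply, dOp_apply, wOp_apply, Fintype.card_fin] at h
  rw [h, lap_apply]
  push_cast
  rfl

/-- Both sides are minus the Dirichlet form `∑ σ(∂_ī f · D^i g)`. Integrating `∂_ī` by parts
produces `ε(N+1) w_i`, and commuting `∂_ī` past `D^i` produces the same term, so the two cancel. -/
theorem IsTraceFunctional.lap_symm (H : c.IsTraceFunctional σ) {f g : c.E}
    (h : f ∈ csIdeal c.U ∨ g ∈ csIdeal c.U) : σ (f * c.lap g) = σ (c.lap f * g) := by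
  have hm : ∀ i, c.bD i f * g ∈ csIdeal c.U := fun i => h.elim
    (fun h => Ideal.mul_mem_right _ _ (c.bD_mem h i)) (fun h => Ideal.mul_mem_left _ _ h)
  have hm' : ∀ i, f * c.dD i g ∈ csIdeal c.U := fun i => h.elim
    (fun h => Ideal.mul_mem_right _ _ h) (fun h => Ideal.mul_mem_left _ _ (c.dD_mem h i))
  have h1 : ∑ i, σ (c.bD i f * c.dD i g) = - σ (c.lap f * g) := by
    rw [lap_apply, Finset.sum_mul, map_sum, ← Finset.sum_neg_distrib]
    refine Finset.sum_congr rfl fun i _ => ?_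
    have := H.dD i _ (hm i)
    rw [Derivation.leibniz, map_add, smul_eq_mul, smul_eq_mul, mul_comm g] at this
    linear_combination this
  have h2 : ∑ i, σ (c.bD i f * c.dD i g) = - σ (f * c.lap g) := by
    have e : ∀ i, σ (c.bD i f * c.dD i g)
        = (c.ε * (N + 1) : ℂ) * σ (f * (c.w i * c.dD i g)) - σ (f * c.bD i (c.dD i g)) := by
      intro i
      have := H.bD i _ (hm' i)
      rw [Derivation.leibniz, map_add, smul_eq_mul, smul_eq_mul, mul_comm (c.dD i g),
        mul_left_comm] at this
      linear_combination this
    simp only [e, Finset.sum_sub_distrib, ← Finset.mul_sum, ← map_sum]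
    rw [sum_bD_dD, mul_add f, map_add, mul_smul_comm, map_smul, smul_eq_mul]
    ring
  exact neg_injective (h2.symm.trans h1)

theorem IsTraceFunctional.shiftLap_symm (H : c.IsTraceFunctional σ) (n : ℕ) {f g : c.E}
    (h : f ∈ csIdeal c.U ∨ g ∈ csIdeal c.U) :
    σ (f * c.shiftLap n g) = σ (c.shiftLap n f * g) := by
  rw [shiftLap_apply, shiftLap_apply, mul_add, add_mul, map_add, map_add, H.lap_symm h,
    mul_smul_comm, smul_mul_assoc]

theorem IsTraceFunctional.polyLap_symm (H : c.IsTraceFunctional σ) (n : ℕ) {f g : c.E}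
    (h : f ∈ csIdeal c.U ∨ g ∈ csIdeal c.U) :
    σ (f * c.polyLap n g) = σ (c.polyLap n f * g) := by
  induction n generalizing f g with
  | zero => rfl
  | succ n ih =>
    have e : c.polyLap (n + 1) f = c.shiftLap n (c.polyLap n f) :=
      congrArg (fun T : Module.End ℂ c.E => T f) (c.polyLap_commute n n).eq
    rw [e, ← H.shiftLap_symm n (h.imp_left (c.polyLap_mem n)), ← ih (h.imp_right (c.shiftLap_mem n))]
    rfl

/-- Stability of a submodule under the basic operators. -/
def Stable (c : SpaceForm N) (J : Submodule ℂ c.E) : Prop :=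
  ∀ u ∈ J, ∀ i, c.bD i u ∈ J ∧ c.dD i u ∈ J

theorem tf_succ_apply (f u : c.E) (n : ℕ) : c.tf f (n + 1) u
    = ∑ i, (c.bD i (c.tf f n (c.dD i u)) - c.tf f n (c.bD i (c.dD i u)))
      - (c.ε * n * (n - 1) : ℂ) • c.tf f n u := by
  rw [tf, tOp, ← Int.cast_smul_eq_zsmul ℂ]
  simp only [LinearMap.sub_apply, LinearMap.sum_apply, LinearMap.smul_apply, Module.End.mul_apply,
    bOp_apply, dOp_apply]
  push_cast
  rfl

/-- The submodule `J` treats two situations at once: `f` arbitrary with `J` the compactly supported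
functions, and `f` compactly supported with `J` everything. -/
theorem tf_mem_csIdeal {J : Submodule ℂ c.E} (hJ : c.Stable J) {f : c.E}
    (hf : ∀ u ∈ J, f * u ∈ csIdeal c.U) (n : ℕ) : ∀ u ∈ J, c.tf f n u ∈ csIdeal c.U := by
  induction n with
  | zero => exact hf
  | succ n ih =>
    intro u hu
    rw [tf_succ_apply]
    refine sub_mem (sum_mem fun i _ => sub_mem ?_ ?_) (smul_mem_csIdeal _ (ih u hu))
    · exact c.bD_mem (ih _ (hJ u hu i).2) i
    · exact ih _ (hJ _ (hJ u hu i).2 i).1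

/-- Integrating the outer `∂_ī` by parts gives `ε(N+1) w_i`. Moving `w_i` through `T_n` costs `n
T_n` after summation against `D^i`; what then remains cancels the curvature term of `∑ ∂_ī D^i`. The
constants add up to `n(N+1) + n(n-1) = n(N+n)`. -/
theorem IsTraceFunctional.tf_succ (H : c.IsTraceFunctional σ) {J : Submodule ℂ c.E}
    (hJ : c.Stable J) {f : c.E} (hf : ∀ u ∈ J, f * u ∈ csIdeal c.U) (n : ℕ) {u : c.E}
    (hu : u ∈ J) : σ (c.tf f (n + 1) u) = - σ (c.tf f n (c.shiftLap n u)) := by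
  have h1 : ∀ i, σ (c.bD i (c.tf f n (c.dD i u)))
      = (c.ε * (N + 1)) * σ (c.w i * c.tf f n (c.dD i u)) := fun i =>
    H.bD i _ (tf_mem_csIdeal hJ hf n _ (hJ u hu i).2)
  have h2 : ∑ i, c.w i * c.tf f n (c.dD i u)
      = c.tf f n (∑ i, c.w i * c.dD i u) - (n : ℂ) • c.tf f n u := by
    have h := congrArg (fun T : Module.End ℂ c.E => T u)
      (c.spaceFormRel.sum_bracket_tOp_w_mul_D (f := c.mulOp f) (fun i => c.mulOp_comm _ _) n)
    rw [← Int.cast_smul_eq_zsmul ℂ] at h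
    change (∑ i, (c.tf f n * c.wOp i - c.wOp i * c.tf f n) * c.dOp i) u
      = ((n : ℤ) : ℂ) • c.tf f n u at h
    simp only [LinearMap.sub_apply, LinearMap.sum_apply, Module.End.mul_apply,
      wOp_apply, dOp_apply, Finset.sum_sub_distrib] at h
    rw [map_sum, ← Int.cast_natCast, ← h]
    abel
  rw [tf_succ_apply, Finset.sum_sub_distrib, ← map_sum (c.tf f n), sum_bD_dD, map_sub, map_sub,
    map_sum]
  simp only [h1, ← Finset.mul_sum, ← map_sum]
  rw [map_sum σ, ← map_sum σ, h2, shiftLap_apply]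
  simp only [map_add, map_sub, map_smul, smul_eq_mul]
  ring

theorem IsTraceFunctional.tf_eq (H : c.IsTraceFunctional σ) {J : Submodule ℂ c.E}
    (hJ : c.Stable J) {f : c.E} (hf : ∀ u ∈ J, f * u ∈ csIdeal c.U) (n : ℕ) {u : c.E}
    (hu : u ∈ J) : σ (c.tf f n u) = (-1) ^ n * σ (f * c.polyLap n u) := by
  induction n generalizing u with
  | zero => simp [tf, tOp, polyLap]
  | succ n ih =>
    have hs : c.shiftLap n u ∈ J := by
      rw [shiftLap_apply, lap_apply]
      exact add_mem (sum_mem fun i _ => (hJ _ (hJ u hu i).1 i).2) (J.smul_mem _ hu)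
    rw [H.tf_succ hJ hf n hu, ih hs, pow_succ]
    change _ = _ * σ (f * c.polyLap n (c.shiftLap n u))
    ring

/-- The formula for `σ(T_n(f) u)` is used once with each choice of `J`, and the polynomial in `Δ` is
moved across the product. -/
theorem IsTraceFunctional.tf_symm (H : c.IsTraceFunctional σ) {f g : c.E}
    (hg : g ∈ csIdeal c.U) (n : ℕ) : σ (c.tf f n g) = σ (c.tf g n f) := by
  have h1 := H.tf_eq (J := (csIdeal c.U).restrictScalars ℂ)
    (fun u hu i => ⟨c.bD_mem hu i, c.dD_mem hu i⟩) (f := f)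
    (fun u hu => Ideal.mul_mem_left _ _ hu) n (u := g) hg
  have h2 := H.tf_eq (J := ⊤) (fun u hu i => ⟨trivial, trivial⟩) (f := g)
    (fun u hu => Ideal.mul_mem_right _ _ hg) n (u := f) trivial
  rw [h1, h2, H.polyLap_symm n (Or.inr hg), mul_comm g]

end Symmetry

end SpaceForm

/-! ### The trace property in one chart -/

open MeasureTheory

namespace SpaceForm

variable {N : ℕ} {c : SpaceForm N}

theorem lOp_apply (f : c.E) (n : ℕ) (g : c.E) :
    c.lOp f n g = ∑ m ∈ Finset.range (n + 1), coef c.ε m n • c.tf f m g := by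
  simp [lOp, LinearMap.sum_apply]

theorem IsTraceFunctional.lOp_symm {σ : c.E →ₗ[ℂ] ℂ} (H : c.IsTraceFunctional σ) (f : c.E)
    {g : c.E} (hg : g ∈ csIdeal c.U) (n : ℕ) : σ (c.lOp f n g) = σ (c.lOp g n f) := by
  simp only [lOp_apply, map_sum, map_smul, H.tf_symm hg]

theorem lOp_mem_csIdeal_right (f : c.E) {g : c.E} (hg : g ∈ csIdeal c.U) (n : ℕ) :
    c.lOp f n g ∈ csIdeal c.U := by
  rw [lOp_apply]
  refine sum_mem fun m _ => smul_mem_csIdeal _ ?_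
  exact tf_mem_csIdeal (J := (csIdeal c.U).restrictScalars ℂ)
    (fun u hu i => ⟨c.bD_mem hu i, c.dD_mem hu i⟩) (fun u hu => Ideal.mul_mem_left _ _ hu) m g hg

theorem lOp_mem_csIdeal_left {f : c.E} (hf : f ∈ csIdeal c.U) (g : c.E) (n : ℕ) :
    c.lOp f n g ∈ csIdeal c.U := by
  rw [lOp_apply]
  refine sum_mem fun m _ => smul_mem_csIdeal _ ?_
  exact tf_mem_csIdeal (J := ⊤) (fun u hu i => ⟨trivial, trivial⟩)
    (fun u hu => Ideal.mul_mem_right _ _ hf) m g trivial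

theorem lOp_sum_left {κ : Type*} (s : Finset κ) (f : κ → c.E) (n : ℕ) :
    c.lOp (∑ a ∈ s, f a) n = ∑ a ∈ s, c.lOp (f a) n := by
  have h : c.mulOp (∑ a ∈ s, f a) = ∑ a ∈ s, c.mulOp (f a) :=
    LinearMap.ext fun u => by simp [LinearMap.sum_apply, Finset.sum_mul]
  simp only [lOp, tf, h, tOp_sum, Finset.smul_sum]
  exact Finset.sum_comm

/-- The integral of the product of `u` with the Riemannian volume density, up to a constant. -/
def volInt (c : SpaceForm N) (u : c.E) : ℂ := ∫ z in c.U, extend (u * c.hInv ^ (N + 1)).1 z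

theorem volInt_eq_integral (u : c.E) : c.volInt u = ∫ z, extend (u * c.hInv ^ (N + 1)).1 z :=
  setIntegral_eq_integral_of_forall_compl_eq_zero fun z hz => by simp [extend, hz]

/-- The trace property on a chart, if one of the functions has compact support. -/
theorem volInt_lOp_symm (f : c.E) {g : c.E} (hg : g ∈ csIdeal c.U) (n : ℕ) :
    c.volInt (c.lOp f n g) = c.volInt (c.lOp g n f) := by
  obtain ⟨σ, hσ, h⟩ := c.exists_isTraceFunctional
  rw [volInt_eq_integral, volInt_eq_integral, ← h _ (lOp_mem_csIdeal_right f hg n),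
    ← h _ (lOp_mem_csIdeal_left hg f n), hσ.lOp_symm f hg]

end SpaceForm

/-! ### Atlases whose charts are space forms -/

namespace KahlerAtlas

variable {N : ℕ} {M : Type} (𝒜 : KahlerAtlas N M) (c : SpaceForm N)

/-- All charts of the atlas have the domain and the potential of `c`. -/
structure IsForm : Prop where
  dom_eq : ∀ i, 𝒜.dom i = c.U
  pot_eq : ∀ i, 𝒜.pot i = c.pot

variable {𝒜 c} (H : 𝒜.IsForm c)

/-- The function `F` on `M` in the chart `i`. -/
def chartFn (F : 𝒜.Smooth) (i : 𝒜.ι) : c.E :=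
  mkSmooth (𝒜.rep i F.1) (H.dom_eq i ▸ F.2 i)

theorem chartFn_apply (F : 𝒜.Smooth) (i : 𝒜.ι) (z : 𝒜.dom i) (hz : z.1 ∈ c.U) :
    (chartFn H F i).1 ⟨z, hz⟩ = F.1 (𝒜.param i z) :=
  dif_pos z.2

theorem chartFn_ext {F G : 𝒜.Smooth} (h : ∀ i, chartFn H F i = chartFn H G i) : F = G := by
  refine Subtype.ext (funext fun p => ?_)
  obtain ⟨i, z, rfl⟩ := 𝒜.cover p
  have hz : z.1 ∈ c.U := H.dom_eq i ▸ z.2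
  rw [← chartFn_apply H F i z hz, h, chartFn_apply]

theorem isKarabegovStar_iff (star : 𝒜.Smooth → 𝒜.Smooth → ℕ → 𝒜.Smooth) :
    𝒜.IsKarabegovStar star ↔ ∀ F G n i,
      chartFn H (star F G n) i = c.lOp (chartFn H F i) n (chartFn H G i) := by
  constructor
  · intro h F G n i
    obtain ⟨A, hA, hG⟩ := h F i
    rw [H.dom_eq, H.pot_eq, c.isLeftMul_iff (H.dom_eq i ▸ F.2 i)] at hA
    refine smoothFn_ext fun z => ?_
    have hz : z.1 ∈ 𝒜.dom i := (H.dom_eq i).symm ▸ z.2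
    exact (hG G n z hz).trans (hA n _ (H.dom_eq i ▸ G.2 i) z)
  · intro h F i
    obtain ⟨A, hA⟩ := c.exists_isLeftMul (f := 𝒜.rep i F.1) (H.dom_eq i ▸ F.2 i)
    refine ⟨A, by rwa [H.dom_eq, H.pot_eq], fun G n z hz => ?_⟩
    rw [c.isLeftMul_iff (H.dom_eq i ▸ F.2 i)] at hA
    have hz' : z ∈ c.U := H.dom_eq i ▸ hz
    refine Eq.trans ?_ (hA n _ (H.dom_eq i ▸ G.2 i) ⟨z, hz'⟩).symm
    exact congrArg (fun u : c.E => u.1 ⟨z, hz'⟩) (h F G n i)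

/-- Gluing of functions on the charts. -/
theorem exists_chartFn_eq (u : 𝒜.ι → c.E)
    (hu : ∀ i j (z : 𝒜.dom i) (z' : 𝒜.dom j) (hz : z.1 ∈ c.U) (hz' : z'.1 ∈ c.U),
      𝒜.param i z = 𝒜.param j z' → (u i).1 ⟨z, hz⟩ = (u j).1 ⟨z', hz'⟩) :
    ∃ F : 𝒜.Smooth, ∀ i, chartFn H F i = u i := by
  choose ix pt hpt using 𝒜.cover
  have hmem : ∀ i (z : 𝒜.dom i), z.1 ∈ c.U := fun i z => H.dom_eq i ▸ z.2
  let F : M → ℂ := fun p => (u (ix p)).1 ⟨pt p, hmem _ _⟩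
  have hF : ∀ i (z : 𝒜.dom i), F (𝒜.param i z) = (u i).1 ⟨z, hmem i z⟩ := fun i z =>
    hu _ _ _ _ _ _ (hpt _)
  have hrep : ∀ i, Set.EqOn (𝒜.rep i F) (extend (u i).1) c.U := fun i z hz => by
    have hz' : z ∈ 𝒜.dom i := (H.dom_eq i).symm ▸ hz
    rw [extend_of_mem _ hz, rep, dif_pos hz', hF]
  refine ⟨⟨F, fun i => ?_⟩, fun i => ?_⟩
  · rw [H.dom_eq]
    exact (u i).2.congr (hrep i)
  · refine smoothFn_ext fun z => ?_
    exact (hrep i z.2).trans (extend_of_mem _ z.2)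

/-- The chart formula `lOp` leaves no freedom, so uniqueness is automatic and existence reduces to
compatibility on overlaps. -/
theorem existsUnique_star
    (hglue : ∀ F G n, ∃ K : 𝒜.Smooth, ∀ i,
      chartFn H K i = c.lOp (chartFn H F i) n (chartFn H G i)) :
    ∃! star, 𝒜.IsKarabegovStar star := by
  choose star hstar using hglue
  refine ⟨star, (isKarabegovStar_iff H star).2 hstar, fun star' h' => ?_⟩
  funext F G n
  refine chartFn_ext H fun i => ?_
  rw [hstar, (isKarabegovStar_iff H star').1 h']

theorem integrand_eqOn (i : 𝒜.ι) (F : 𝒜.Smooth) : Set.EqOn (𝒜.integrand i F)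
    (fun z => 2 ^ N * extend (chartFn H F i * c.hInv ^ (N + 1)).1 z) c.U := by
  intro z hz
  rw [integrand, H.pot_eq, c.volDensity_eq hz]
  simp only
  rw [extend_of_mem _ hz, mul_val, pow_val, SpaceForm.hInv_apply]
  change 𝒜.rep i F.1 z * _ = 2 ^ N * (𝒜.rep i F.1 z * _)
  push_cast
  ring

theorem volIntegral_eq (i : 𝒜.ι) (F : 𝒜.Smooth) :
    𝒜.volIntegral i F = 2 ^ N * c.volInt (chartFn H F i) := by
  rw [volIntegral, H.dom_eq, setIntegral_congr_fun c.isOpen.measurableSet (integrand_eqOn H i F),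
    integral_const_mul]
  rfl

theorem volIntegrable_iff (i : 𝒜.ι) (F : 𝒜.Smooth) : 𝒜.VolIntegrable i F ↔
    IntegrableOn (extend (chartFn H F i * c.hInv ^ (N + 1)).1) c.U := by
  rw [VolIntegrable, H.dom_eq, integrableOn_congr_fun (integrand_eqOn H i F) c.isOpen.measurableSet]
  exact integrable_const_mul_iff (by simp) _

theorem volIntegrable_of_mem (i : 𝒜.ι) (F : 𝒜.Smooth) (h : chartFn H F i ∈ csIdeal c.U) :
    𝒜.VolIntegrable i F :=
  (volIntegrable_iff H i F).2
    (integrable_extend c.isOpen (Ideal.mul_mem_right _ _ h)).integrableOn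

end KahlerAtlas

/-! ### Complex hyperbolic space -/

/-- The chart of `ℂH^N`. -/
def chForm (N : ℕ) : SpaceForm N where
  U := unitBall N
  ε := -1
  isOpen := isOpen_lt (by fun_prop) continuous_const
  sq_sign := by norm_num
  pos := fun z hz => by
    have : ∑ k, ‖z k‖ ^ 2 < 1 := hz
    push_cast
    linarith

theorem isForm_CH (N : ℕ) : (CH N).IsForm (chForm N) where
  dom_eq _ := rfl
  pot_eq _ := by
    funext z
    change -Real.log (1 - ∑ k, ‖z k‖ ^ 2)
      = ((-1 : ℤ) : ℝ) * Real.log (1 + ((-1 : ℤ) : ℝ) * ∑ k, ‖z k‖ ^ 2)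
    push_cast
    rw [neg_one_mul, neg_one_mul, ← sub_eq_add_neg]

theorem chartFn_CH_mem {N : ℕ} (F : (CH N).Smooth) (hF : HasCompactSupport F.1) (i : (CH N).ι) :
    KahlerAtlas.chartFn (isForm_CH N) F i ∈ csIdeal (chForm N).U := by
  refine ⟨Subtype.val '' tsupport F.1, ?_, hF.isCompact.image continuous_subtype_val,
    fun z hz => ?_⟩
  · rintro _ ⟨z, -, rfl⟩
    exact z.2
  · refine (KahlerAtlas.chartFn_apply (isForm_CH N) F i z z.2).trans ?_
    refine image_eq_zero_of_notMem_tsupport fun h => hz ⟨_, h, rfl⟩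

theorem existsUnique_star_CH (N : ℕ) : ∃! star, (CH N).IsKarabegovStar star :=
  KahlerAtlas.existsUnique_star (isForm_CH N) fun F G n =>
    KahlerAtlas.exists_chartFn_eq (isForm_CH N) _ (by
      rintro ⟨⟩ ⟨⟩ z z' hz hz' h
      obtain rfl : z = z' := h
      rfl)

theorem trace_CH (N : ℕ) (star : (CH N).Smooth → (CH N).Smooth → ℕ → (CH N).Smooth)
    (hstar : (CH N).IsKarabegovStar star) (F G : (CH N).Smooth)
    (hF : HasCompactSupport F.1) (hG : HasCompactSupport G.1) (i : (CH N).ι) (n : ℕ) :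
    (CH N).VolIntegrable i (star F G n) ∧ (CH N).VolIntegrable i (star G F n) ∧
      (CH N).volIntegral i (star F G n) = (CH N).volIntegral i (star G F n) := by
  have H := isForm_CH N
  have h := (KahlerAtlas.isKarabegovStar_iff H star).1 hstar
  refine ⟨KahlerAtlas.volIntegrable_of_mem H i _ ?_, KahlerAtlas.volIntegrable_of_mem H i _ ?_, ?_⟩
  · rw [h]
    exact SpaceForm.lOp_mem_csIdeal_right _ (chartFn_CH_mem G hG i) n
  · rw [h]
    exact SpaceForm.lOp_mem_csIdeal_right _ (chartFn_CH_mem F hF i) n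
  · rw [KahlerAtlas.volIntegral_eq H, KahlerAtlas.volIntegral_eq H, h, h,
      SpaceForm.volInt_lOp_symm _ (chartFn_CH_mem G hG i)]

/-! ### Complex projective space: gluing in homogeneous coordinates -/

/-- The inhomogeneous charts of `ℂP^N`. -/
def cpForm (N : ℕ) : SpaceForm N where
  U := Set.univ
  ε := 1
  isOpen := isOpen_univ
  sq_sign := by norm_num
  pos := fun z _ => by
    have : 0 ≤ ∑ k, ‖z k‖ ^ 2 := Finset.sum_nonneg fun k _ => by positivity
    push_cast
    linarith

theorem isForm_CP (N : ℕ) : (CP N).IsForm (cpForm N) where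
  dom_eq _ := rfl
  pot_eq _ := by
    funext z
    change Real.log (1 + ∑ k, ‖z k‖ ^ 2)
      = ((1 : ℤ) : ℝ) * Real.log (1 + ((1 : ℤ) : ℝ) * ∑ k, ‖z k‖ ^ 2)
    push_cast
    rw [one_mul, one_mul]

theorem fderiv_eq_sum_wirtinger {N : ℕ} (f : V N → ℂ) (z v : V N) :
    fderiv ℝ f z v = ∑ k, (v k * dz k f z + (starRingEnd ℂ) (v k) * dzbar k f z) := by
  have h1 : ∀ (k : Fin N) (a : ℂ), (Pi.single k a : V N)
      = a.re • (Pi.single k 1 : V N) + a.im • (Pi.single k Complex.I : V N) := by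
    intro k a
    rw [← Pi.single_smul, ← Pi.single_smul, ← Pi.single_add]
    congr 1
    simp
  conv_lhs => rw [← Finset.univ_sum_single v, map_sum]
  refine Finset.sum_congr rfl fun k _ => ?_
  rw [h1, map_add, map_smul, map_smul, dz, dzbar]
  generalize fderiv ℝ f z (Pi.single k 1) = X
  generalize fderiv ℝ f z (Pi.single k Complex.I) = Y
  obtain ⟨a, b⟩ := v k
  apply Complex.ext <;> simp <;> ring

/-- The inhomogeneous coordinates with respect to the index `i`. -/
def proj {N : ℕ} (i : Fin (N + 1)) (Z : V (N + 1)) : V N := fun k => Z (i.succAbove k) / Z i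

section Pull

variable {N : ℕ} {i : Fin (N + 1)} {Ω : Set (V (N + 1))}

theorem contDiffOn_proj (hi : ∀ Z ∈ Ω, Z i ≠ 0) : ContDiffOn ℝ ∞ (proj i) Ω := by
  rw [contDiffOn_pi]
  intro k
  have hA : ∀ A, ContDiffOn ℝ ∞ (fun Z : V (N + 1) => Z A) Ω := fun A => by fun_prop
  have hinv : ContDiffOn ℝ ∞ (fun Z : V (N + 1) => (Z i)⁻¹) Ω := (hA i).inv hi
  exact ((hA _).mul hinv).congr fun Z _ => div_eq_mul_inv _ _

theorem contDiff_extend_univ (u : (cpForm N).E) : ContDiff ℝ ∞ (extend u.1) :=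
  contDiffOn_univ.1 u.2

theorem extend_univ (u : (cpForm N).E) (z : V N) : extend u.1 z = u.1 ⟨z, trivial⟩ :=
  extend_of_mem _ _

/-- Pull-back of functions of inhomogeneous coordinates to homogeneous coordinates. -/
def pull (hi : ∀ Z ∈ Ω, Z i ≠ 0) : (cpForm N).E →ₐ[ℂ] SmoothFn Ω where
  toFun u := mkSmooth (fun Z => extend u.1 (proj i Z))
    ((contDiff_extend_univ u).comp_contDiffOn (contDiffOn_proj hi))
  map_one' := smoothFn_ext fun Z => by simp [extend_univ]
  map_zero' := smoothFn_ext fun Z => by simp [extend_univ]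
  map_add' u v := smoothFn_ext fun Z => by simp [extend_univ]
  map_mul' u v := smoothFn_ext fun Z => by simp [extend_univ]
  commutes' r := smoothFn_ext fun Z => by
    simp only [mkSmooth_apply, extend_univ]
    rfl

theorem pull_apply (hi : ∀ Z ∈ Ω, Z i ≠ 0) (u : (cpForm N).E) (Z : Ω) :
    (pull hi u).1 Z = u.1 ⟨proj i Z, trivial⟩ := extend_univ _ _

/-- The chain rule, with the derivative of the inner map expressed through its components, the
pulled back `z^k` and `z̄^k`. -/
theorem dirDer_pull (hΩ : IsOpen Ω) (hi : ∀ Z ∈ Ω, Z i ≠ 0) (v : V (N + 1)) (u : (cpForm N).E) :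
    dirDer hΩ v (pull hi u)
      = ∑ k, (pull hi ((cpForm N).dzD k u) * dirDer hΩ v (pull hi ((cpForm N).zc k))
        + pull hi ((cpForm N).bD k u) * dirDer hΩ v (pull hi ((cpForm N).zb k))) := by
  refine smoothFn_ext fun Z => ?_
  have hp : DifferentiableAt ℝ (proj i) Z.1 :=
    ((contDiffOn_proj hi).contDiffAt (hΩ.mem_nhds Z.2)).differentiableAt (by simp)
  have key : ∀ u : (cpForm N).E, (dirDer hΩ v (pull hi u)).1 Z
      = fderiv ℝ (extend u.1) (proj i Z) (fderiv ℝ (proj i) Z v) := by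
    intro u
    refine (dirDer_mkSmooth hΩ v (fun Z => extend u.1 (proj i Z))
      ((contDiff_extend_univ u).comp_contDiffOn (contDiffOn_proj hi)) Z).trans ?_
    have := fderiv_comp Z.1 ((contDiff_extend_univ u).differentiable (by simp) (proj i Z)) hp
    exact congrArg (fun L => L v) this
  have hzc : ∀ k, extend ((cpForm N).zc k).1 = fun z : V N => z k := fun k =>
    funext fun z => extend_univ _ z
  have hzb : ∀ k, extend ((cpForm N).zb k).1 = fun z : V N => (starRingEnd ℂ) (z k) := fun k =>
    funext fun z => extend_univ _ z
  rw [key, fderiv_eq_sum_wirtinger, sum_val]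
  refine Finset.sum_congr rfl fun k _ => ?_
  rw [add_val, mul_val, mul_val, key, key, hzc, hzb, fderiv_coord, fderiv_coordBar, pull_apply,
    pull_apply, SpaceForm.dzD, dzDer_apply, SpaceForm.bD, dzbarDer_apply]
  ring

theorem dzDer_pull_aux (hΩ : IsOpen Ω) (hi : ∀ Z ∈ Ω, Z i ≠ 0) (A : Fin (N + 1))
    (u : (cpForm N).E) : dzDer hΩ A (pull hi u)
      = ∑ k, (pull hi ((cpForm N).dzD k u) * dzDer hΩ A (pull hi ((cpForm N).zc k))
        + pull hi ((cpForm N).bD k u) * dzDer hΩ A (pull hi ((cpForm N).zb k))) := by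
  simp only [dzDer, Derivation.smul_apply, Derivation.sub_apply]
  rw [dirDer_pull, dirDer_pull, Finset.smul_sum, ← Finset.sum_sub_distrib, Finset.smul_sum]
  refine Finset.sum_congr rfl fun k _ => ?_
  simp only [mul_smul_comm, mul_sub, smul_add, smul_sub]
  abel

theorem dzbarDer_pull_aux (hΩ : IsOpen Ω) (hi : ∀ Z ∈ Ω, Z i ≠ 0) (A : Fin (N + 1))
    (u : (cpForm N).E) : dzbarDer hΩ A (pull hi u)
      = ∑ k, (pull hi ((cpForm N).dzD k u) * dzbarDer hΩ A (pull hi ((cpForm N).zc k))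
        + pull hi ((cpForm N).bD k u) * dzbarDer hΩ A (pull hi ((cpForm N).zb k))) := by
  simp only [dzbarDer, Derivation.smul_apply, Derivation.add_apply]
  rw [dirDer_pull, dirDer_pull, Finset.smul_sum, ← Finset.sum_add_distrib, Finset.smul_sum]
  refine Finset.sum_congr rfl fun k _ => ?_
  simp only [mul_smul_comm, mul_add, smul_add]
  abel

/-- The function `1 / Z^i`. -/
def invCoord (hi : ∀ Z ∈ Ω, Z i ≠ 0) : SmoothFn Ω :=
  mkSmooth (fun Z => (Z i)⁻¹) (ContDiffOn.inv (by fun_prop) hi)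

/-- The function `1 / Z̄^i`. -/
def invCoordBar (hi : ∀ Z ∈ Ω, Z i ≠ 0) : SmoothFn Ω :=
  mkSmooth (fun Z => ((starRingEnd ℂ) (Z i))⁻¹)
    (ContDiffOn.inv (contDiff_coordBar i).contDiffOn fun Z hZ => by simpa using hi Z hZ)

theorem invCoord_mul (hi : ∀ Z ∈ Ω, Z i ≠ 0) : invCoord hi * coord Ω i = 1 :=
  smoothFn_ext fun Z => inv_mul_cancel₀ (hi Z Z.2)

theorem invCoordBar_mul (hi : ∀ Z ∈ Ω, Z i ≠ 0) : invCoordBar hi * coordBar Ω i = 1 :=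
  smoothFn_ext fun Z => inv_mul_cancel₀ (by simpa using hi Z Z.2)

theorem pull_zc (hi : ∀ Z ∈ Ω, Z i ≠ 0) (k : Fin N) :
    pull hi ((cpForm N).zc k) = invCoord hi * coord Ω (i.succAbove k) :=
  smoothFn_ext fun Z => (pull_apply hi _ Z).trans (div_eq_inv_mul _ _)

theorem pull_zb (hi : ∀ Z ∈ Ω, Z i ≠ 0) (k : Fin N) :
    pull hi ((cpForm N).zb k) = invCoordBar hi * coordBar Ω (i.succAbove k) :=
  smoothFn_ext fun Z => (pull_apply hi _ Z).trans ((map_div₀ _ _ _).trans (div_eq_inv_mul _ _))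

theorem dzDer_invCoordBar (hΩ : IsOpen Ω) (hi : ∀ Z ∈ Ω, Z i ≠ 0) (A : Fin (N + 1)) :
    dzDer hΩ A (invCoordBar hi) = 0 := by
  rw [Derivation.leibniz_of_mul_eq_one _ (invCoordBar_mul hi), dzDer_coordBar, smul_zero]

theorem dzbarDer_invCoord (hΩ : IsOpen Ω) (hi : ∀ Z ∈ Ω, Z i ≠ 0) (A : Fin (N + 1)) :
    dzbarDer hΩ A (invCoord hi) = 0 := by
  rw [Derivation.leibniz_of_mul_eq_one _ (invCoord_mul hi), dzbarDer_coord, smul_zero]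

theorem dzDer_pull_zb (hΩ : IsOpen Ω) (hi : ∀ Z ∈ Ω, Z i ≠ 0) (A : Fin (N + 1)) (k : Fin N) :
    dzDer hΩ A (pull hi ((cpForm N).zb k)) = 0 := by
  rw [pull_zb, Derivation.leibniz, dzDer_coordBar, dzDer_invCoordBar, smul_zero, smul_zero,
    add_zero]

theorem dzbarDer_pull_zc (hΩ : IsOpen Ω) (hi : ∀ Z ∈ Ω, Z i ≠ 0) (A : Fin (N + 1)) (k : Fin N) :
    dzbarDer hΩ A (pull hi ((cpForm N).zc k)) = 0 := by
  rw [pull_zc, Derivation.leibniz, dzbarDer_coord, dzbarDer_invCoord, smul_zero, smul_zero,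
    add_zero]

theorem dzDer_succAbove_pull (hΩ : IsOpen Ω) (hi : ∀ Z ∈ Ω, Z i ≠ 0) (k : Fin N)
    (u : (cpForm N).E) : dzDer hΩ (i.succAbove k) (pull hi u)
      = invCoord hi * pull hi ((cpForm N).dzD k u) := by
  rw [dzDer_pull_aux, Finset.sum_eq_single k]
  · rw [dzDer_pull_zb, pull_zc, Derivation.leibniz,
      Derivation.leibniz_of_mul_eq_one _ (invCoord_mul hi), dzDer_coord, dzDer_coord]
    simp only [smul_eq_mul, if_neg (Fin.succAbove_ne i k), if_true]
    ring
  · intro l _ hl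
    rw [dzDer_pull_zb, pull_zc, Derivation.leibniz,
      Derivation.leibniz_of_mul_eq_one _ (invCoord_mul hi), dzDer_coord, dzDer_coord]
    simp only [smul_eq_mul, if_neg (Fin.succAbove_ne i k),
      if_neg fun h => hl (Fin.succAbove_right_injective h).symm]
    ring
  · simp

/-- Pulled back functions are homogeneous of degree zero, so the derivative along `Z^i` is
determined by the others through Euler's relation. -/
theorem dzDer_self_pull (hΩ : IsOpen Ω) (hi : ∀ Z ∈ Ω, Z i ≠ 0)
    (u : (cpForm N).E) : dzDer hΩ i (pull hi u)
      = -(invCoord hi * pull hi ((cpForm N).eul u)) := by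
  rw [dzDer_pull_aux, SpaceForm.eul_apply, map_sum, Finset.mul_sum, ← Finset.sum_neg_distrib]
  refine Finset.sum_congr rfl fun k _ => ?_
  rw [dzDer_pull_zb, map_mul, pull_zc, Derivation.leibniz,
    Derivation.leibniz_of_mul_eq_one _ (invCoord_mul hi), dzDer_coord, dzDer_coord]
  simp only [smul_eq_mul, if_neg (Fin.succAbove_ne i k).symm, if_true]
  ring

theorem dzbarDer_succAbove_pull (hΩ : IsOpen Ω) (hi : ∀ Z ∈ Ω, Z i ≠ 0) (k : Fin N)
    (u : (cpForm N).E) : dzbarDer hΩ (i.succAbove k) (pull hi u)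
      = invCoordBar hi * pull hi ((cpForm N).bD k u) := by
  rw [dzbarDer_pull_aux, Finset.sum_eq_single k]
  · rw [dzbarDer_pull_zc, pull_zb, Derivation.leibniz,
      Derivation.leibniz_of_mul_eq_one _ (invCoordBar_mul hi), dzbarDer_coordBar, dzbarDer_coordBar]
    simp only [smul_eq_mul, if_neg (Fin.succAbove_ne i k), if_true]
    ring
  · intro l _ hl
    rw [dzbarDer_pull_zc, pull_zb, Derivation.leibniz,
      Derivation.leibniz_of_mul_eq_one _ (invCoordBar_mul hi), dzbarDer_coordBar, dzbarDer_coordBar]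
    simp only [smul_eq_mul, if_neg (Fin.succAbove_ne i k),
      if_neg fun h => hl (Fin.succAbove_right_injective h).symm]
    ring
  · simp

theorem dzbarDer_self_pull (hΩ : IsOpen Ω) (hi : ∀ Z ∈ Ω, Z i ≠ 0)
    (u : (cpForm N).E) : dzbarDer hΩ i (pull hi u)
      = -(invCoordBar hi * ∑ k, pull hi ((cpForm N).zb k) * pull hi ((cpForm N).bD k u)) := by
  rw [dzbarDer_pull_aux, Finset.mul_sum, ← Finset.sum_neg_distrib]
  refine Finset.sum_congr rfl fun k _ => ?_
  rw [dzbarDer_pull_zc, pull_zb, Derivation.leibniz,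
    Derivation.leibniz_of_mul_eq_one _ (invCoordBar_mul hi), dzbarDer_coordBar, dzbarDer_coordBar]
  simp only [smul_eq_mul, if_neg (Fin.succAbove_ne i k).symm, if_true]
  ring

variable (Ω) in
/-- The function `|Z|²`. -/
def normSqFn : SmoothFn Ω := ∑ A, coord Ω A * coordBar Ω A

theorem normSqFn_mul_invCoord (hi : ∀ Z ∈ Ω, Z i ≠ 0) :
    normSqFn Ω * invCoord hi = coordBar Ω i * pull hi (cpForm N).h := by
  have h1 : pull hi (cpForm N).h = 1 + ∑ k, invCoord hi * coord Ω (i.succAbove k)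
      * (invCoordBar hi * coordBar Ω (i.succAbove k)) := by
    have : ((cpForm N).ε : (cpForm N).E) = 1 := Int.cast_one
    simp only [SpaceForm.h, this, map_add, map_mul, map_sum, map_one, pull_zc, pull_zb, one_mul]
  rw [h1, normSqFn, Fin.sum_univ_succAbove _ i, add_mul, mul_add, Finset.sum_mul, Finset.mul_sum]
  congr 1
  · linear_combination (coordBar Ω i) * invCoord_mul hi
  · refine Finset.sum_congr rfl fun k _ => ?_
    linear_combination (-(coord Ω (i.succAbove k) * coordBar Ω (i.succAbove k) * invCoord hi))
      * invCoordBar_mul hi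

/-! #### The operators in homogeneous coordinates -/

/-- The bidifferential operators in homogeneous coordinates. -/
def ambOp (hΩ : IsOpen Ω) (f : SmoothFn Ω) (n : ℕ) : Module.End ℂ (SmoothFn Ω) :=
  tOp 1 (fun A => (dzbarDer hΩ A : SmoothFn Ω →ₗ[ℂ] SmoothFn Ω))
    (fun A => LinearMap.mulLeft ℂ (normSqFn Ω) ∘ₗ (dzDer hΩ A : SmoothFn Ω →ₗ[ℂ] SmoothFn Ω))
    (LinearMap.mulLeft ℂ f) n

theorem ambOp_succ_apply (hΩ : IsOpen Ω) (f : SmoothFn Ω) (n : ℕ) (u : SmoothFn Ω) :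
    ambOp hΩ f (n + 1) u
      = ∑ A, (dzbarDer hΩ A (ambOp hΩ f n (normSqFn Ω * dzDer hΩ A u))
          - ambOp hΩ f n (dzbarDer hΩ A (normSqFn Ω * dzDer hΩ A u)))
        - (n * (n - 1) : ℂ) • ambOp hΩ f n u := by
  rw [ambOp, tOp, ← Int.cast_smul_eq_zsmul ℂ]
  simp only [LinearMap.sub_apply, LinearMap.sum_apply, LinearMap.smul_apply, Module.End.mul_apply]
  push_cast
  rw [one_mul]
  rfl

/-- Functions annihilated by all `∂_A` behave as scalars: they commute with `f` and with `|Z|² ∂_A`,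
and the class is stable under bracketing with `∂_Ā`. -/
theorem ambOp_mul (hΩ : IsOpen Ω) (f : SmoothFn Ω) (n : ℕ) (q u : SmoothFn Ω)
    (hq : ∀ A, dzDer hΩ A q = 0) : ambOp hΩ f n (q * u) = q * ambOp hΩ f n u := by
  have := tOp_commute_of_commute (ε := 1)
    (b := fun A => ((dzbarDer hΩ A : SmoothFn Ω →ₗ[ℂ] SmoothFn Ω) : Module.End ℂ (SmoothFn Ω)))
    (D := fun A => LinearMap.mulLeft ℂ (normSqFn Ω) ∘ₗ (dzDer hΩ A : SmoothFn Ω →ₗ[ℂ] SmoothFn Ω))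
    (f := LinearMap.mulLeft ℂ f)
    (s := {T | ∃ q : SmoothFn Ω, (∀ A, dzDer hΩ A q = 0) ∧ T = LinearMap.mulLeft ℂ q})
    (by
      rintro _ ⟨q, -, rfl⟩
      exact LinearMap.ext fun u => mul_left_comm f q u)
    (by
      rintro A _ ⟨q, hq, rfl⟩
      refine LinearMap.ext fun u => ?_
      change normSqFn Ω * dzDer hΩ A (q * u) = q * (normSqFn Ω * dzDer hΩ A u)
      rw [Derivation.leibniz, hq, smul_zero, add_zero, smul_eq_mul]
      ring)
    (by
      rintro A _ ⟨q, hq, rfl⟩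
      refine ⟨dzbarDer hΩ A q, fun B => ?_, LinearMap.ext fun u => ?_⟩
      · rw [← dzbarDer_dzDer_comm, hq, map_zero]
      · change dzbarDer hΩ A (q * u) - q * dzbarDer hΩ A u = dzbarDer hΩ A q * u
        rw [Derivation.leibniz, smul_eq_mul, smul_eq_mul]
        ring)
    n _ ⟨q, hq, rfl⟩
  exact congrArg (fun T : Module.End ℂ (SmoothFn Ω) => T u) this.eq

theorem tf_mul_zb (c : SpaceForm N) (f : c.E) (n : ℕ) (k : Fin N) (u : c.E) :
    c.tf f n (c.zb k * u) = c.zb k * c.tf f n u := by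
  have := tOp_commute_of_commute (ε := c.ε) (b := c.bOp) (D := c.dOp) (f := c.mulOp f)
    (s := {T | ∃ q : c.E, (∀ j, c.dzD j q = 0) ∧ T = c.mulOp q})
    (by
      rintro _ ⟨q, -, rfl⟩
      exact c.mulOp_comm f q)
    (by
      rintro j _ ⟨q, hq, rfl⟩
      have h0 : c.mulOp 0 = 0 := LinearMap.ext fun u => zero_mul u
      have h := c.dOp_mulOp j q
      simp only [SpaceForm.dD_eq_sum, hq, mul_zero, Finset.sum_const_zero, h0] at h
      exact sub_eq_zero.1 h)
    (by
      rintro j _ ⟨q, hq, rfl⟩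
      exact ⟨c.bD j q, fun l => by rw [← c.bD_dzD, hq, map_zero], c.bOp_mulOp j q⟩)
    n _ ⟨c.zb k, fun j => c.dzD_zb j k, rfl⟩
  exact congrArg (fun T : Module.End ℂ c.E => T u) this.eq

/-- The ambient recursion preserves pull-backs and reproduces the chart recursion. As `|Z|² / Z^i =
Z̄^i h`, the factors `Z̄^i` from `|Z|² ∂_A` and `1/Z̄^i` from `∂_Ā` cancel, and the antiholomorphic
factors pass through `T` by `ambOp_mul`. Since the ambient operator does not mention `i`,
compatibility of charts follows. -/
theorem ambOp_pull (hΩ : IsOpen Ω) (hi : ∀ Z ∈ Ω, Z i ≠ 0) (f : (cpForm N).E) (n : ℕ) :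
    ∀ u, ambOp hΩ (pull hi f) n (pull hi u) = pull hi ((cpForm N).tf f n u) := by
  induction n with
  | zero => exact fun u => (map_mul (pull hi) f u).symm
  | succ n ih =>
    intro u
    set T := ambOp hΩ (pull hi f) n with hT
    set t := (cpForm N).tf f n with ht
    have hcb : ∀ A, dzDer hΩ A (coordBar Ω i) = 0 := fun A => dzDer_coordBar hΩ A i
    have hrb : ∀ A, dzDer hΩ A (invCoordBar hi) = 0 := dzDer_invCoordBar hΩ hi
    have hone := invCoordBar_mul hi
    have hbr : ∀ (A : Fin (N + 1)) (x : SmoothFn Ω),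
        dzbarDer hΩ A (T (coordBar Ω i * x)) - T (dzbarDer hΩ A (coordBar Ω i * x))
          = coordBar Ω i * (dzbarDer hΩ A (T x) - T (dzbarDer hΩ A x)) := by
      intro A x
      rw [hT, ambOp_mul hΩ _ _ _ _ hcb, Derivation.leibniz, Derivation.leibniz, map_add]
      -- The derivative of `Z̄^i` is `0` or `1`, so it passes through `T` and this Leibniz term
      -- cancels in the commutator.
      have hA : T (x • dzbarDer hΩ A (coordBar Ω i)) = T x • dzbarDer hΩ A (coordBar Ω i) := by
        rw [dzbarDer_coordBar]
        split_ifs <;> simp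
      rw [← hT, hA, smul_eq_mul, smul_eq_mul, smul_eq_mul, hT, ambOp_mul hΩ _ _ _ _ hcb]
      ring
    have hk : ∀ (k : Fin N) (v : (cpForm N).E),
        dzbarDer hΩ (i.succAbove k) (T (pull hi v)) - T (dzbarDer hΩ (i.succAbove k) (pull hi v))
          = invCoordBar hi * pull hi ((cpForm N).bD k (t v) - t ((cpForm N).bD k v)) := by
      intro k v
      rw [ih, dzbarDer_succAbove_pull, dzbarDer_succAbove_pull, hT, ambOp_mul hΩ _ _ _ _ hrb,
        ← hT, ih, map_sub, mul_sub]
    have h0 : ∀ v : (cpForm N).E, dzbarDer hΩ i (T (pull hi v)) - T (dzbarDer hΩ i (pull hi v))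
          = -(invCoordBar hi * pull hi (∑ k, (cpForm N).zb k *
            ((cpForm N).bD k (t v) - t ((cpForm N).bD k v)))) := by
      intro v
      have hz : ∀ k (x : (cpForm N).E), T (pull hi ((cpForm N).zb k) * pull hi x)
          = pull hi ((cpForm N).zb k * t x) := by
        intro k x
        rw [hT, ambOp_mul hΩ _ _ _ _ (fun A => dzDer_pull_zb hΩ hi A k), ← hT, ih, map_mul]
      rw [ih, dzbarDer_self_pull, dzbarDer_self_pull, map_neg, hT, ambOp_mul hΩ _ _ _ _ hrb,
        ← hT, map_sum]
      simp only [hz, map_sum, map_mul, mul_sub, map_sub, Finset.sum_sub_distrib]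
      ring
    have hDk : ∀ k, normSqFn Ω * dzDer hΩ (i.succAbove k) (pull hi u)
        = coordBar Ω i * pull hi ((cpForm N).h * (cpForm N).dzD k u) := by
      intro k
      rw [dzDer_succAbove_pull, map_mul, ← mul_assoc, normSqFn_mul_invCoord, mul_assoc]
    have hD0 : normSqFn Ω * dzDer hΩ i (pull hi u)
        = coordBar Ω i * pull hi (-((cpForm N).h * (cpForm N).eul u)) := by
      rw [dzDer_self_pull, map_neg, map_mul, mul_neg, ← mul_assoc, normSqFn_mul_invCoord, mul_assoc,
        mul_neg]
    have hε : ((cpForm N).ε : ℂ) = 1 := Int.cast_one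
    have hε' : ((cpForm N).ε : (cpForm N).E) = 1 := Int.cast_one
    -- `D^k` splits into a `∂_k` part and an Euler part. The former is matched by the ambient index
    -- `i.succAbove k`, the latter, summed over `k`, by the index `i`, whose two minus signs cancel.
    have hdD : ∀ k, (cpForm N).bD k (t ((cpForm N).dD k u)) - t ((cpForm N).bD k ((cpForm N).dD k u))
        = ((cpForm N).bD k (t ((cpForm N).h * (cpForm N).dzD k u))
            - t ((cpForm N).bD k ((cpForm N).h * (cpForm N).dzD k u)))
          + (cpForm N).zb k * ((cpForm N).bD k (t ((cpForm N).h * (cpForm N).eul u))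
            - t ((cpForm N).bD k ((cpForm N).h * (cpForm N).eul u))) := by
      intro k
      have e : (cpForm N).dD k u
          = (cpForm N).h * (cpForm N).dzD k u + (cpForm N).zb k * ((cpForm N).h * (cpForm N).eul u) := by
        rw [(cpForm N).dD_apply, hε']; ring
      have hz : ∀ x, t ((cpForm N).zb k * x) = (cpForm N).zb k * t x := tf_mul_zb _ f n k
      have hb : ∀ x, (cpForm N).bD k ((cpForm N).zb k * x)
          = (cpForm N).zb k * (cpForm N).bD k x + x := by
        intro x
        rw [Derivation.leibniz, (cpForm N).bD_zb, if_pos rfl, smul_eq_mul, smul_eq_mul, mul_one]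
      rw [e, map_add, map_add, map_add, map_add, hz, hb, hb, map_add, hz]
      ring
    rw [ambOp_succ_apply, Fin.sum_univ_succAbove _ i, SpaceForm.tf_succ_apply, ← hT, ← ht]
    simp only [hDk, hD0, hbr, hk, h0, hdD, hε, one_mul]
    have hcancel : ∀ x : SmoothFn Ω, coordBar Ω i * (invCoordBar hi * x) = x := by
      intro x
      linear_combination x * hone
    simp only [mul_neg, hcancel, ih]
    rw [map_sub, map_smul, Finset.sum_add_distrib, map_add, map_sum (pull hi)]
    congr 1
    rw [map_sum (pull hi), map_sum (pull hi), ← Finset.sum_neg_distrib, ← Finset.sum_add_distrib,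
      ← Finset.sum_add_distrib]
    refine Finset.sum_congr rfl fun k _ => ?_
    simp only [map_neg, map_mul, map_sub]
    ring

theorem pull_lOp (hΩ : IsOpen Ω) (hi : ∀ Z ∈ Ω, Z i ≠ 0) (f g : (cpForm N).E) (n : ℕ) :
    pull hi ((cpForm N).lOp f n g)
      = ∑ m ∈ Finset.range (n + 1), coef 1 m n • ambOp hΩ (pull hi f) m (pull hi g) := by
  rw [SpaceForm.lOp_apply, map_sum]
  refine Finset.sum_congr rfl fun m _ => ?_
  rw [map_smul, ambOp_pull]
  rfl

end Pull

/-! ### Existence and uniqueness of the star product on `ℂP^N` -/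

theorem param_proj {N : ℕ} (i : Fin (N + 1)) (Z : V (N + 1)) (hZ : Z i ≠ 0) (hZ0 : Z ≠ 0) :
    (CP N).param i ⟨proj i Z, trivial⟩ = Projectivization.mk ℂ Z hZ0 := by
  refine (Projectivization.mk_eq_mk_iff' ℂ _ _ _ _).2 ⟨(Z i)⁻¹, ?_⟩
  ext j
  refine Fin.succAboveCases i ?_ (fun j => ?_) j
  · simp [hZ]
  · simp [proj, div_eq_inv_mul]

/-- The function `F` on `ℂP^N` in homogeneous coordinates. -/
theorem pull_chartFn {N : ℕ} {Ω : Set (V (N + 1))} {i : Fin (N + 1)} (hi : ∀ Z ∈ Ω, Z i ≠ 0)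
    (F : (CP N).Smooth) (Z : Ω) (hZ0 : Z.1 ≠ 0) :
    (pull hi (KahlerAtlas.chartFn (isForm_CP N) F i)).1 Z = F.1 (Projectivization.mk ℂ Z.1 hZ0) := by
  rw [pull_apply, ← param_proj i Z.1 (hi Z Z.2) hZ0]
  exact KahlerAtlas.chartFn_apply (isForm_CP N) F i ⟨proj i Z.1, trivial⟩ trivial

theorem existsUnique_star_CP (N : ℕ) : ∃! star, (CP N).IsKarabegovStar star := by
  refine KahlerAtlas.existsUnique_star (isForm_CP N) fun F G n =>
    KahlerAtlas.exists_chartFn_eq (isForm_CP N) _ ?_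
  intro (i : Fin (N + 1)) (j : Fin (N + 1)) z z' hz hz' h
  let Ω : Set (V (N + 1)) := {Z | Z i ≠ 0 ∧ Z j ≠ 0}
  have hΩ : IsOpen Ω := by
    refine IsOpen.inter (isOpen_ne_fun (continuous_apply i) continuous_const)
      (isOpen_ne_fun (continuous_apply j) continuous_const)
  have hi : ∀ Z ∈ Ω, Z i ≠ 0 := fun Z hZ => hZ.1
  have hj : ∀ Z ∈ Ω, Z j ≠ 0 := fun Z hZ => hZ.2
  have hpull : ∀ F : (CP N).Smooth, pull hi (KahlerAtlas.chartFn (isForm_CP N) F i)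
      = pull hj (KahlerAtlas.chartFn (isForm_CP N) F j) := by
    intro F
    refine smoothFn_ext fun Z => ?_
    have hZ0 : Z.1 ≠ 0 := fun h => hi Z Z.2 (congrFun h i)
    rw [pull_chartFn hi F Z hZ0, pull_chartFn hj F Z hZ0]
  have key := pull_lOp hΩ hi (KahlerAtlas.chartFn (isForm_CP N) F i)
    (KahlerAtlas.chartFn (isForm_CP N) G i) n
  rw [hpull F, hpull G, ← pull_lOp hΩ hj] at key
  obtain ⟨a, ha⟩ := (Projectivization.mk_eq_mk_iff' ℂ _ _ _ _).1 h
  have hai : a * (j.insertNth (1 : ℂ) z'.1 : V (N + 1)) i = 1 := by simpa using congrFun ha i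
  have ha0 : a ≠ 0 := left_ne_zero_of_mul_eq_one hai
  have haj : (i.insertNth (1 : ℂ) z.1 : V (N + 1)) j = a := by simpa using (congrFun ha j).symm
  -- The representative normalized at `i`; its `j`-th coordinate is the transition factor `a`, so it
  -- lies in `Ω` and projects to `z` and to `z'`.
  let Z : Ω := ⟨i.insertNth (1 : ℂ) z.1, by simp, by rw [haj]; exact ha0⟩
  have e := congrArg (fun u : SmoothFn Ω => u.1 Z) key
  simp only [pull_apply] at e
  have p1 : proj i Z.1 = z.1 := by
    funext k
    simp [proj, Z]
  have p2 : proj j Z.1 = z'.1 := by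
    funext k
    have : (i.insertNth (1 : ℂ) z.1 : V (N + 1)) (j.succAbove k) = a * z'.1 k := by
      simpa using (congrFun ha (j.succAbove k)).symm
    change (i.insertNth (1 : ℂ) z.1 : V (N + 1)) (j.succAbove k)
      / (i.insertNth (1 : ℂ) z.1 : V (N + 1)) j = _
    rw [this, haj, mul_div_cancel_left₀ _ ha0]
  simp only [p1, p2] at e
  exact e

/-! ### The volume of `ℂP^N` as an image of a Gaussian measure -/

/-- The measure `e^{-|Z|²} dZ` in homogeneous coordinates. -/
def gaussMeasure (N : ℕ) : Measure (V N) :=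
  volume.withDensity fun Z => ENNReal.ofReal (Real.exp (-∑ A, ‖Z A‖ ^ 2))

/-- The volume measure of `ℂP^N` in an inhomogeneous chart, up to a constant. -/
def fsMeasure (N : ℕ) : Measure (V N) :=
  volume.withDensity fun z => ENNReal.ofReal (((cpForm N).rho z)⁻¹ ^ (N + 1))

theorem cpForm_rho {N : ℕ} (z : V N) : (cpForm N).rho z = 1 + ∑ k, ‖z k‖ ^ 2 := by
  change 1 + ((1 : ℤ) : ℝ) * ∑ k, ‖z k‖ ^ 2 = _
  rw [Int.cast_one, one_mul]

theorem cpForm_rho_pos {N : ℕ} (z : V N) : 0 < (cpForm N).rho z := (cpForm N).rho_pos trivial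

theorem continuous_cpForm_rho (N : ℕ) : Continuous (cpForm N).rho :=
  (cpForm N).contDiff_rho.continuous

theorem measurable_fsDensity {N : ℕ} : Measurable fun z : V N =>
    ENNReal.ofReal (((cpForm N).rho z)⁻¹ ^ (N + 1)) :=
  (((continuous_cpForm_rho N).measurable.inv).pow_const _).ennreal_ofReal

theorem lintegral_comp_smul {N : ℕ} (a : ℂ) (ha : a ≠ 0) {f : V N → ENNReal} (hf : Measurable f) :
    ∫⁻ v, f v = ENNReal.ofReal (‖a‖ ^ (2 * N)) * ∫⁻ z, f (a • z) := by
  let L : V N →ₗ[ℝ] V N := (a • LinearMap.id : V N →ₗ[ℂ] V N).restrictScalars ℝ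
  have hdet : LinearMap.det L = ‖a‖ ^ (2 * N) := by
    rw [LinearMap.det_restrictScalars, LinearMap.det_smul, LinearMap.det_id, mul_one,
      Module.finrank_fin_fun, Algebra.norm_complex_apply, map_pow, Complex.normSq_eq_norm_sq,
      ← pow_mul]
  have hpos : 0 < ‖a‖ ^ (2 * N) := pow_pos (norm_pos_iff.2 ha) _
  have hmap := Measure.map_linearMap_addHaar_eq_smul_addHaar (volume : Measure (V N))
    (f := L) (hdet ▸ hpos.ne')
  have hL : Measurable L := L.continuous_of_finiteDimensional.measurable
  have : ∫⁻ z, f (a • z) = ENNReal.ofReal ((‖a‖ ^ (2 * N))⁻¹) * ∫⁻ v, f v := by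
    rw [hdet, abs_of_pos (inv_pos.2 hpos)] at hmap
    rw [← smul_eq_mul, ← lintegral_smul_measure, ← hmap, lintegral_map hf hL]
    rfl
  rw [this, ← mul_assoc, ← ENNReal.ofReal_mul hpos.le, mul_inv_cancel₀ hpos.ne', ENNReal.ofReal_one,
    one_mul]

theorem lintegral_norm_pow_mul_exp (N : ℕ) {b : ℝ} (hb : 0 < b) :
    ∫⁻ ζ : ℂ, ENNReal.ofReal (‖ζ‖ ^ (2 * N) * Real.exp (-(b * ‖ζ‖ ^ 2)))
      = ENNReal.ofReal (Real.pi * N.factorial) * ENNReal.ofReal (b⁻¹ ^ (N + 1)) := by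
  have h := Complex.integral_rpow_mul_exp_neg_mul_rpow (p := 2) (q := (2 * N : ℕ)) (b := b)
    one_le_two (by have : (0 : ℝ) ≤ (2 * N : ℕ) := Nat.cast_nonneg _; linarith) hb
  have e1 : (((2 * N : ℕ) : ℝ) + 2) / 2 = N + 1 := by push_cast; ring
  have e2 : -(((2 * N : ℕ) : ℝ) + 2) / 2 = -((N + 1 : ℕ) : ℝ) := by push_cast; ring
  rw [e1, e2, Real.Gamma_nat_eq_factorial, Real.rpow_neg hb.le, Real.rpow_natCast] at h
  simp only [Real.rpow_natCast, Real.rpow_two, neg_mul] at h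
  have hval : (2 * Real.pi / 2 * (b ^ (N + 1))⁻¹ * N.factorial : ℝ)
      = Real.pi * N.factorial * b⁻¹ ^ (N + 1) := by rw [inv_pow]; ring
  rw [hval] at h
  have hpos : 0 < Real.pi * N.factorial * b⁻¹ ^ (N + 1) := by positivity
  -- The integral of a non-integrable function is `0` by convention, so the nonzero value forces
  -- integrability.
  have hint : Integrable fun ζ : ℂ => ‖ζ‖ ^ (2 * N) * Real.exp (-(b * ‖ζ‖ ^ 2)) := by
    by_contra hc
    rw [integral_undef hc] at h
    exact hpos.ne h
  rw [← ofReal_integral_eq_lintegral_ofReal hint (Filter.Eventually.of_forall fun ζ => by positivity),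
    h, ENNReal.ofReal_mul (by positivity)]

theorem measurable_proj {N : ℕ} (i : Fin (N + 1)) : Measurable (proj i) :=
  measurable_pi_lambda _ fun _ => (measurable_pi_apply _).div (measurable_pi_apply _)

/-- In the coordinates `Z = ζ (1, z)` with `ζ = Z^i`, the Jacobian is `|ζ|^{2N}` and `|Z|² = |ζ|²
h(z)`. Integrating out `ζ` leaves `π N! h^{-(N+1)}`, with a constant that does not depend on `i`. -/
theorem map_proj_gaussMeasure {N : ℕ} (i : Fin (N + 1)) : (gaussMeasure (N + 1)).map (proj i)
    = ENNReal.ofReal (Real.pi * N.factorial) • fsMeasure N := by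
  refine Measure.ext_of_lintegral _ fun f hf => ?_
  have hfp : Measurable fun Z => f (proj i Z) := hf.comp (measurable_proj i)
  have hG : Measurable fun Z : V (N + 1) => ENNReal.ofReal (Real.exp (-∑ A, ‖Z A‖ ^ 2)) := by
    fun_prop
  have hR := measurable_fsDensity (N := N)
  rw [lintegral_map hf (measurable_proj i), gaussMeasure,
    lintegral_withDensity_eq_lintegral_mul _ hG hfp,
    lintegral_smul_measure, fsMeasure, lintegral_withDensity_eq_lintegral_mul _ hR hf]
  have hpres := (volume_preserving_piFinSuccAbove (fun _ : Fin (N + 1) => ℂ) i).symm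
  rw [← hpres.lintegral_comp (hG.mul hfp), Measure.volume_eq_prod]
  refine (lintegral_prod _ ((hG.mul hfp).comp hpres.measurable).aemeasurable).trans ?_
  have hG2 : ∀ (ζ : ℂ) (v : V N), (MeasurableEquiv.piFinSuccAbove (fun _ : Fin (N + 1) => ℂ) i).symm
      (ζ, v) = i.insertNth ζ v := fun ζ v => rfl
  have hstep : ∀ᵐ ζ : ℂ, ∫⁻ v : V N,
      ((fun Z : V (N + 1) => ENNReal.ofReal (Real.exp (-∑ A, ‖Z A‖ ^ 2))) * fun Z => f (proj i Z))
        ((MeasurableEquiv.piFinSuccAbove (fun _ : Fin (N + 1) => ℂ) i).symm (ζ, v))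
      = ∫⁻ z : V N, ENNReal.ofReal
          (‖ζ‖ ^ (2 * N) * Real.exp (-((cpForm N).rho z * ‖ζ‖ ^ 2))) * f z := by
    filter_upwards [Measure.ae_ne volume (0 : ℂ)] with ζ hζ
    rw [lintegral_comp_smul ζ hζ, ← lintegral_const_mul]
    · refine lintegral_congr fun z => ?_
      have hp : proj i (i.insertNth ζ (ζ • z) : V (N + 1)) = z := by
        funext k
        simp [proj, hζ]
      have hs : ∑ A, ‖(i.insertNth ζ (ζ • z) : V (N + 1)) A‖ ^ 2 = (cpForm N).rho z * ‖ζ‖ ^ 2 := by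
        rw [Fin.sum_univ_succAbove _ i, cpForm_rho, add_mul, Finset.sum_mul]
        simp [mul_pow, mul_comm]
      rw [hG2, Pi.mul_apply, hp, hs, ← mul_assoc, ← ENNReal.ofReal_mul (by positivity)]
    · have := (hG.mul hfp).comp
        (hpres.measurable.comp (measurable_prodMk_left (x := ζ)))
      exact this.comp (measurable_const_smul ζ)
    · exact (hG.mul hfp).comp
        (hpres.measurable.comp (measurable_prodMk_left (x := ζ)))
  have hJ : Measurable fun p : ℂ × V N => ENNReal.ofReal
      (‖p.1‖ ^ (2 * N) * Real.exp (-((cpForm N).rho p.2 * ‖p.1‖ ^ 2))) := by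
    have := (continuous_cpForm_rho N).measurable
    fun_prop
  refine (lintegral_congr_ae hstep).trans ?_
  rw [lintegral_lintegral_swap
    (hJ.mul (hf.comp measurable_snd)).aemeasurable, smul_eq_mul, ← lintegral_const_mul]
  · refine lintegral_congr fun z => ?_
    refine (lintegral_mul_const _ (hJ.comp (measurable_prodMk_right (y := z)))).trans ?_
    simp only [Function.comp_apply]
    rw [lintegral_norm_pow_mul_exp N (cpForm_rho_pos z), Pi.mul_apply, mul_assoc]
  · exact hR.mul hf

instance isFiniteMeasure_fsMeasure (N : ℕ) : IsFiniteMeasure (fsMeasure N) := by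
  refine isFiniteMeasure_withDensity_ofReal (Integrable.hasFiniteIntegral ?_)
  -- The density is at most `(1 + ‖z‖²)^{-(N+1)}` in the sup norm, which is integrable because
  -- `2(N+1)` exceeds the real dimension `2N`.
  have hfin : (Module.finrank ℝ (V N) : ℝ) < 2 * N + 2 := by
    rw [Module.finrank_pi_fintype]
    simp [Complex.finrank_real_complex]
    linarith
  refine (integrable_rpow_neg_one_add_norm_sq (μ := volume) hfin).mono'
    ((((continuous_cpForm_rho N).measurable.inv).pow_const _).aestronglyMeasurable)
    (Filter.Eventually.of_forall fun z => ?_)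
  have hle : 1 + ‖z‖ ^ 2 ≤ (cpForm N).rho z := by
    rw [cpForm_rho]
    have hs : 0 ≤ ∑ k, ‖z k‖ ^ 2 := Finset.sum_nonneg fun k _ => by positivity
    have : ‖z‖ ≤ √(∑ k, ‖z k‖ ^ 2) := by
      refine (pi_norm_le_iff_of_nonneg (Real.sqrt_nonneg _)).2 fun k => ?_
      refine Real.le_sqrt_of_sq_le ?_
      exact Finset.single_le_sum (f := fun k => ‖z k‖ ^ 2) (fun k _ => by positivity)
        (Finset.mem_univ k)
    have := (Real.le_sqrt (norm_nonneg z) hs).1 this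
    linarith
  have e : -(2 * (N : ℝ) + 2) / 2 = -((N + 1 : ℕ) : ℝ) := by push_cast; ring
  have hpos := cpForm_rho_pos z
  rw [e, Real.rpow_neg (by positivity), Real.rpow_natCast, ← inv_pow, Real.norm_of_nonneg
    (by positivity)]
  gcongr

/-! ### Integration of functions on `ℂP^N` -/

section Integration

variable {N : ℕ}

theorem extend_chartFn_proj (F : (CP N).Smooth) (a : Fin (N + 1)) {Z : V (N + 1)} (ha : Z a ≠ 0)
    (hZ0 : Z ≠ 0) : extend (KahlerAtlas.chartFn (isForm_CP N) F a).1 (proj a Z)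
      = F.1 (Projectivization.mk ℂ Z hZ0) := by
  rw [extend_univ, ← param_proj a Z ha hZ0]
  exact KahlerAtlas.chartFn_apply (isForm_CP N) F a ⟨proj a Z, trivial⟩ trivial

theorem proj_insertNth (i : Fin (N + 1)) (z : V N) : proj i (i.insertNth (1 : ℂ) z) = z := by
  funext k
  simp [proj]

theorem exists_forall_norm_le {Z : V (N + 1)} (hZ : Z ≠ 0) :
    ∃ a, Z a ≠ 0 ∧ ∀ b, ‖Z b‖ ≤ ‖Z a‖ := by
  obtain ⟨a, ha⟩ := Finite.exists_max fun b => ‖Z b‖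
  refine ⟨a, fun h => hZ (funext fun b => ?_), ha⟩
  simpa [h] using ha b

/-- Compactness of `ℂP^N` by hand: dividing by a coordinate of largest modulus puts every point into
the closed unit polydisc of some chart, and there are finitely many charts. -/
theorem exists_norm_chartFn_le (F : (CP N).Smooth) :
    ∃ C : ℝ, ∀ (i : Fin (N + 1)) (z : V N),
      ‖extend (KahlerAtlas.chartFn (isForm_CP N) F i).1 z‖ ≤ C := by
  have h : ∀ a : Fin (N + 1), ∃ C : ℝ, ∀ z ∈ Metric.closedBall (0 : V N) 1,
      ‖extend (KahlerAtlas.chartFn (isForm_CP N) F a).1 z‖ ≤ C := fun a =>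
    (isCompact_closedBall (0 : V N) 1).exists_bound_of_continuousOn
      (contDiff_extend_univ _).continuous.continuousOn
  choose C hC using h
  obtain ⟨m, hm⟩ := Finite.exists_max C
  refine ⟨C m, fun i z => ?_⟩
  have hZ0 := insertNth_one_ne_zero i z
  obtain ⟨a, ha, hle⟩ := exists_forall_norm_le hZ0
  have e := extend_chartFn_proj F i (Z := i.insertNth (1 : ℂ) z) (by simp) hZ0
  rw [proj_insertNth] at e
  rw [e, ← extend_chartFn_proj F a ha hZ0]
  refine (hC a _ ?_).trans (hm a)
  rw [mem_closedBall_zero_iff, pi_norm_le_iff_of_nonneg zero_le_one]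
  intro k
  rw [proj, norm_div]
  exact div_le_one_of_le₀ (hle _) (norm_nonneg _)

theorem integrable_chartFn (F : (CP N).Smooth) (i : Fin (N + 1)) :
    Integrable (extend (KahlerAtlas.chartFn (isForm_CP N) F i).1) (fsMeasure N) := by
  obtain ⟨C, hC⟩ := exists_norm_chartFn_le F
  exact Integrable.of_bound (contDiff_extend_univ _).continuous.aestronglyMeasurable C
    (Filter.Eventually.of_forall (hC i))

theorem extend_mul_hInv_pow (u : (cpForm N).E) (z : V N) :
    extend (u * (cpForm N).hInv ^ (N + 1)).1 z
      = (ENNReal.ofReal (((cpForm N).rho z)⁻¹ ^ (N + 1))).toReal • extend u.1 z := by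
  have := cpForm_rho_pos z
  rw [ENNReal.toReal_ofReal (by positivity), extend_univ, extend_univ, mul_val, pow_val,
    SpaceForm.hInv_apply, Complex.real_smul, mul_comm]
  push_cast
  rfl

theorem cpForm_volInt (u : (cpForm N).E) :
    (cpForm N).volInt u = ∫ z, extend u.1 z ∂fsMeasure N := by
  rw [SpaceForm.volInt_eq_integral, fsMeasure, integral_withDensity_eq_integral_toReal_smul
    measurable_fsDensity (Filter.Eventually.of_forall fun z => ENNReal.ofReal_lt_top)]
  exact integral_congr_ae (Filter.Eventually.of_forall (extend_mul_hInv_pow u))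

theorem volIntegrable_CP (F : (CP N).Smooth) (i : (CP N).ι) : (CP N).VolIntegrable i F := by
  rw [KahlerAtlas.volIntegrable_iff (isForm_CP N)]
  refine Integrable.integrableOn ?_
  have h := integrable_chartFn F i
  rw [fsMeasure, integrable_withDensity_iff_integrable_smul' measurable_fsDensity
    (Filter.Eventually.of_forall fun z => ENNReal.ofReal_lt_top)] at h
  exact h.congr (Filter.Eventually.of_forall fun z => (extend_mul_hInv_pow _ z).symm)

theorem volInt_chartFn (F : (CP N).Smooth) (i : Fin (N + 1)) :
    (Real.pi * N.factorial) • (cpForm N).volInt (KahlerAtlas.chartFn (isForm_CP N) F i)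
      = ∫ Z, extend (KahlerAtlas.chartFn (isForm_CP N) F i).1 (proj i Z) ∂gaussMeasure (N + 1) := by
  have h := integral_map (μ := gaussMeasure (N + 1)) (measurable_proj i).aemeasurable
    (f := extend (KahlerAtlas.chartFn (isForm_CP N) F i).1)
    (contDiff_extend_univ _).continuous.aestronglyMeasurable
  rw [← h, map_proj_gaussMeasure, integral_smul_measure, cpForm_volInt,
    ENNReal.toReal_ofReal (by positivity)]

/-- Both integrals are Gaussian integrals of the same function of homogeneous coordinates, defined
off the null set where `Z^i` or `Z^j` vanishes. -/
theorem volInt_chartFn_eq (F : (CP N).Smooth) (i j : Fin (N + 1)) :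
    (cpForm N).volInt (KahlerAtlas.chartFn (isForm_CP N) F i)
      = (cpForm N).volInt (KahlerAtlas.chartFn (isForm_CP N) F j) := by
  have hpos : Real.pi * N.factorial ≠ 0 := by positivity
  refine smul_right_injective ℂ hpos ?_
  simp only [volInt_chartFn]
  refine integral_congr_ae ((withDensity_absolutelyContinuous _ _).ae_le ?_)
  have hne : ∀ a : Fin (N + 1), ∀ᵐ Z : V (N + 1), Z a ≠ 0 := fun a =>
    Measure.ae_eval_ne (fun _ : Fin (N + 1) => (volume : Measure ℂ)) a 0
  filter_upwards [hne i, hne j] with Z hi hj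
  have hZ0 : Z ≠ 0 := fun h => hi (congrFun h i)
  rw [extend_chartFn_proj F i hi hZ0, extend_chartFn_proj F j hj hZ0]

end Integration

/-! ### A partition of unity -/

section Partition

variable {N : ℕ}

/-- The share of the coordinate `a` in the square norm. -/
def share (a : Fin (N + 1)) (Z : V (N + 1)) : ℝ := ‖Z a‖ ^ 2 / ∑ b, ‖Z b‖ ^ 2

/-- The bump functions before normalization. -/
def bump (a : Fin (N + 1)) (Z : V (N + 1)) : ℝ :=
  expNegInvGlue (share a Z - (2 * (N + 1) : ℝ)⁻¹)

/-- The partition of unity in homogeneous coordinates. -/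
def cutoff (a : Fin (N + 1)) (Z : V (N + 1)) : ℝ := bump a Z / ∑ b, bump b Z

theorem sum_norm_sq_pos {Z : V (N + 1)} (hZ : Z ≠ 0) : 0 < ∑ b, ‖Z b‖ ^ 2 := by
  obtain ⟨a, ha⟩ := Function.ne_iff.1 hZ
  exact Finset.sum_pos' (fun b _ => by positivity)
    ⟨a, Finset.mem_univ a, pow_pos (norm_pos_iff.2 ha) 2⟩

/-- The largest share is at least `1/(N+1)`, which exceeds the threshold `1/(2(N+1))` in `bump`. -/
theorem sum_bump_pos {Z : V (N + 1)} (hZ : Z ≠ 0) : 0 < ∑ b, bump b Z := by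
  have hs := sum_norm_sq_pos hZ
  obtain ⟨a, -, hle⟩ := exists_forall_norm_le hZ
  refine Finset.sum_pos' (fun b _ => expNegInvGlue.nonneg _) ⟨a, Finset.mem_univ a, ?_⟩
  refine expNegInvGlue.pos_of_pos (sub_pos.2 ?_)
  have h1 : ∑ b, ‖Z b‖ ^ 2 ≤ (N + 1) * ‖Z a‖ ^ 2 := by
    refine (Finset.sum_le_card_nsmul Finset.univ _ (‖Z a‖ ^ 2) fun b _ => ?_).trans_eq (by simp)
    exact pow_le_pow_left₀ (norm_nonneg _) (hle b) 2
  rw [share, lt_div_iff₀ hs, inv_mul_lt_iff₀ (by positivity)]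
  linarith

theorem sum_cutoff {Z : V (N + 1)} (hZ : Z ≠ 0) : ∑ a, cutoff a Z = 1 := by
  simp only [cutoff, ← Finset.sum_div]
  exact div_self (sum_bump_pos hZ).ne'

theorem cutoff_smul (a : Fin (N + 1)) {r : ℂ} (hr : r ≠ 0) (Z : V (N + 1)) :
    cutoff a (r • Z) = cutoff a Z := by
  have h : ∀ b, share b (r • Z) = share b Z := by
    intro b
    have : ‖r‖ ^ 2 ≠ 0 := pow_ne_zero 2 (norm_ne_zero_iff.2 hr)
    simp only [share, Pi.smul_apply, smul_eq_mul, norm_mul, mul_pow, ← Finset.mul_sum]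
    exact mul_div_mul_left _ _ this
  simp only [cutoff, bump, h]

theorem contDiff_cutoff_insertNth (a i : Fin (N + 1)) :
    ContDiff ℝ ∞ fun z : V N => (cutoff a (i.insertNth (1 : ℂ) z) : ℂ) := by
  have hZ : ∀ b, ContDiff ℝ ∞ fun z : V N => (i.insertNth (1 : ℂ) z : V (N + 1)) b := by
    intro b
    refine Fin.succAboveCases i ?_ (fun k => ?_) b
    · simpa using contDiff_const
    · simpa using contDiff_apply ℝ ℂ k
  have hn : ∀ b, ContDiff ℝ ∞ fun z : V N => ‖(i.insertNth (1 : ℂ) z : V (N + 1)) b‖ ^ 2 :=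
    fun b => (hZ b).norm_sq ℝ
  have hs : ∀ b, ContDiff ℝ ∞ fun z : V N => share b (i.insertNth (1 : ℂ) z) := fun b =>
    (hn b).div (ContDiff.sum fun b _ => hn b)
      fun z => (sum_norm_sq_pos (insertNth_one_ne_zero i z)).ne'
  have hb : ∀ b, ContDiff ℝ ∞ fun z : V N => bump b (i.insertNth (1 : ℂ) z) := fun b =>
    expNegInvGlue.contDiff.comp ((hs b).sub contDiff_const)
  exact Complex.ofRealCLM.contDiff.comp ((hb a).div (ContDiff.sum fun b _ => hb b)
    fun z => (sum_bump_pos (insertNth_one_ne_zero i z)).ne')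

theorem norm_le_of_cutoff_ne_zero (a : Fin (N + 1)) (z : V N)
    (h : cutoff a (a.insertNth (1 : ℂ) z) ≠ 0) : ‖z‖ ≤ 2 * (N + 1) := by
  by_contra! hlt
  obtain ⟨k, hk⟩ : ∃ k, (2 * (N + 1) : ℝ) < ‖z k‖ := by
    by_contra! hle
    exact hlt.not_ge ((pi_norm_le_iff_of_nonneg (by positivity)).2 hle)
  refine h ?_
  have hN : (0 : ℝ) ≤ N := Nat.cast_nonneg N
  have hsum : ‖z k‖ ^ 2 ≤ ∑ b, ‖z b‖ ^ 2 :=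
    Finset.single_le_sum (f := fun b => ‖z b‖ ^ 2) (fun b _ => by positivity) (Finset.mem_univ k)
  have : bump a (a.insertNth (1 : ℂ) z) = 0 := by
    refine expNegInvGlue.zero_of_nonpos (sub_nonpos.2 ?_)
    rw [share, Fin.sum_univ_succAbove _ a]
    simp only [Fin.insertNth_apply_same, Fin.insertNth_apply_succAbove, norm_one, one_pow, one_div]
    -- The share of coordinate `a` is `1/(1 + |z|²)`, and `|z|² ≥ (2(N+1))² ≥ 2(N+1)` puts it below
    -- the threshold.
    refine inv_anti₀ (by positivity) ?_
    nlinarith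
  rw [cutoff, this, zero_div]

/-- Multiplication of a smooth function with the partition of unity. -/
theorem exists_partition (F : (CP N).Smooth) : ∃ P : Fin (N + 1) → (CP N).Smooth,
    (∀ i, KahlerAtlas.chartFn (isForm_CP N) F i
      = ∑ a, KahlerAtlas.chartFn (isForm_CP N) (P a) i) ∧
    ∀ a : Fin (N + 1), KahlerAtlas.chartFn (isForm_CP N) (P a) a ∈ csIdeal (cpForm N).U := by
  let χ : Fin (N + 1) → Fin (N + 1) → (cpForm N).E := fun a i =>
    mkSmooth _ (contDiff_cutoff_insertNth a i).contDiffOn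
  have hχ : ∀ a i (z : (cpForm N).U), (χ a i).1 z = (cutoff a (i.insertNth (1 : ℂ) z.1) : ℂ) :=
    fun a i z => rfl
  have hex : ∀ a, ∃ P : (CP N).Smooth, ∀ i : Fin (N + 1),
      KahlerAtlas.chartFn (isForm_CP N) P i = χ a i * KahlerAtlas.chartFn (isForm_CP N) F i := by
    intro a
    refine KahlerAtlas.exists_chartFn_eq (isForm_CP N)
      (fun i : Fin (N + 1) => χ a i * KahlerAtlas.chartFn (isForm_CP N) F i) ?_
    intro (i : Fin (N + 1)) (j : Fin (N + 1)) z z' hz hz' h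
    have hF : (KahlerAtlas.chartFn (isForm_CP N) F i).1 ⟨z, hz⟩
        = (KahlerAtlas.chartFn (isForm_CP N) F j).1 ⟨z', hz'⟩ := by
      refine (KahlerAtlas.chartFn_apply (isForm_CP N) F i z hz).trans ?_
      exact (congrArg F.1 h).trans (KahlerAtlas.chartFn_apply (isForm_CP N) F j z' hz').symm
    obtain ⟨r, hr⟩ := (Projectivization.mk_eq_mk_iff' ℂ _ _ _ _).1 h
    have hr0 : r ≠ 0 := by
      rintro rfl
      exact insertNth_one_ne_zero i z.1 (by rw [← hr, zero_smul])
    rw [mul_val, mul_val, hF, hχ, hχ]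
    simp only
    rw [← hr, cutoff_smul a hr0]
  choose P hP using hex
  refine ⟨P, fun (i : Fin (N + 1)) => ?_, fun a => ?_⟩
  · suffices h : ∑ a, χ a i = 1 by
      refine Eq.trans ?_ (Finset.sum_congr rfl fun a _ => (hP a i).symm)
      rw [← Finset.sum_mul, h, one_mul]
    refine smoothFn_ext fun z => ?_
    rw [sum_val]
    refine (Finset.sum_congr rfl fun a _ => hχ a i z).trans ?_
    rw [← Complex.ofReal_sum, sum_cutoff (insertNth_one_ne_zero i z.1)]
    rfl
  · rw [hP]
    refine Ideal.mul_mem_right _ _ ⟨Metric.closedBall 0 (2 * (N + 1)), Set.subset_univ _,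
      isCompact_closedBall _ _, fun z hz => ?_⟩
    rw [hχ, Complex.ofReal_eq_zero]
    by_contra h
    exact hz (mem_closedBall_zero_iff.2 (norm_le_of_cutoff_ne_zero a z.1 h))

end Partition

/-! ### The trace property on `ℂP^N` -/

theorem volInt_sum_chartFn {N : ℕ} (K : Fin (N + 1) → (CP N).Smooth) (i : Fin (N + 1)) :
    (cpForm N).volInt (∑ a, KahlerAtlas.chartFn (isForm_CP N) (K a) i)
      = ∑ a, (cpForm N).volInt (KahlerAtlas.chartFn (isForm_CP N) (K a) i) := by
  simp only [cpForm_volInt]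
  rw [← integral_finsetSum _ fun a _ => integrable_chartFn (K a) i]
  refine integral_congr_ae (Filter.Eventually.of_forall fun z => ?_)
  simp only [extend_univ, sum_val]

theorem trace_CP (N : ℕ) (star : (CP N).Smooth → (CP N).Smooth → ℕ → (CP N).Smooth)
    (hstar : (CP N).IsKarabegovStar star) (F G : (CP N).Smooth) (i : (CP N).ι) (n : ℕ) :
    (CP N).VolIntegrable i (star F G n) ∧ (CP N).VolIntegrable i (star G F n) ∧
      (CP N).volIntegral i (star F G n) = (CP N).volIntegral i (star G F n) := by
  have H := isForm_CP N
  have h := (KahlerAtlas.isKarabegovStar_iff H star).1 hstar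
  refine ⟨volIntegrable_CP _ i, volIntegrable_CP _ i, ?_⟩
  rw [KahlerAtlas.volIntegral_eq H, KahlerAtlas.volIntegral_eq H]
  congr 1
  obtain ⟨P, hsum, hP⟩ := exists_partition F
  have h1 : KahlerAtlas.chartFn H (star F G n) i
      = ∑ a, KahlerAtlas.chartFn H (star (P a) G n) i := by
    simp only [h]
    rw [hsum, SpaceForm.lOp_sum_left, LinearMap.sum_apply]
  have h2 : KahlerAtlas.chartFn H (star G F n) i
      = ∑ a, KahlerAtlas.chartFn H (star G (P a) n) i := by
    simp only [h]
    rw [hsum, map_sum]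
  rw [h1, h2]
  refine (volInt_sum_chartFn _ i).trans (Eq.trans ?_ (volInt_sum_chartFn _ i).symm)
  refine Finset.sum_congr rfl fun a _ => ?_
  -- Each piece `P a` is integrated in its own chart `a`, the one in which it has compact support.
  refine (volInt_chartFn_eq _ i a).trans (Eq.trans ?_ (volInt_chartFn_eq _ i a).symm)
  have e1 := h (P a) G n a
  have e2 := h G (P a) n a
  refine (congrArg (cpForm N).volInt e1).trans (Eq.trans ?_ (congrArg (cpForm N).volInt e2).symm)
  exact (SpaceForm.volInt_lOp_symm _ (hP a) n).symm

end KarabegovTrace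

end

theorem mainTheorem1 (N : ℕ) :
    -- complex projective space; it is compact, so every smooth function has compact support
    ((∃! star, (KarabegovTrace.CP N).IsKarabegovStar star) ∧
      ∀ star, (KarabegovTrace.CP N).IsKarabegovStar star →
        ∀ (F G : (KarabegovTrace.CP N).Smooth) (i : (KarabegovTrace.CP N).ι) (n : ℕ),
          (KarabegovTrace.CP N).VolIntegrable i (star F G n) ∧
          (KarabegovTrace.CP N).VolIntegrable i (star G F n) ∧
          (KarabegovTrace.CP N).volIntegral i (star F G n) =
            (KarabegovTrace.CP N).volIntegral i (star G F n)) ∧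
    -- complex hyperbolic space
    ((∃! star, (KarabegovTrace.CH N).IsKarabegovStar star) ∧
      ∀ star, (KarabegovTrace.CH N).IsKarabegovStar star →
        ∀ (F G : (KarabegovTrace.CH N).Smooth), HasCompactSupport F.1 → HasCompactSupport G.1 →
        ∀ (i : (KarabegovTrace.CH N).ι) (n : ℕ),
          (KarabegovTrace.CH N).VolIntegrable i (star F G n) ∧
          (KarabegovTrace.CH N).VolIntegrable i (star G F n) ∧
          (KarabegovTrace.CH N).volIntegral i (star F G n) =
            (KarabegovTrace.CH N).volIntegral i (star G F n)) := by
  exact ⟨⟨KarabegovTrace.existsUnique_star_CP N, KarabegovTrace.trace_CP N⟩,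
    KarabegovTrace.existsUnique_star_CH N, KarabegovTrace.trace_CH N⟩
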